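/- **Circuits.** $\mathrm{LO_v}$-circuits $D:n\to m$ ($n,m\in\mathbb N$) are the morphisms of the PROP (strict symmetric monoidal category with objects $\mathbb N$; tensor $\oplus$, identities $I_n$, swap $\sigma:2\to2$, empty circuit $I_0$; in $D_1\oplus D_2$ the circuit $D_1$ is on the top wires, numbered first) generated by: the vacuum source $s:0\to1$, the vacuum detector $d:1\to0$, the phase shifters $P(\varphi):1\to1$, the wave plates $R(\theta):1\to1$, the beam splitters $B(\theta):2\to2$ ($\varphi,\theta\in\mathbb R$) and the polarising beam splitter $\mathrm{PBS}:2\to2$. Write $D_1;D_2$ for $D_2\circ D_1$, $I=I_1$, and $N=R(\pi/2);P(-\pi/2)$ for the negation. **Single-photon semantics.** Let $M_n=\{V,H\}\times\{0,\dots,n-1\}$, with elements written $c_p$. To $D:n\to m$ one associates the linear map $[\![D]\!]:\mathbb C^{M_n}\to\mathbb C^{M_m}$ given by $[\![D_1;D_2]\!]=[\![D_2]\!]\circ[\![D_1]\!]$, $[\![D_1\oplus D_2]\!]=[\![D_1]\!]\oplus[\![D_2]\!]$ (direct sum, positions of the second summand being shifted), identities to identities, $[\![s]\!]=[\![d]\!]=0$,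 $[\![P(\varphi)]\!]:|c_0\rangle\mapsto e^{i\varphi}|c_0\rangle$, $[\![B(\theta)]\!]:|c_p\rangle\mapsto\cos\theta\,|c_p\rangle+i\sin\theta\,|c_{1-p}\rangle$, $[\![R(\theta)]\!]:|V_0\rangle\mapsto\cos\theta\,|V_0\rangle+i\sin\theta\,|H_0\rangle,\ |H_0\rangle\mapsto\cos\theta\,|H_0\rangle+i\sin\theta\,|V_0\rangle$, $[\![\mathrm{PBS}]\!]:|V_p\rangle\mapsto|V_p\rangle,\ |H_p\rangle\mapsto|H_{1-p}\rangle$, and $[\![\sigma]\!]:|c_p\rangle\mapsto|c_{1-p}\rangle$. For $D:n\to n$ built from phase shifters, beam splitters and identities only, $[\![D]\!]_{\mathrm{pp}}:\mathbb C^n\to\mathbb C^n$ is the unique linear map with $[\![D]\!]\circ\iota=\iota\circ[\![D]\!]_{\mathrm{pp}}$, where $\iota|k\rangle=|H_k\rangle$. **The $\mathrm{LO_v}$-calculus.** $\mathrm{LO_v}\vdash D_1=D_2$ is the smallest congruence (for $;$ and $\oplus$) on circuits that satisfies the axioms of PROPs and, for all real parameters, the equations - $P(\varphi_1);P(\varphi_2)=P(\varphi_1+\varphi_2)$,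 $\ P(0)=I$, $\ B(0)=I\oplus I$; - $(N\oplus N);\mathrm{PBS};(N\oplus N)=\mathrm{PBS};\sigma$, $\ \mathrm{PBS};\mathrm{PBS}=I\oplus I$; - $(\mathrm{PBS}\oplus I);(I\oplus\mathrm{PBS});(\mathrm{PBS}\oplus I)=(\sigma\oplus I);(I\oplus\mathrm{PBS});(\sigma\oplus I)$; - $\mathrm{PBS};(N\oplus I);\mathrm{PBS}=(N\oplus I);\mathrm{PBS};(N\oplus I)$; - $s;d=I_0$, $\ s;P(\varphi)=s$, $\ s;R(\theta)=s$, $\ (s\oplus s);\mathrm{PBS}=s\oplus s$, $\ P(\varphi);d=d$, $\ R(\theta);d=d$, $\ \mathrm{PBS};(d\oplus d)=d\oplus d$; - $P(\varphi);R(\pi/2)=R(\pi/2);P(\varphi)$, $\ (P(\varphi)\oplus P(\varphi));\mathrm{PBS}=\mathrm{PBS};(P(\varphi)\oplus P(\varphi))$; - $B(\theta)=(I\oplus N);\mathrm{PBS};(R(\theta)\oplus R(\theta));\mathrm{PBS};(I\oplus N)$; - (Euler equation) $L=E$, where $$L=(B(\theta_1)\oplus I);(P(\varphi_2)\oplus P(\varphi_1)\oplus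 I);(I\oplus B(\theta_2));(B(\theta_3)\oplus I),$$ $$E=(I\oplus P(\beta_1)\oplus I);(I\oplus B(\alpha_1));(P(\beta_2)\oplus I\oplus I);(B(\alpha_2)\oplus I);(I\oplus P(\beta_3)\oplus I);(I\oplus B(\alpha_3));(P(\beta_4)\oplus P(\beta_5)\oplus P(\beta_6)),$$ the angles of $L$ are arbitrary, and those of $E$ are the unique $\alpha_1,\alpha_2,\alpha_3,\beta_1,\beta_2,\beta_3\in[0,\pi)$, $\beta_4,\beta_5,\beta_6\in[0,2\pi)$ with $[\![E]\!]_{\mathrm{pp}}=[\![L]\!]_{\mathrm{pp}}$, $\ \alpha_i\in\{0,\frac\pi2\}\Rightarrow\beta_i=0$ for $i=1,2,3$, and $\alpha_2=0\Rightarrow\alpha_1=0$. **Proposition.** Let $D_1,D_2:n\to m$ be $\mathrm{LO_v}$-circuits that contain no vacuum source $s$ and no vacuum detector $d$. If $[\![D_1]\!]=[\![D_2]\!]$, then $\mathrm{LO_v}\vdash D_1=D_2$. -/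

import Mathlib

noncomputable section

namespace LOv

/-! ### Syntax: the terms of the PROP of linear optical circuits -/

/-- Circuits `n → m`. `comp D₁ D₂` is `D₂ ∘ D₁` (first `D₁`, then `D₂`), `tensor D₁ D₂` is
`D₁ ⊕ D₂` with `D₁` on top, `idn n` is the identity on `n` wires and `symmetry a b` the symmetry of
the PROP, which moves the `a` top wires below the `b` others.
These are terms; the axioms of PROPs are imposed by the congruence `Provable` below. -/
inductive Circuit : ℕ → ℕ → Type
  | idn (n : ℕ) : Circuit n n
  | symmetry (a b : ℕ) : Circuit (a + b) (b + a)
  | comp {a b c : ℕ} (D₁ : Circuit a b) (D₂ : Circuit b c) : Circuit a c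
  | tensor {a b c d : ℕ} (D₁ : Circuit a b) (D₂ : Circuit c d) : Circuit (a + c) (b + d)
  /-- vacuum state source -/
  | source : Circuit 0 1
  /-- vacuum state detector -/
  | detector : Circuit 1 0
  /-- phase shifter -/
  | phase (φ : ℝ) : Circuit 1 1
  /-- wave plate (polarisation rotation) -/
  | polrot (θ : ℝ) : Circuit 1 1
  /-- beam splitter -/
  | bs (θ : ℝ) : Circuit 2 2
  /-- polarising beam splitter -/
  | pbs : Circuit 2 2

namespace Circuit

/-- The single wire. -/
abbrev wire : Circuit 1 1 := idn 1

/-- The empty circuit. -/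
abbrev empty : Circuit 0 0 := idn 0

/-- The swap of two wires. -/
abbrev swap : Circuit 2 2 := symmetry 1 1

/-- Transport along equalities of the numbers of wires; it does not change the circuit. -/
def castWires {n m n' m' : ℕ} (hn : n = n') (hm : m = m') (D : Circuit n m) : Circuit n' m' :=
  hn ▸ hm ▸ D

end Circuit

infixl:60 " ⨟ " => Circuit.comp
infixl:70 " ⊞ₗ " => Circuit.tensor

open Circuit

/-- The pola-negation, a shortcut for a wave plate of angle `π/2` and a phase shift `-π/2`. -/
def neg : Circuit 1 1 := polrot (Real.pi / 2) ⨟ phase (-(Real.pi / 2))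

/-- The circuit contains no vacuum state source and no vacuum state detector. -/
def Circuit.VacuumFree : {n m : ℕ} → Circuit n m → Prop
  | _, _, idn _ => True
  | _, _, symmetry _ _ => True
  | _, _, comp D₁ D₂ => D₁.VacuumFree ∧ D₂.VacuumFree
  | _, _, tensor D₁ D₂ => D₁.VacuumFree ∧ D₂.VacuumFree
  | _, _, source => False
  | _, _, detector => False
  | _, _, phase _ => True
  | _, _, polrot _ => True
  | _, _, bs _ => True
  | _, _, pbs => True

/-- Polarisation-preserving circuits: built from beam splitters, phase shifters and identities
by composition and tensor (no swaps). -/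
def Circuit.PolPreserving : {n m : ℕ} → Circuit n m → Prop
  | _, _, idn _ => True
  | _, _, symmetry _ _ => False
  | _, _, comp D₁ D₂ => D₁.PolPreserving ∧ D₂.PolPreserving
  | _, _, tensor D₁ D₂ => D₁.PolPreserving ∧ D₂.PolPreserving
  | _, _, source => False
  | _, _, detector => False
  | _, _, phase _ => True
  | _, _, polrot _ => False
  | _, _, bs _ => True
  | _, _, pbs => False

/-! ### Single-photon semantics -/

/-- Polarisations: vertical and horizontal. -/
inductive Pol
  | V
  | H
  deriving DecidableEq

instance : Fintype Pol := ⟨{Pol.V, Pol.H}, fun c => by cases c <;> simp⟩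

/-- Spatial and polarisation modes on `n` wires: the pair `(c, p)` is the mode `c_p`. -/
abbrev Modes (n : ℕ) : Type := Pol × Fin n

/-- The state space of a single photon on `n` wires. -/
abbrev State (n : ℕ) : Type := Modes n → ℂ

/-- The basis state of a mode. -/
def ket {n : ℕ} (x : Modes n) : State n := Pi.single x 1

/-- The linear map with given values on the basis states. -/
def onBasis {n m : ℕ} (f : Modes n → State m) : State n →ₗ[ℂ] State m :=
  (Pi.basisFun ℂ (Modes n)).constr ℂ f

/-- The inclusion `c_p ↦ c_p` of the states on the first `m` wires. -/
def inclTop (m m' : ℕ) : State m →ₗ[ℂ] State (m + m') :=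
  onBasis fun x => ket (x.1, Fin.castAdd m' x.2)

/-- The shift `c_p ↦ c_{p+m}` of the positions by `m`. -/
def shift (m m' : ℕ) : State m' →ₗ[ℂ] State (m + m') :=
  onBasis fun x => ket (x.1, Fin.natAdd m x.2)

/-- Direct sum of linear maps: `f` acts on the top wires and `g` on the bottom wires. -/
def directSum {n m n' m' : ℕ} (f : State n →ₗ[ℂ] State m) (g : State n' →ₗ[ℂ] State m') :
    State (n + n') →ₗ[ℂ] State (m + m') :=
  onBasis fun x =>
    Fin.addCases (motive := fun _ => State (m + m'))
      (fun k => inclTop m m' (f (ket (x.1, k))))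
      (fun k => shift m m' (g (ket (x.1, k)))) x.2

/-- The single-photon semantics of a circuit. -/
def interp : {n m : ℕ} → Circuit n m → (State n →ₗ[ℂ] State m)
  | _, _, idn _ => LinearMap.id
  | _, _, symmetry a b => onBasis fun x =>
      Fin.addCases (motive := fun _ => State (b + a))
        (fun k => ket (x.1, Fin.natAdd b k)) (fun k => ket (x.1, Fin.castAdd a k)) x.2
  | _, _, comp D₁ D₂ => interp D₂ ∘ₗ interp D₁
  | _, _, tensor D₁ D₂ => directSum (interp D₁) (interp D₂)
  | _, _, source => 0
  | _, _, detector => 0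
  | _, _, phase φ => onBasis fun x => Complex.exp (Complex.I * φ) • ket x
  | _, _, polrot θ => onBasis fun x =>
      match x with
      | (Pol.V, p) =>
        (Real.cos θ : ℂ) • ket (Pol.V, p) + (Complex.I * Real.sin θ) • ket (Pol.H, p)
      | (Pol.H, p) =>
        (Real.cos θ : ℂ) • ket (Pol.H, p) + (Complex.I * Real.sin θ) • ket (Pol.V, p)
  | _, _, bs θ => onBasis fun x =>
      (Real.cos θ : ℂ) • ket x + (Complex.I * Real.sin θ) • ket (x.1, 1 - x.2)
  | _, _, pbs => onBasis fun x =>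
      match x with
      | (Pol.V, p) => ket (Pol.V, p)
      | (Pol.H, p) => ket (Pol.H, 1 - p)

/-- The injection `k ↦ H_k`. -/
def iotaH (n : ℕ) : (Fin n → ℂ) →ₗ[ℂ] State n :=
  (Pi.basisFun ℂ (Fin n)).constr ℂ fun k => ket (Pol.H, k)

/-- The projection on the horizontal coordinates, a left inverse of `iotaH`. -/
def projH (n : ℕ) : State n →ₗ[ℂ] (Fin n → ℂ) :=
  LinearMap.funLeft ℂ ℂ fun k => (Pol.H, k)

/-- The spatial semantics. On a polarisation-preserving circuit `D` it is the unique map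
with `interp D ∘ iotaH = iotaH ∘ interpH D`; see `interpH_spec` and `interpH_unique`. -/
def interpH {n m : ℕ} (D : Circuit n m) : (Fin n → ℂ) →ₗ[ℂ] (Fin m → ℂ) :=
  projH m ∘ₗ interp D ∘ₗ iotaH n

theorem iotaH_single {n : ℕ} (k : Fin n) : iotaH n (Pi.single k 1) = ket (Pol.H, k) := by
  rw [iotaH, ← Pi.basisFun_apply, Module.Basis.constr_basis]

theorem onBasis_ket {n m : ℕ} (f : Modes n → State m) (x : Modes n) :
    onBasis f (ket x) = f x := by
  rw [onBasis, ket, ← Pi.basisFun_apply, Module.Basis.constr_basis]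

theorem projH_comp_iotaH (n : ℕ) : projH n ∘ₗ iotaH n = LinearMap.id := by
  refine (Pi.basisFun ℂ (Fin n)).ext fun k => ?_
  ext j
  simp [iotaH_single, projH, ket, LinearMap.funLeft_apply, Pi.single_apply]

theorem interpH_spec {n m : ℕ} (D : Circuit n m) (hD : D.PolPreserving) :
    interp D ∘ₗ iotaH n = iotaH m ∘ₗ interpH D := by
  have hex : ∃ f, interp D ∘ₗ iotaH n = iotaH m ∘ₗ f := by
    induction D with
    | idn n => exact ⟨LinearMap.id, by simp [interp]⟩
    | comp D₁ D₂ ih₁ ih₂ =>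
      obtain ⟨f, hf⟩ := ih₁ hD.1
      obtain ⟨g, hg⟩ := ih₂ hD.2
      refine ⟨g ∘ₗ f, ?_⟩
      rw [interp, LinearMap.comp_assoc, hf, ← LinearMap.comp_assoc, hg, LinearMap.comp_assoc]
    | tensor D₁ D₂ ih₁ ih₂ =>
      obtain ⟨f, hf⟩ := ih₁ hD.1
      obtain ⟨g, hg⟩ := ih₂ hD.2
      rename_i a b c d
      have hi : inclTop b d ∘ₗ iotaH b = iotaH (b + d) ∘ₗ
          (Pi.basisFun ℂ (Fin b)).constr ℂ fun k => Pi.single (Fin.castAdd d k) 1 := by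
        refine (Pi.basisFun ℂ _).ext fun k => ?_
        simp only [LinearMap.comp_apply, Module.Basis.constr_basis]
        simp [iotaH_single, inclTop, onBasis_ket]
      have hs : shift b d ∘ₗ iotaH d = iotaH (b + d) ∘ₗ
          (Pi.basisFun ℂ (Fin d)).constr ℂ fun k => Pi.single (Fin.natAdd b k) 1 := by
        refine (Pi.basisFun ℂ _).ext fun k => ?_
        simp only [LinearMap.comp_apply, Module.Basis.constr_basis]
        simp [iotaH_single, shift, onBasis_ket]
      refine ⟨(Pi.basisFun ℂ (Fin (a + c))).constr ℂ fun k =>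
        Fin.addCases (motive := fun _ => Fin (b + d) → ℂ)
          (fun k => (Pi.basisFun ℂ (Fin b)).constr ℂ
            (fun k => Pi.single (Fin.castAdd d k) 1) (f (Pi.single k 1)))
          (fun k => (Pi.basisFun ℂ (Fin d)).constr ℂ
            (fun k => Pi.single (Fin.natAdd b k) 1) (g (Pi.single k 1))) k,
        (Pi.basisFun ℂ _).ext fun k => ?_⟩
      simp only [LinearMap.comp_apply, Module.Basis.constr_basis]
      simp only [Pi.basisFun_apply, iotaH_single, interp, directSum, onBasis_ket]
      refine Fin.addCases (fun k => ?_) (fun k => ?_) k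
      · have h1 := LinearMap.congr_fun hf (Pi.single k 1)
        simp only [LinearMap.comp_apply, iotaH_single] at h1
        simp only [Fin.addCases_left, h1]
        exact LinearMap.congr_fun hi _
      · have h1 := LinearMap.congr_fun hg (Pi.single k 1)
        simp only [LinearMap.comp_apply, iotaH_single] at h1
        simp only [Fin.addCases_right, h1]
        exact LinearMap.congr_fun hs _
    | phase φ =>
      refine ⟨Complex.exp (Complex.I * φ) • LinearMap.id, (Pi.basisFun ℂ _).ext fun k => ?_⟩
      simp [interp, iotaH_single, onBasis_ket]
    | bs θ =>
      refine ⟨(Pi.basisFun ℂ (Fin 2)).constr ℂ fun k => (Real.cos θ : ℂ) • Pi.single k 1 +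
        (Complex.I * Real.sin θ) • Pi.single (1 - k) 1, (Pi.basisFun ℂ _).ext fun k => ?_⟩
      simp only [LinearMap.comp_apply, Module.Basis.constr_basis]
      simp only [Pi.basisFun_apply, iotaH_single, interp, onBasis_ket, map_add, map_smul]
    | _ => exact hD.elim
  obtain ⟨f, hf⟩ := hex
  rw [interpH, hf, ← LinearMap.comp_assoc f, projH_comp_iotaH, LinearMap.id_comp]

theorem interpH_unique {n m : ℕ} (D : Circuit n m) (f : (Fin n → ℂ) →ₗ[ℂ] (Fin m → ℂ))
    (hf : interp D ∘ₗ iotaH n = iotaH m ∘ₗ f) : f = interpH D := by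
  rw [interpH, hf, ← LinearMap.comp_assoc, projH_comp_iotaH, LinearMap.id_comp]

/-! ### The equational theory -/

/-- A circuit on wires `0, 1` as a circuit on three wires. -/
def onTop (D : Circuit 2 2) : Circuit 3 3 := D ⊞ₗ wire

/-- A circuit on wires `1, 2` as a circuit on three wires. -/
def onBottom (D : Circuit 2 2) : Circuit 3 3 := wire ⊞ₗ D

/-- Three one-wire circuits in parallel. -/
def parallel (D₀ D₁ D₂ : Circuit 1 1) : Circuit 3 3 := D₀ ⊞ₗ D₁ ⊞ₗ D₂

/-- Left-hand side of the Euler equation: beam splitters on wires `01`, `12`, `01`. -/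
def eulerLeft (θ₁ θ₂ θ₃ φ₁ φ₂ : ℝ) : Circuit 3 3 :=
  onTop (bs θ₁) ⨟ parallel (phase φ₂) (phase φ₁) wire ⨟ onBottom (bs θ₂) ⨟ onTop (bs θ₃)

/-- Right-hand side of the Euler equation: beam splitters on wires `12`, `01`, `12`. -/
def eulerRight (α₁ α₂ α₃ β₁ β₂ β₃ β₄ β₅ β₆ : ℝ) : Circuit 3 3 :=
  parallel wire (phase β₁) wire ⨟ onBottom (bs α₁) ⨟
  parallel (phase β₂) wire wire ⨟ onTop (bs α₂) ⨟
  parallel wire (phase β₃) wire ⨟ onBottom (bs α₃) ⨟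
  parallel (phase β₄) (phase β₅) (phase β₆)

/-- The conditions that make the angles of `eulerRight` unique for a given unitary. -/
structure EulerAngles (α₁ α₂ α₃ β₁ β₂ β₃ β₄ β₅ β₆ : ℝ) : Prop where
  hα₁ : α₁ ∈ Set.Ico 0 Real.pi
  hα₂ : α₂ ∈ Set.Ico 0 Real.pi
  hα₃ : α₃ ∈ Set.Ico 0 Real.pi
  hβ₁ : β₁ ∈ Set.Ico 0 Real.pi
  hβ₂ : β₂ ∈ Set.Ico 0 Real.pi
  hβ₃ : β₃ ∈ Set.Ico 0 Real.pi
  hβ₄ : β₄ ∈ Set.Ico 0 (2 * Real.pi)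
  hβ₅ : β₅ ∈ Set.Ico 0 (2 * Real.pi)
  hβ₆ : β₆ ∈ Set.Ico 0 (2 * Real.pi)
  hαβ₁ : α₁ = 0 ∨ α₁ = Real.pi / 2 → β₁ = 0
  hαβ₂ : α₂ = 0 ∨ α₂ = Real.pi / 2 → β₂ = 0
  hαβ₃ : α₃ = 0 ∨ α₃ = Real.pi / 2 → β₃ = 0
  hα₂₁ : α₂ = 0 → α₁ = 0

/-- `Provable D₁ D₂`: the equation `D₁ = D₂` is derivable in the `LOv`-calculus. This is the
smallest congruence that satisfies the axioms of PROPs and the equations of the calculus. -/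
inductive Provable : {n m : ℕ} → Circuit n m → Circuit n m → Prop
  /- congruence -/
  | refl {n m : ℕ} (D : Circuit n m) : Provable D D
  | symm {n m : ℕ} {D D' : Circuit n m} : Provable D D' → Provable D' D
  | trans {n m : ℕ} {D D' D'' : Circuit n m} : Provable D D' → Provable D' D'' → Provable D D''
  | comp_congr {a b c : ℕ} {D₁ D₁' : Circuit a b} {D₂ D₂' : Circuit b c} :
      Provable D₁ D₁' → Provable D₂ D₂' → Provable (D₁ ⨟ D₂) (D₁' ⨟ D₂')
  | tensor_congr {a b c d : ℕ} {D₁ D₁' : Circuit a b} {D₂ D₂' : Circuit c d} :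
      Provable D₁ D₁' → Provable D₂ D₂' → Provable (D₁ ⊞ₗ D₂) (D₁' ⊞ₗ D₂')
  /- axioms of PROPs: strict symmetric monoidal category -/
  | id_comp {n m : ℕ} (D : Circuit n m) : Provable (idn n ⨟ D) D
  | comp_id {n m : ℕ} (D : Circuit n m) : Provable (D ⨟ idn m) D
  | comp_assoc {a b c d : ℕ} (D₁ : Circuit a b) (D₂ : Circuit b c) (D₃ : Circuit c d) :
      Provable (D₁ ⨟ D₂ ⨟ D₃) (D₁ ⨟ (D₂ ⨟ D₃))
  | tensor_id (n m : ℕ) : Provable (idn n ⊞ₗ idn m) (idn (n + m))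
  | interchange {a b c a' b' c' : ℕ} (D₁ : Circuit a b) (D₂ : Circuit b c)
      (D₁' : Circuit a' b') (D₂' : Circuit b' c') :
      Provable ((D₁ ⨟ D₂) ⊞ₗ (D₁' ⨟ D₂')) ((D₁ ⊞ₗ D₁') ⨟ (D₂ ⊞ₗ D₂'))
  | empty_tensor {n m : ℕ} (D : Circuit n m) :
      Provable (castWires (Nat.zero_add n) (Nat.zero_add m) (empty ⊞ₗ D)) D
  | tensor_empty {n m : ℕ} (D : Circuit n m) : Provable (D ⊞ₗ empty) D
  | tensor_assoc {a b a' b' a'' b'' : ℕ} (D : Circuit a b) (D' : Circuit a' b')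
      (D'' : Circuit a'' b'') :
      Provable (castWires (Nat.add_assoc a a' a'') (Nat.add_assoc b b' b'') (D ⊞ₗ D' ⊞ₗ D''))
        (D ⊞ₗ (D' ⊞ₗ D''))
  | symm_natural {a b c d : ℕ} (D : Circuit a b) (D' : Circuit c d) :
      Provable ((D ⊞ₗ D') ⨟ symmetry b d) (symmetry a c ⨟ (D' ⊞ₗ D))
  | symm_symm (a b : ℕ) : Provable (symmetry a b ⨟ symmetry b a) (idn (a + b))
  | hexagon (a b c : ℕ) :
      Provable (symmetry a (b + c))
        (castWires (Nat.add_assoc a b c) (Nat.add_assoc b a c) (symmetry a b ⊞ₗ idn c) ⨟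
          castWires rfl (Nat.add_assoc b c a).symm (idn b ⊞ₗ symmetry a c))
  /- equations of the calculus -/
  | phase_add (φ₁ φ₂ : ℝ) : Provable (phase φ₁ ⨟ phase φ₂) (phase (φ₁ + φ₂))
  | phase_zero : Provable (phase 0) wire
  | bs_zero : Provable (bs 0) (wire ⊞ₗ wire)
  | pbs_neg : Provable ((neg ⊞ₗ neg) ⨟ pbs ⨟ (neg ⊞ₗ neg)) (pbs ⨟ swap)
  | pbs_pbs : Provable (pbs ⨟ pbs) (wire ⊞ₗ wire)
  | pbs_pbs_pbs :
      Provable (onTop pbs ⨟ onBottom pbs ⨟ onTop pbs)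
        (onTop swap ⨟ onBottom pbs ⨟ onTop swap)
  | pbs_neg_pbs :
      Provable (pbs ⨟ (neg ⊞ₗ wire) ⨟ pbs) ((neg ⊞ₗ wire) ⨟ pbs ⨟ (neg ⊞ₗ wire))
  | source_detector : Provable (source ⨟ detector) empty
  | source_phase (φ : ℝ) : Provable (source ⨟ phase φ) source
  | source_polrot (θ : ℝ) : Provable (source ⨟ polrot θ) source
  | source_pbs : Provable ((source ⊞ₗ source) ⨟ pbs) (source ⊞ₗ source)
  | phase_detector (φ : ℝ) : Provable (phase φ ⨟ detector) detector
  | polrot_detector (θ : ℝ) : Provable (polrot θ ⨟ detector) detector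
  | pbs_detector : Provable (pbs ⨟ (detector ⊞ₗ detector)) (detector ⊞ₗ detector)
  | phase_polrot (φ : ℝ) :
      Provable (phase φ ⨟ polrot (Real.pi / 2)) (polrot (Real.pi / 2) ⨟ phase φ)
  | phase_pbs (φ : ℝ) :
      Provable ((phase φ ⊞ₗ phase φ) ⨟ pbs) (pbs ⨟ (phase φ ⊞ₗ phase φ))
  | bs_emulation (θ : ℝ) :
      Provable (bs θ)
        ((wire ⊞ₗ neg) ⨟ pbs ⨟ (polrot θ ⊞ₗ polrot θ) ⨟ pbs ⨟ (wire ⊞ₗ neg))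
  | euler (θ₁ θ₂ θ₃ φ₁ φ₂ α₁ α₂ α₃ β₁ β₂ β₃ β₄ β₅ β₆ : ℝ)
      (hangles : EulerAngles α₁ α₂ α₃ β₁ β₂ β₃ β₄ β₅ β₆)
      (hU : interpH (eulerRight α₁ α₂ α₃ β₁ β₂ β₃ β₄ β₅ β₆) =
        interpH (eulerLeft θ₁ θ₂ θ₃ φ₁ φ₂)) :
      Provable (eulerLeft θ₁ θ₂ θ₃ φ₁ φ₂) (eulerRight α₁ α₂ α₃ β₁ β₂ β₃ β₄ β₅ β₆)

end LOv

end

noncomputable section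

namespace LOv

open Circuit

/-! ### Pointwise description of the semantics -/

/-! A vacuum-free circuit on n wires acts on 2n modes, and it can be traded for a circuit on 2n
wires in which polarisation plays no role. The circuit `split` adds a vacuum below a wire and sends
the vertical part to the top wire and the horizontal part, made vertical, to the bottom one. `splits
n` does this on every wire, and s;d = I₀ gives it the left inverse `merges n`. Each vacuum-free
generator slides through `splits` (`VGen.exists_spatial`): a phase shifter becomes two phase
shifters, a wave plate becomes a beam splitter, the polarising beam splitter becomes the exchange of
the two horizontal wires (`pb_comp_split_tensor_split`), and a swap becomes a swap of pairs. Swaps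
are themselves beam splitters of angle π/2 up to phases. So every vacuum-free f satisfies f;splits =
splits;f' with f' in `Spatial`, the circuits of phase shifters and beam splitters. Every vertical
basis state lies in the image of `splits`, so if f and g have the same semantics then f' and g'
agree on vertical states. Completeness of `Spatial` gives f' = g', and composing with `merges` gives
f = g.

Completeness of `Spatial` rests on the Euler equation. Every 3×3 unitary has Euler angles
(`exists_eulerAngles`), so left-hand sides with the same matrix are provably equal. With a trivial
middle beam splitter this gives the two-wire laws and the normal form `NF2`. In general it rewrites
a product on wires 01, 12, 01 as one on 12, 01, 12, and reversing the wires gives the converse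
(`exists_Bo_T_Bo`). Hence every spatial circuit is a circuit on all wires but the last followed by a
staircase (`Spatial.exists_stair`). If the whole is semantically the identity, the first step of the
staircase is only a phase on its upper wire, so the last wire is bare and induction applies
(`Spatial.eq_one_of_sem`). Invertibility reduces equality of two circuits to this case. -/

theorem hom_ext_ket {n : ℕ} {E : Type*} [AddCommMonoid E] [Module ℂ E] {f g : State n →ₗ[ℂ] E}
    (h : ∀ x, f (ket x) = g (ket x)) : f = g :=
  (Pi.basisFun ℂ (Modes n)).ext fun x => by simpa [ket] using h x

/-- The restriction of a state to the top wires. -/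
def topL (n m : ℕ) : State (n + m) →ₗ[ℂ] State n :=
  LinearMap.funLeft ℂ ℂ fun a => (a.1, Fin.castAdd m a.2)

/-- The restriction of a state to the bottom wires. -/
def botL (n m : ℕ) : State (n + m) →ₗ[ℂ] State m :=
  LinearMap.funLeft ℂ ℂ fun a => (a.1, Fin.natAdd n a.2)

theorem topL_apply {n m : ℕ} (x : State (n + m)) (c : Pol) (k : Fin n) :
    topL n m x (c, k) = x (c, Fin.castAdd m k) := rfl

theorem botL_apply {n m : ℕ} (x : State (n + m)) (c : Pol) (k : Fin m) :
    botL n m x (c, k) = x (c, Fin.natAdd n k) := rfl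

theorem state_ext {n m : ℕ} {x y : State (n + m)} (h₁ : topL n m x = topL n m y)
    (h₂ : botL n m x = botL n m y) : x = y := by
  funext ⟨c, k⟩
  refine Fin.addCases (fun k => ?_) (fun k => ?_) k
  · exact congrFun h₁ (c, k)
  · exact congrFun h₂ (c, k)

theorem ket_apply {n : ℕ} (x y : Modes n) : ket x y = if y = x then 1 else 0 := by
  simp [ket, Pi.single_apply]

theorem topL_ket_castAdd {n m : ℕ} (c : Pol) (k : Fin n) :
    topL n m (ket (c, Fin.castAdd m k)) = ket (c, k) := by
  funext ⟨c', k'⟩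
  simp [topL_apply, ket_apply, Fin.ext_iff]

theorem topL_ket_natAdd {n m : ℕ} (c : Pol) (k : Fin m) :
    topL n m (ket (c, Fin.natAdd n k)) = 0 := by
  funext ⟨c', k'⟩
  have : (k' : ℕ) ≠ n + k := by omega
  simp [topL_apply, ket_apply, Fin.ext_iff, this]

theorem botL_ket_castAdd {n m : ℕ} (c : Pol) (k : Fin n) :
    botL n m (ket (c, Fin.castAdd m k)) = 0 := by
  funext ⟨c', k'⟩
  have : n + (k' : ℕ) ≠ k := by omega
  simp [botL_apply, ket_apply, Fin.ext_iff, this]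

theorem botL_ket_natAdd {n m : ℕ} (c : Pol) (k : Fin m) :
    botL n m (ket (c, Fin.natAdd n k)) = ket (c, k) := by
  funext ⟨c', k'⟩
  simp [botL_apply, ket_apply, Fin.ext_iff]

theorem topL_inclTop (n m : ℕ) (x : State n) : topL n m (inclTop n m x) = x := by
  suffices h : topL n m ∘ₗ inclTop n m = LinearMap.id from LinearMap.congr_fun h x
  exact hom_ext_ket fun x => by simp [inclTop, onBasis_ket, topL_ket_castAdd]

theorem botL_inclTop (n m : ℕ) (x : State n) : botL n m (inclTop n m x) = 0 := by
  suffices h : botL n m ∘ₗ inclTop n m = 0 from LinearMap.congr_fun h x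
  exact hom_ext_ket fun x => by simp [inclTop, onBasis_ket, botL_ket_castAdd]

theorem topL_shift (n m : ℕ) (x : State m) : topL n m (shift n m x) = 0 := by
  suffices h : topL n m ∘ₗ shift n m = 0 from LinearMap.congr_fun h x
  exact hom_ext_ket fun x => by simp [shift, onBasis_ket, topL_ket_natAdd]

theorem botL_shift (n m : ℕ) (x : State m) : botL n m (shift n m x) = x := by
  suffices h : botL n m ∘ₗ shift n m = LinearMap.id from LinearMap.congr_fun h x
  exact hom_ext_ket fun x => by simp [shift, onBasis_ket, botL_ket_natAdd]

theorem topL_directSum {n m n' m' : ℕ} (f : State n →ₗ[ℂ] State m) (g : State n' →ₗ[ℂ] State m')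
    (x : State (n + n')) : topL m m' (directSum f g x) = f (topL n n' x) := by
  suffices h : topL m m' ∘ₗ directSum f g = f ∘ₗ topL n n' from LinearMap.congr_fun h x
  refine hom_ext_ket fun ⟨c, k⟩ => ?_
  refine Fin.addCases (fun k => ?_) (fun k => ?_) k
  · simp [directSum, onBasis_ket, topL_inclTop, topL_ket_castAdd]
  · simp [directSum, onBasis_ket, topL_shift, topL_ket_natAdd]

theorem botL_directSum {n m n' m' : ℕ} (f : State n →ₗ[ℂ] State m) (g : State n' →ₗ[ℂ] State m')
    (x : State (n + n')) : botL m m' (directSum f g x) = g (botL n n' x) := by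
  suffices h : botL m m' ∘ₗ directSum f g = g ∘ₗ botL n n' from LinearMap.congr_fun h x
  refine hom_ext_ket fun ⟨c, k⟩ => ?_
  refine Fin.addCases (fun k => ?_) (fun k => ?_) k
  · simp [directSum, onBasis_ket, botL_inclTop, botL_ket_castAdd]
  · simp [directSum, onBasis_ket, botL_shift, botL_ket_natAdd]

theorem topL_symmetry (a b : ℕ) (x : State (a + b)) :
    topL b a (interp (symmetry a b) x) = botL a b x := by
  suffices h : topL b a ∘ₗ interp (symmetry a b) = botL a b from LinearMap.congr_fun h x
  refine hom_ext_ket fun ⟨c, k⟩ => ?_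
  refine Fin.addCases (fun k => ?_) (fun k => ?_) k
  · simp [interp, onBasis_ket, topL_ket_natAdd, botL_ket_castAdd]
  · simp [interp, onBasis_ket, topL_ket_castAdd, botL_ket_natAdd]

theorem botL_symmetry (a b : ℕ) (x : State (a + b)) :
    botL b a (interp (symmetry a b) x) = topL a b x := by
  suffices h : botL b a ∘ₗ interp (symmetry a b) = topL a b from LinearMap.congr_fun h x
  refine hom_ext_ket fun ⟨c, k⟩ => ?_
  refine Fin.addCases (fun k => ?_) (fun k => ?_) k
  · simp [interp, onBasis_ket, botL_ket_natAdd, topL_ket_castAdd]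
  · simp [interp, onBasis_ket, botL_ket_castAdd, topL_ket_natAdd]

theorem apply_eq_of_ket {n m : ℕ} {f : State n →ₗ[ℂ] State m} (g : Modes n → State m)
    (hf : ∀ a, f (ket a) = g a) (x : State n) (b : Modes m) : f x b = ∑ a, x a * g a b := by
  have hx : x = ∑ a, x a • ket a := by
    funext b
    simp [Finset.sum_apply, ket_apply]
  conv_lhs => rw [hx]
  simp [map_sum, hf, Finset.sum_apply]

theorem sum_pol {E : Type*} [AddCommMonoid E] (f : Pol → E) : ∑ c, f c = f Pol.V + f Pol.H :=
  Finset.sum_pair (by simp)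

theorem interp_phase_apply (φ : ℝ) (x : State 1) (b : Modes 1) :
    interp (phase φ) x b = Complex.exp (Complex.I * φ) * x b := by
  rw [apply_eq_of_ket _ fun a => by rw [interp, onBasis_ket]]
  simp [ket_apply, mul_comm]

theorem interp_bs_apply (θ : ℝ) (x : State 2) (c : Pol) (p : Fin 2) :
    interp (bs θ) x (c, p) =
      Complex.cos θ * x (c, p) + Complex.I * Complex.sin θ * x (c, 1 - p) := by
  rw [apply_eq_of_ket _ fun a => by rw [interp, onBasis_ket], Fintype.sum_prod_type, sum_pol,
    Fin.sum_univ_two, Fin.sum_univ_two]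
  cases c <;> fin_cases p <;> simp [ket_apply] <;> ring

theorem interp_polrot_V (θ : ℝ) (x : State 1) (p : Fin 1) :
    interp (polrot θ) x (Pol.V, p) =
      Complex.cos θ * x (Pol.V, p) + Complex.I * Complex.sin θ * x (Pol.H, p) := by
  rw [apply_eq_of_ket _ fun a => by rw [interp, onBasis_ket], Fintype.sum_prod_type, sum_pol]
  fin_cases p
  simp [ket_apply]; ring

theorem interp_polrot_H (θ : ℝ) (x : State 1) (p : Fin 1) :
    interp (polrot θ) x (Pol.H, p) =
      Complex.cos θ * x (Pol.H, p) + Complex.I * Complex.sin θ * x (Pol.V, p) := by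
  rw [apply_eq_of_ket _ fun a => by rw [interp, onBasis_ket], Fintype.sum_prod_type, sum_pol]
  fin_cases p
  simp [ket_apply]; ring

theorem interp_pbs_V (x : State 2) (p : Fin 2) : interp pbs x (Pol.V, p) = x (Pol.V, p) := by
  rw [apply_eq_of_ket _ fun a => by rw [interp, onBasis_ket], Fintype.sum_prod_type, sum_pol,
    Fin.sum_univ_two, Fin.sum_univ_two]
  fin_cases p <;> simp [ket_apply]

theorem interp_pbs_H (x : State 2) (p : Fin 2) : interp pbs x (Pol.H, p) = x (Pol.H, 1 - p) := by
  rw [apply_eq_of_ket _ fun a => by rw [interp, onBasis_ket], Fintype.sum_prod_type, sum_pol,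
    Fin.sum_univ_two, Fin.sum_univ_two]
  fin_cases p <;> simp [ket_apply]

/-- Transport of states along an equality of the numbers of wires. -/
def castState {n m : ℕ} (h : n = m) : State n →ₗ[ℂ] State m :=
  LinearMap.funLeft ℂ ℂ fun a => (a.1, Fin.cast h.symm a.2)

theorem castState_self {n : ℕ} (h : n = n) (x : State n) : castState h x = x := rfl

theorem castState_castState {n m k : ℕ} (h : n = m) (h' : m = k) (x : State n) :
    castState h' (castState h x) = castState (h.trans h') x := rfl

theorem interp_castWires {n m n' m' : ℕ} (hn : n = n') (hm : m = m') (D : Circuit n m)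
    (x : State n') :
    interp (castWires hn hm D) x = castState hm (interp D (castState hn.symm x)) := by
  subst hn hm
  rfl

theorem topL_castState_assoc {a b c : ℕ} (h : a + b + c = a + (b + c)) (x : State (a + b + c)) :
    topL a (b + c) (castState h x) = topL a b (topL (a + b) c x) := rfl

theorem topL_botL_castState_assoc {a b c : ℕ} (h : a + b + c = a + (b + c))
    (x : State (a + b + c)) :
    topL b c (botL a (b + c) (castState h x)) = botL a b (topL (a + b) c x) := rfl

theorem botL_botL_castState_assoc {a b c : ℕ} (h : a + b + c = a + (b + c))
    (x : State (a + b + c)) :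
    botL b c (botL a (b + c) (castState h x)) = botL (a + b) c x := by
  funext ⟨p, k⟩
  simp only [botL_apply, castState, LinearMap.funLeft_apply]
  congr 2
  simp [Fin.ext_iff, Nat.add_assoc]

theorem botL_castState_symm {a b c : ℕ} (h : a + (b + c) = a + b + c)
    (x : State (a + (b + c))) :
    botL (a + b) c (castState h x) = botL b c (botL a (b + c) x) :=
  (botL_botL_castState_assoc h.symm (castState h x)).symm

theorem topL_topL_castState_symm {a b c : ℕ} (h : a + (b + c) = a + b + c)
    (x : State (a + (b + c))) :
    topL a b (topL (a + b) c (castState h x)) = topL a (b + c) x := rfl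

theorem botL_topL_castState_symm {a b c : ℕ} (h : a + (b + c) = a + b + c)
    (x : State (a + (b + c))) :
    botL a b (topL (a + b) c (castState h x)) = topL b c (botL a (b + c) x) := rfl

theorem topL_interp_tensor {n m n' m' : ℕ} (D : Circuit n m) (D' : Circuit n' m')
    (x : State (n + n')) : topL m m' (interp (D ⊞ₗ D') x) = interp D (topL n n' x) :=
  topL_directSum _ _ x

theorem botL_interp_tensor {n m n' m' : ℕ} (D : Circuit n m) (D' : Circuit n' m')
    (x : State (n + n')) : botL m m' (interp (D ⊞ₗ D') x) = interp D' (botL n n' x) :=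
  botL_directSum _ _ x

theorem interp_comp_apply {a b c : ℕ} (D₁ : Circuit a b) (D₂ : Circuit b c) (x : State a) :
    interp (D₁ ⨟ D₂) x = interp D₂ (interp D₁ x) := rfl

theorem interp_idn_apply {n : ℕ} (x : State n) : interp (idn n) x = x := rfl

/-! ### Soundness of the structural axioms that involve transports. -/

theorem sound_empty_tensor {n m : ℕ} (D : Circuit n m) :
    interp (castWires (Nat.zero_add n) (Nat.zero_add m) (empty ⊞ₗ D)) = interp D := by
  have h (n : ℕ) (x : State (0 + n)) : castState (Nat.zero_add n) x = botL 0 n x := by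
    funext ⟨c, k⟩
    simp only [castState, botL_apply, LinearMap.funLeft_apply]
    congr 2
    simp
  refine LinearMap.ext fun x => ?_
  rw [interp_castWires, h, botL_interp_tensor, ← h, castState_castState, castState_self]

theorem sound_tensor_assoc {a b a' b' a'' b'' : ℕ} (D : Circuit a b) (D' : Circuit a' b')
    (D'' : Circuit a'' b'') :
    interp (castWires (Nat.add_assoc a a' a'') (Nat.add_assoc b b' b'') (D ⊞ₗ D' ⊞ₗ D'')) =
      interp (D ⊞ₗ (D' ⊞ₗ D'')) := by
  refine LinearMap.ext fun x => ?_
  rw [interp_castWires]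
  refine state_ext ?_ (state_ext ?_ ?_)
  · simp only [topL_castState_assoc, topL_interp_tensor, topL_topL_castState_symm]
  · simp only [topL_botL_castState_assoc, topL_interp_tensor, botL_interp_tensor,
      botL_topL_castState_symm]
  · simp only [botL_botL_castState_assoc, botL_interp_tensor, botL_castState_symm]

theorem sound_hexagon (a b c : ℕ) :
    interp (symmetry a (b + c)) =
      interp (castWires (Nat.add_assoc a b c) (Nat.add_assoc b a c) (symmetry a b ⊞ₗ idn c) ⨟
          castWires rfl (Nat.add_assoc b c a).symm (idn b ⊞ₗ symmetry a c)) := by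
  refine LinearMap.ext fun x => ?_
  rw [interp_comp_apply, interp_castWires, interp_castWires, castState_self]
  refine state_ext (state_ext ?_ ?_) ?_
  · simp only [topL_symmetry, topL_topL_castState_symm, topL_interp_tensor, interp_idn_apply,
      topL_castState_assoc, botL_topL_castState_symm]
  · simp only [topL_symmetry, botL_topL_castState_symm, botL_interp_tensor, interp_idn_apply,
      botL_castState_symm, botL_botL_castState_assoc]
  · simp only [botL_symmetry, botL_castState_symm, botL_interp_tensor,
      topL_botL_castState_assoc, topL_interp_tensor, topL_topL_castState_symm]

/-- Phase shifters and beam splitters act by the same formula on both polarisations. The side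
condition of the Euler equation concerns horizontal modes only, and this extends it to the full
semantics. -/
theorem interp_congr_of_polPreserving {n m : ℕ} (D : Circuit n m) (hD : D.PolPreserving)
    {c c' : Pol} {x x' : State n} (h : ∀ j, x (c, j) = x' (c', j)) (k : Fin m) :
    interp D x (c, k) = interp D x' (c', k) := by
  induction D with
  | idn n => exact h k
  | comp D₁ D₂ ih₁ ih₂ => exact ih₂ hD.2 (fun j => ih₁ hD.1 h j) k
  | tensor D₁ D₂ ih₁ ih₂ =>
    refine Fin.addCases (fun k => ?_) (fun k => ?_) k
    · rw [← topL_apply (interp _ x), ← topL_apply (interp _ x'), topL_interp_tensor,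
        topL_interp_tensor]
      exact ih₁ hD.1 (fun j => h _) k
    · rw [← botL_apply (interp _ x), ← botL_apply (interp _ x'), botL_interp_tensor,
        botL_interp_tensor]
      exact ih₂ hD.2 (fun j => h _) k
  | phase φ => simp only [interp_phase_apply, h]
  | bs θ => simp only [interp_bs_apply, h]
  | _ => exact hD.elim

theorem iotaH_apply_H {n : ℕ} (v : Fin n → ℂ) (j : Fin n) : iotaH n v (Pol.H, j) = v j :=
  congrFun (LinearMap.congr_fun (projH_comp_iotaH n) v) j

/-- On a polarisation-preserving circuit the spatial semantics determines the semantics. -/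
theorem interp_apply_of_polPreserving {n m : ℕ} (D : Circuit n m) (hD : D.PolPreserving)
    (x : State n) (c : Pol) (k : Fin m) :
    interp D x (c, k) = interpH D (fun j => x (c, j)) k :=
  interp_congr_of_polPreserving D hD (fun j => (iotaH_apply_H (fun j => x (c, j)) j).symm) k

/-! ### Coordinates on few wires and soundness of the optical axioms. -/

theorem interp_tensor_zero {D D' : Circuit 1 1} (x : State 2) (c : Pol) :
    interp (D ⊞ₗ D') x (c, (0 : Fin 2)) = interp D (fun a => x (a.1, 0)) (c, 0) := by
  have h := congrFun (topL_interp_tensor D D' x) (c, 0)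
  refine h.trans (congrArg (fun y => interp D y (c, 0)) ?_)
  funext ⟨c, p⟩
  fin_cases p
  rfl

theorem interp_tensor_one {D D' : Circuit 1 1} (x : State 2) (c : Pol) :
    interp (D ⊞ₗ D') x (c, (1 : Fin 2)) = interp D' (fun a => x (a.1, 1)) (c, 0) := by
  have h := congrFun (botL_interp_tensor D D' x) (c, 0)
  refine h.trans (congrArg (fun y => interp D' y (c, 0)) ?_)
  funext ⟨c, p⟩
  fin_cases p
  rfl

theorem interp_swap_zero (x : State 2) (c : Pol) :
    interp swap x (c, (0 : Fin 2)) = x (c, 1) :=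
  congrFun (topL_symmetry 1 1 x) (c, 0)

theorem interp_swap_one (x : State 2) (c : Pol) :
    interp swap x (c, (1 : Fin 2)) = x (c, 0) :=
  congrFun (botL_symmetry 1 1 x) (c, 0)

theorem interp_onTop_zero (D : Circuit 2 2) (x : State 3) (c : Pol) :
    interp (onTop D) x (c, (0 : Fin 3)) = interp D (fun a => x (a.1, Fin.castAdd 1 a.2)) (c, 0) :=
  congrFun (topL_interp_tensor D wire x) (c, 0)

theorem interp_onTop_one (D : Circuit 2 2) (x : State 3) (c : Pol) :
    interp (onTop D) x (c, (1 : Fin 3)) = interp D (fun a => x (a.1, Fin.castAdd 1 a.2)) (c, 1) :=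
  congrFun (topL_interp_tensor D wire x) (c, 1)

theorem interp_onTop_two (D : Circuit 2 2) (x : State 3) (c : Pol) :
    interp (onTop D) x (c, (2 : Fin 3)) = x (c, 2) :=
  congrFun (botL_interp_tensor D wire x) (c, 0)

theorem interp_onBottom_zero (D : Circuit 2 2) (x : State 3) (c : Pol) :
    interp (onBottom D) x (c, (0 : Fin 3)) = x (c, 0) :=
  congrFun (topL_interp_tensor wire D x) (c, 0)

theorem interp_onBottom_one (D : Circuit 2 2) (x : State 3) (c : Pol) :
    interp (onBottom D) x (c, (1 : Fin 3)) =
      interp D (fun a => x (a.1, Fin.natAdd 1 a.2)) (c, 0) :=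
  congrFun (botL_interp_tensor wire D x) (c, 0)

theorem interp_onBottom_two (D : Circuit 2 2) (x : State 3) (c : Pol) :
    interp (onBottom D) x (c, (2 : Fin 3)) =
      interp D (fun a => x (a.1, Fin.natAdd 1 a.2)) (c, 1) :=
  congrFun (botL_interp_tensor wire D x) (c, 1)

theorem interp_neg_V (x : State 1) (p : Fin 1) : interp neg x (Pol.V, p) = x (Pol.H, p) := by
  rw [neg, interp_comp_apply, interp_phase_apply, interp_polrot_V]
  have : Complex.exp (Complex.I * (-(Real.pi / 2) : ℝ)) = -Complex.I := by
    rw [mul_comm]; push_cast; rw [Complex.exp_mul_I]; simp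
  rw [this]
  push_cast
  simp only [Complex.cos_pi_div_two, Complex.sin_pi_div_two]
  linear_combination -x (Pol.H, p) * Complex.I_mul_I

theorem interp_neg_H (x : State 1) (p : Fin 1) : interp neg x (Pol.H, p) = x (Pol.V, p) := by
  rw [neg, interp_comp_apply, interp_phase_apply, interp_polrot_H]
  have : Complex.exp (Complex.I * (-(Real.pi / 2) : ℝ)) = -Complex.I := by
    rw [mul_comm]; push_cast; rw [Complex.exp_mul_I]; simp
  rw [this]
  push_cast
  simp only [Complex.cos_pi_div_two, Complex.sin_pi_div_two]
  linear_combination -x (Pol.V, p) * Complex.I_mul_I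

theorem interp_ext_two {D D' : Circuit 2 2}
    (h : ∀ x c, interp D x (c, 0) = interp D' x (c, 0) ∧ interp D x (c, 1) = interp D' x (c, 1)) :
    interp D = interp D' := by
  refine LinearMap.ext fun x => funext fun ⟨c, p⟩ => ?_
  fin_cases p
  exacts [(h x c).1, (h x c).2]

theorem sound_pbs_neg :
    interp ((neg ⊞ₗ neg) ⨟ pbs ⨟ (neg ⊞ₗ neg)) = interp (pbs ⨟ swap) := by
  refine interp_ext_two fun x c => ?_
  cases c <;> simp [interp_comp_apply, interp_tensor_zero, interp_tensor_one, interp_neg_V,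
    interp_neg_H, interp_pbs_V, interp_pbs_H, interp_swap_zero, interp_swap_one]

theorem interp_ext_three {D D' : Circuit 3 3}
    (h : ∀ x c, interp D x (c, 0) = interp D' x (c, 0) ∧
      interp D x (c, 1) = interp D' x (c, 1) ∧ interp D x (c, 2) = interp D' x (c, 2)) :
    interp D = interp D' := by
  refine LinearMap.ext fun x => funext fun ⟨c, p⟩ => ?_
  fin_cases p
  exacts [(h x c).1, (h x c).2.1, (h x c).2.2]

theorem sound_pbs_pbs_pbs :
    interp (onTop pbs ⨟ onBottom pbs ⨟ onTop pbs) =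
      interp (onTop swap ⨟ onBottom pbs ⨟ onTop swap) := by
  refine interp_ext_three fun x c => ?_
  have h0 : (Fin.castAdd 1 (0 : Fin 2)) = (0 : Fin 3) := rfl
  have h1 : (Fin.castAdd 1 (1 : Fin 2)) = (1 : Fin 3) := rfl
  have h2 : (Fin.natAdd 1 (0 : Fin 2)) = (1 : Fin 3) := rfl
  have h3 : (Fin.natAdd 1 (1 : Fin 2)) = (2 : Fin 3) := rfl
  cases c <;> simp [interp_comp_apply, interp_onTop_zero, interp_onTop_one, interp_onTop_two,
    interp_onBottom_zero, interp_onBottom_one, interp_onBottom_two, h0, h1, h2, h3,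
    interp_pbs_V, interp_pbs_H, interp_swap_zero, interp_swap_one]

theorem sound_pbs_neg_pbs :
    interp (pbs ⨟ (neg ⊞ₗ wire) ⨟ pbs) = interp ((neg ⊞ₗ wire) ⨟ pbs ⨟ (neg ⊞ₗ wire)) := by
  refine interp_ext_two fun x c => ?_
  cases c <;> simp [interp_comp_apply, interp_tensor_zero, interp_tensor_one, interp_neg_V,
    interp_neg_H, interp_pbs_V, interp_pbs_H, interp_idn_apply]

theorem sound_bs_emulation (θ : ℝ) :
    interp (bs θ) =
      interp ((wire ⊞ₗ neg) ⨟ pbs ⨟ (polrot θ ⊞ₗ polrot θ) ⨟ pbs ⨟ (wire ⊞ₗ neg)) := by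
  refine interp_ext_two fun x c => ?_
  cases c <;> simp [interp_comp_apply, interp_tensor_zero, interp_tensor_one, interp_neg_V,
    interp_neg_H, interp_pbs_V, interp_pbs_H, interp_idn_apply, interp_bs_apply,
    interp_polrot_V, interp_polrot_H]

theorem interp_ext_one {D D' : Circuit 1 1}
    (h : ∀ x, interp D x (Pol.V, 0) = interp D' x (Pol.V, 0) ∧
      interp D x (Pol.H, 0) = interp D' x (Pol.H, 0)) : interp D = interp D' := by
  refine LinearMap.ext fun x => funext fun ⟨c, p⟩ => ?_
  fin_cases p
  cases c
  exacts [(h x).1, (h x).2]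

/-- Provable equations hold in the semantics. -/
theorem interp_eq_of_provable {n m : ℕ} {D D' : Circuit n m} (h : Provable D D') :
    interp D = interp D' := by
  induction h with
  | refl => rfl
  | symm _ ih => exact ih.symm
  | trans _ _ ih₁ ih₂ => exact ih₁.trans ih₂
  | comp_congr _ _ ih₁ ih₂ => simp only [interp, ih₁, ih₂]
  | tensor_congr _ _ ih₁ ih₂ => simp only [interp, ih₁, ih₂]
  | id_comp => rfl
  | comp_id => rfl
  | comp_assoc => rfl
  | tensor_id n m =>
    refine LinearMap.ext fun x => state_ext ?_ ?_
    · rw [topL_interp_tensor, interp_idn_apply, interp_idn_apply]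
    · rw [botL_interp_tensor, interp_idn_apply, interp_idn_apply]
  | interchange D₁ D₂ D₁' D₂' =>
    refine LinearMap.ext fun x => state_ext ?_ ?_
    · simp only [topL_interp_tensor, interp_comp_apply]
    · simp only [botL_interp_tensor, interp_comp_apply]
  | empty_tensor D => exact sound_empty_tensor D
  | tensor_empty D =>
    exact LinearMap.ext fun x => funext fun ⟨c, k⟩ =>
      congrFun (topL_interp_tensor D Circuit.empty x) (c, k)
  | tensor_assoc D D' D'' => exact sound_tensor_assoc D D' D''
  | symm_natural D D' =>
    refine LinearMap.ext fun x => state_ext ?_ ?_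
    · simp only [interp_comp_apply, topL_symmetry, botL_interp_tensor, topL_interp_tensor]
    · simp only [interp_comp_apply, botL_symmetry, botL_interp_tensor, topL_interp_tensor]
  | symm_symm a b =>
    refine LinearMap.ext fun x => state_ext ?_ ?_
    · simp only [interp_comp_apply, topL_symmetry, botL_symmetry, interp_idn_apply]
    · simp only [interp_comp_apply, botL_symmetry, topL_symmetry, interp_idn_apply]
  | hexagon a b c => exact sound_hexagon a b c
  | phase_add φ₁ φ₂ =>
    refine interp_ext_one fun x => ?_
    simp only [interp_comp_apply, interp_phase_apply, ← mul_assoc, ← Complex.exp_add]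
    push_cast
    ring_nf
    simp
  | phase_zero => exact interp_ext_one fun x => by simp [interp_phase_apply, interp_idn_apply]
  | bs_zero =>
    refine interp_ext_two fun x c => ?_
    simp [interp_bs_apply, interp_tensor_zero, interp_tensor_one, interp_idn_apply]
  | pbs_neg => exact sound_pbs_neg
  | pbs_pbs =>
    refine interp_ext_two fun x c => ?_
    cases c <;> simp [interp_comp_apply, interp_tensor_zero, interp_tensor_one, interp_pbs_V,
      interp_pbs_H, interp_idn_apply]
  | pbs_pbs_pbs => exact sound_pbs_pbs_pbs
  | pbs_neg_pbs => exact sound_pbs_neg_pbs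
  | source_detector => exact LinearMap.ext fun x => funext fun a => a.2.elim0
  | source_phase => simp [interp]
  | source_polrot => simp [interp]
  | source_pbs =>
    exact LinearMap.ext fun x => by
      rw [show x = 0 from funext fun a => a.2.elim0, map_zero, map_zero]
  | phase_detector => simp [interp]
  | polrot_detector => simp [interp]
  | pbs_detector => exact LinearMap.ext fun x => funext fun a => a.2.elim0
  | phase_polrot φ =>
    refine interp_ext_one fun x => ?_
    simp only [interp_comp_apply, interp_phase_apply, interp_polrot_V, interp_polrot_H]
    constructor <;> ring
  | phase_pbs φ =>
    refine interp_ext_two fun x c => ?_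
    cases c <;> simp [interp_comp_apply, interp_tensor_zero, interp_tensor_one, interp_pbs_V,
      interp_pbs_H, interp_phase_apply]
  | bs_emulation θ => exact sound_bs_emulation θ
  | euler θ₁ θ₂ θ₃ φ₁ φ₂ α₁ α₂ α₃ β₁ β₂ β₃ β₄ β₅ β₆ _ hU =>
    refine LinearMap.ext fun x => funext fun ⟨c, k⟩ => ?_
    rw [interp_apply_of_polPreserving _ (by simp [eulerLeft, onTop, onBottom, parallel,
      PolPreserving]), interp_apply_of_polPreserving _ (by simp [eulerRight, onTop, onBottom,
      parallel, PolPreserving]), hU]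

/-! ### Circuits up to provable equality -/

/-- Provable equality as a setoid. -/
def provableSetoid (n m : ℕ) : Setoid (Circuit n m) where
  r := Provable
  iseqv := ⟨Provable.refl, Provable.symm, Provable.trans⟩

/-- Circuits `n → m` up to provable equality. -/
def Hom (n m : ℕ) : Type := Quotient (provableSetoid n m)

namespace Hom

/-- The class of a circuit. -/
def mk {n m : ℕ} (D : Circuit n m) : Hom n m := Quotient.mk (provableSetoid n m) D

theorem mk_eq_mk {n m : ℕ} {D D' : Circuit n m} : mk D = mk D' ↔ Provable D D' :=
  ⟨fun h => Quotient.exact h, fun h => Quotient.sound h⟩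

theorem ind {n m : ℕ} {P : Hom n m → Prop} (h : ∀ D, P (mk D)) (f : Hom n m) : P f :=
  Quotient.ind h f

/-- Sequential composition. -/
def comp {a b c : ℕ} : Hom a b → Hom b c → Hom a c :=
  Quotient.map₂ Circuit.comp fun _ _ h _ _ h' => Provable.comp_congr h h'

/-- Parallel composition. -/
def tensor {a b c d : ℕ} : Hom a b → Hom c d → Hom (a + c) (b + d) :=
  Quotient.map₂ Circuit.tensor fun _ _ h _ _ h' => Provable.tensor_congr h h'

/-- The identity. -/
def id (n : ℕ) : Hom n n := mk (idn n)

/-- The symmetry. -/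
def sym (a b : ℕ) : Hom (a + b) (b + a) := mk (symmetry a b)

/-- The semantics of a class of circuits. -/
def sem {n m : ℕ} : Hom n m → (State n →ₗ[ℂ] State m) :=
  Quotient.lift interp fun _ _ h => interp_eq_of_provable h

end Hom

infixl:60 " ≫ₗ " => Hom.comp
infixl:70 " ⊗ₗ " => Hom.tensor

namespace Hom

theorem mk_comp {a b c : ℕ} (D : Circuit a b) (D' : Circuit b c) :
    mk (D ⨟ D') = mk D ≫ₗ mk D' := rfl

theorem id_comp {n m : ℕ} (f : Hom n m) : id n ≫ₗ f = f := by
  induction f using ind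
  exact mk_eq_mk.2 (.id_comp _)

theorem comp_id {n m : ℕ} (f : Hom n m) : f ≫ₗ id m = f := by
  induction f using ind
  exact mk_eq_mk.2 (.comp_id _)

theorem comp_assoc {a b c d : ℕ} (f : Hom a b) (g : Hom b c) (h : Hom c d) :
    f ≫ₗ g ≫ₗ h = f ≫ₗ (g ≫ₗ h) := by
  induction f using ind
  induction g using ind
  induction h using ind
  exact mk_eq_mk.2 (.comp_assoc _ _ _)

theorem id_tensor_id (n m : ℕ) : id n ⊗ₗ id m = id (n + m) := mk_eq_mk.2 (.tensor_id n m)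

theorem comp_tensor_comp {a b c a' b' c' : ℕ} (f : Hom a b) (g : Hom b c) (f' : Hom a' b')
    (g' : Hom b' c') : (f ≫ₗ g) ⊗ₗ (f' ≫ₗ g') = (f ⊗ₗ f') ≫ₗ (g ⊗ₗ g') := by
  induction f using ind
  induction g using ind
  induction f' using ind
  induction g' using ind
  exact mk_eq_mk.2 (.interchange _ _ _ _)

theorem tensor_id_zero {n m : ℕ} (f : Hom n m) : f ⊗ₗ id 0 = f := by
  induction f using ind
  exact mk_eq_mk.2 (.tensor_empty _)

theorem heq_of_castWires {n m n' m' : ℕ} (hn : n = n') (hm : m = m') {D : Circuit n m}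
    {D' : Circuit n' m'} (h : mk (castWires hn hm D) = mk D') : HEq (mk D) (mk D') := by
  subst hn hm
  exact heq_of_eq h

/-- Heterogeneous equality absorbs the transport of the axiom; when the two wire counts agree
definitionally, `eq_of_heq` turns it into an equality. -/
theorem tensor_assoc {a b a' b' a'' b'' : ℕ} (f : Hom a b) (f' : Hom a' b') (f'' : Hom a'' b'') :
    HEq (f ⊗ₗ f' ⊗ₗ f'') (f ⊗ₗ (f' ⊗ₗ f'')) := by
  induction f using ind
  induction f' using ind
  induction f'' using ind
  exact heq_of_castWires _ _ (mk_eq_mk.2 (.tensor_assoc _ _ _))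

theorem id_zero_tensor {n m : ℕ} (f : Hom n m) : HEq (id 0 ⊗ₗ f) f := by
  induction f using ind
  exact heq_of_castWires _ _ (mk_eq_mk.2 (.empty_tensor _))

theorem sym_natural {a b c d : ℕ} (f : Hom a b) (g : Hom c d) :
    (f ⊗ₗ g) ≫ₗ sym b d = sym a c ≫ₗ (g ⊗ₗ f) := by
  induction f using ind
  induction g using ind
  exact mk_eq_mk.2 (.symm_natural _ _)

theorem sym_sym (a b : ℕ) : sym a b ≫ₗ sym b a = id (a + b) := mk_eq_mk.2 (.symm_symm a b)

/-- Products are read in the order of the circuit, so the semantics reverses them. -/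
instance (N : ℕ) : Monoid (Hom N N) where
  mul := comp
  one := id N
  mul_assoc := comp_assoc
  one_mul := id_comp
  mul_one := comp_id

theorem mul_def {N : ℕ} (f g : Hom N N) : f * g = f ≫ₗ g := rfl

theorem one_def (N : ℕ) : (1 : Hom N N) = id N := rfl

theorem tensor_mul {N N' : ℕ} (f g : Hom N N) (f' g' : Hom N' N') :
    (f * g) ⊗ₗ (f' * g') = (f ⊗ₗ f') * (g ⊗ₗ g') :=
  comp_tensor_comp f g f' g'

theorem mul_tensor_id {N : ℕ} (f g : Hom N N) (k : ℕ) :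
    (f * g) ⊗ₗ id k = (f ⊗ₗ id k) * (g ⊗ₗ id k) := by
  rw [← tensor_mul, ← one_def k, one_mul]

theorem id_tensor_mul {N : ℕ} (f g : Hom N N) (k : ℕ) :
    id k ⊗ₗ (f * g) = (id k ⊗ₗ f) * (id k ⊗ₗ g) := by
  rw [← tensor_mul, ← one_def k, one_mul]

theorem tensor_eq_mul {N N' : ℕ} (f : Hom N N) (g : Hom N' N') :
    f ⊗ₗ g = (f ⊗ₗ id N') * (id N ⊗ₗ g) := by
  rw [← tensor_mul, ← one_def, ← one_def, one_mul, mul_one]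

theorem tensor_eq_mul' {N N' : ℕ} (f : Hom N N) (g : Hom N' N') :
    f ⊗ₗ g = (id N ⊗ₗ g) * (f ⊗ₗ id N') := by
  rw [← tensor_mul, ← one_def, ← one_def, one_mul, mul_one]

theorem tensor_commute {N N' : ℕ} (f : Hom N N) (g : Hom N' N') :
    Commute (f ⊗ₗ id N') (id N ⊗ₗ g) := by
  rw [Commute, SemiconjBy, ← tensor_eq_mul, ← tensor_eq_mul']

/-! ### The semantics of classes -/

theorem sem_comp {a b c : ℕ} (f : Hom a b) (g : Hom b c) (x : State a) :
    sem (f ≫ₗ g) x = sem g (sem f x) := by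
  induction f using ind
  induction g using ind
  rfl

theorem sem_mul {N : ℕ} (f g : Hom N N) (x : State N) : sem (f * g) x = sem g (sem f x) :=
  sem_comp f g x

theorem sem_id {N : ℕ} (x : State N) : sem (id N) x = x := rfl

theorem topL_sem_tensor {n m n' m' : ℕ} (f : Hom n m) (g : Hom n' m') (x : State (n + n')) :
    topL m m' (sem (f ⊗ₗ g) x) = sem f (topL n n' x) := by
  induction f using ind
  induction g using ind
  exact topL_interp_tensor _ _ x

theorem botL_sem_tensor {n m n' m' : ℕ} (f : Hom n m) (g : Hom n' m') (x : State (n + n')) :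
    botL m m' (sem (f ⊗ₗ g) x) = sem g (botL n n' x) := by
  induction f using ind
  induction g using ind
  exact botL_interp_tensor _ _ x

/-! ### The generators -/

/-- The vacuum source. -/
def src : Hom 0 1 := mk source
/-- The vacuum detector. -/
def det : Hom 1 0 := mk detector
/-- The phase shifter. -/
def ph (φ : ℝ) : Hom 1 1 := mk (phase φ)
/-- The wave plate. -/
def rot (θ : ℝ) : Hom 1 1 := mk (polrot θ)
/-- The beam splitter. -/
def bsp (θ : ℝ) : Hom 2 2 := mk (bs θ)
/-- The polarising beam splitter. -/
def pb : Hom 2 2 := mk pbs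
/-- The swap. -/
def sw : Hom 2 2 := mk swap
/-- The negation. -/
def ng : Hom 1 1 := mk neg

/-- A wire can be cancelled. -/
theorem tensor_id_one_cancel {n m : ℕ} {f g : Hom n m} (h : f ⊗ₗ id 1 = g ⊗ₗ id 1) : f = g := by
  -- Feeding a vacuum into the extra wire and detecting it afterwards deletes that wire, because s;d
  -- = I₀.
  have key (f : Hom n m) : (id n ⊗ₗ src) ≫ₗ (f ⊗ₗ id 1) ≫ₗ (id m ⊗ₗ det) = f := by
    rw [← comp_tensor_comp, ← comp_tensor_comp, id_comp, comp_id, comp_id,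
      show src ≫ₗ det = id 0 from mk_eq_mk.2 .source_detector, tensor_id_zero]
  rw [← key f, h, key]

theorem ph_mul (φ ψ : ℝ) : ph φ * ph ψ = ph (φ + ψ) := mk_eq_mk.2 (.phase_add φ ψ)

theorem ph_zero : ph 0 = 1 := mk_eq_mk.2 .phase_zero

theorem bsp_zero : bsp 0 = 1 := by
  rw [one_def, ← id_tensor_id 1 1]
  exact mk_eq_mk.2 .bs_zero

theorem ng_eq : ng = rot (Real.pi / 2) * ph (-(Real.pi / 2)) := rfl

theorem sw_mul_sw : sw * sw = 1 := sym_sym 1 1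

theorem tensor_mul_sw (f g : Hom 1 1) : (f ⊗ₗ g) * sw = sw * (g ⊗ₗ f) := sym_natural f g

theorem pb_mul_pb : pb * pb = 1 := by
  rw [one_def, ← id_tensor_id 1 1]
  exact mk_eq_mk.2 .pbs_pbs

theorem ng_pb_ng : (ng ⊗ₗ ng) * pb * (ng ⊗ₗ ng) = pb * sw := mk_eq_mk.2 .pbs_neg

theorem pb_ng_pb : pb * (ng ⊗ₗ id 1) * pb = (ng ⊗ₗ id 1) * pb * (ng ⊗ₗ id 1) :=
  mk_eq_mk.2 .pbs_neg_pbs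

theorem bsp_eq (θ : ℝ) :
    bsp θ = (id 1 ⊗ₗ ng) * pb * (rot θ ⊗ₗ rot θ) * pb * (id 1 ⊗ₗ ng) :=
  mk_eq_mk.2 (.bs_emulation θ)

theorem ph_rot_comm (φ : ℝ) : Commute (ph φ) (rot (Real.pi / 2)) := mk_eq_mk.2 (.phase_polrot φ)

theorem ph_pb_comm (φ : ℝ) : Commute (ph φ ⊗ₗ ph φ) pb := mk_eq_mk.2 (.phase_pbs φ)

theorem src_comp_ph (φ : ℝ) : src ≫ₗ ph φ = src := mk_eq_mk.2 (.source_phase φ)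

theorem src_comp_rot (θ : ℝ) : src ≫ₗ rot θ = src := mk_eq_mk.2 (.source_polrot θ)

theorem src_src_comp_pb : (src ⊗ₗ src) ≫ₗ pb = src ⊗ₗ src := mk_eq_mk.2 .source_pbs

end Hom

/-! ### The negation -/

section Group

variable {G : Type*} [Group G] {A s u v : G}

/-- Here `s` stands for the swap, `A` for the polarising beam splitter, and `u`, `v` for the
negation on the top and bottom wire. Put y = uv, which commutes with s. Inverting yAy = As gives sA
= y⁻¹Ay⁻¹, hence sAs = y⁻¹(As)y⁻¹ = A. -/
theorem conj_of_relations (hs : s * s = 1) (hA : A * A = 1) (huv : Commute u v)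
    (hus : u * s = s * v) (hvs : v * s = s * u) (h₁ : u * v * A * (u * v) = A * s) :
    s * A = A * s := by
  have hn : u * v * s = s * (u * v) := by
    rw [mul_assoc, hvs, ← mul_assoc, hus, mul_assoc, ← huv.eq]
  have hn' : (u * v)⁻¹ * s = s * (u * v)⁻¹ := by
    rw [inv_mul_eq_iff_eq_mul, ← mul_assoc, hn, mul_inv_cancel_right]
  have h2 : s * A = (u * v)⁻¹ * A * (u * v)⁻¹ := by
    have : (A * s)⁻¹ = s * A := by
      rw [mul_inv_rev, inv_eq_of_mul_eq_one_left hs, inv_eq_of_mul_eq_one_left hA]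
    rw [← this, ← h₁, mul_inv_rev, mul_inv_rev _ A, inv_eq_of_mul_eq_one_left hA, mul_assoc]
  have h3 : s * A * s = A := by
    rw [h2, mul_assoc, hn', ← mul_assoc, mul_assoc _ A, ← h₁]
    group
  calc s * A = s * A * s * s := by rw [mul_assoc (s * A), hs, mul_one]
    _ = A * s := by rw [h3]

/-- With y = uv, the relation yAy = As = sA gives AyA = y⁻¹s. On the other hand AyA = (AuA)(AvA) =
(uAu)(vAv) = u(AyA)v. Comparing, and moving s past v, gives u y⁻¹ u = y⁻¹, that is u² = 1 since u
and v commute. -/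
theorem sq_eq_one_of_relations (hs : s * s = 1)
    (hA : A * A = 1) (huv : Commute u v) (hus : u * s = s * v) (hvs : v * s = s * u)
    (h₁ : u * v * A * (u * v) = A * s) (h₂ : A * u * A = u * A * u) : u * u = 1 := by
  have hsA := conj_of_relations hs hA huv hus hvs h₁
  have hsus : s * u * s = v := by rw [mul_assoc, hus, ← mul_assoc, hs, one_mul]
  have hv : A * v * A = v * A * v := by
    have hsi : s⁻¹ = s := inv_eq_of_mul_eq_one_left hs
    have e := congrArg (MulAut.conj s) h₂
    simp only [map_mul, MulAut.conj_apply, hsi, hsus, hsA] at e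
    rwa [mul_assoc A s s, hs, mul_one] at e
  have hy : A * (u * v) * A = (u * v)⁻¹ * s := by
    rw [eq_inv_mul_iff_mul_eq, ← mul_assoc, ← mul_assoc, h₁, mul_assoc, hsA, ← mul_assoc, hA,
      one_mul]
  have hy' : A * (u * v) * A = u * (A * (u * v) * A) * v := by
    calc A * (u * v) * A = (A * u * A) * (A * v * A) := by
          simp only [mul_assoc]
          rw [← mul_assoc A A, hA, one_mul]
      _ = _ := by rw [h₂, hv]; simp only [mul_assoc]
  have h4 : u * (u * v)⁻¹ * s * v = (u * v)⁻¹ * s := by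
    rw [mul_assoc u, ← hy, ← hy', hy]
  rw [mul_assoc, ← hus, ← mul_assoc, mul_left_inj, huv.eq, mul_inv_rev, mul_inv_cancel_left,
    huv.inv_inv.eq, mul_right_inj] at h4
  exact mul_eq_one_iff_eq_inv.2 h4

end Group

namespace Hom

theorem id_tensor_ng_mul_sw : (id 1 ⊗ₗ ng) * sw = sw * (ng ⊗ₗ id 1) := tensor_mul_sw _ _

theorem ng_tensor_id_mul_sw : (ng ⊗ₗ id 1) * sw = sw * (id 1 ⊗ₗ ng) := tensor_mul_sw _ _

/-- The emulation of B(0) = I ⊕ I starts and ends with this factor, which therefore has an inverse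
on each side. -/
theorem isUnit_id_tensor_ng : IsUnit (id 1 ⊗ₗ ng) := by
  have h := bsp_zero
  rw [bsp_eq] at h
  have h' := h
  rw [mul_assoc, mul_assoc, mul_assoc] at h'
  exact isUnit_iff_exists.2 ⟨_, h', by rw [left_inv_eq_right_inv h h'] at h; exact h⟩

theorem ng_relations : (ng ⊗ₗ id 1) * (ng ⊗ₗ id 1) = 1 ∧ sw * pb = pb * sw := by
  obtain ⟨v, hv⟩ := isUnit_id_tensor_ng
  let s : (Hom 2 2)ˣ := ⟨sw, sw, sw_mul_sw, sw_mul_sw⟩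
  let A : (Hom 2 2)ˣ := ⟨pb, pb, pb_mul_pb, pb_mul_pb⟩
  -- So far only the bottom negation is known to be invertible; the top one is its conjugate by the
  -- swap.
  let u : (Hom 2 2)ˣ := s * v * s
  have hu : (u : Hom 2 2) = ng ⊗ₗ id 1 := by
    simp only [u, s, Units.val_mul, hv]
    rw [mul_assoc, id_tensor_ng_mul_sw, ← mul_assoc, sw_mul_sw, one_mul]
  have hs : s * s = 1 := Units.ext sw_mul_sw
  have hA : A * A = 1 := Units.ext pb_mul_pb
  have huv : Commute u v := Units.ext (by
    change (u : Hom 2 2) * v = v * u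
    rw [hu, hv]
    exact tensor_commute ng ng)
  have hus : u * s = s * v := by rw [mul_assoc, hs, mul_one]
  have hvs : v * s = s * u := by
    simp only [u, ← mul_assoc, hs, one_mul]
  have h₁ : u * v * A * (u * v) = A * s := Units.ext (by
    simp only [Units.val_mul, hu, hv]
    rw [← tensor_eq_mul]
    exact ng_pb_ng)
  have h₂ : A * u * A = u * A * u := Units.ext (by
    simp only [Units.val_mul, hu]
    exact pb_ng_pb)
  constructor
  · rw [← hu, ← Units.val_mul, sq_eq_one_of_relations hs hA huv hus hvs h₁ h₂]
    rfl
  · exact congrArg Units.val (conj_of_relations hs hA huv hus hvs h₁)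

theorem sw_mul_pb : sw * pb = pb * sw := ng_relations.2

theorem ng_mul_ng : ng * ng = 1 := by
  refine tensor_id_one_cancel ?_
  rw [mul_tensor_id, ng_relations.1, one_def, one_def, id_tensor_id]

theorem ng_tensor_mul_self : (id 1 ⊗ₗ ng) * (id 1 ⊗ₗ ng) = 1 := by
  rw [← id_tensor_mul, ng_mul_ng, one_def, id_tensor_id, one_def]

theorem ng_ng_mul_self : (ng ⊗ₗ ng) * (ng ⊗ₗ ng) = 1 := by
  rw [← tensor_mul, ng_mul_ng, one_def, id_tensor_id, one_def]

theorem pb_ng_ng_pb : pb * (ng ⊗ₗ ng) * pb = (ng ⊗ₗ ng) * sw := by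
  calc pb * (ng ⊗ₗ ng) * pb = (ng ⊗ₗ ng) * ((ng ⊗ₗ ng) * pb * (ng ⊗ₗ ng)) * pb := by
        simp only [← mul_assoc, ng_ng_mul_self, one_mul]
    _ = (ng ⊗ₗ ng) * sw := by
        rw [ng_pb_ng, ← sw_mul_pb, mul_assoc, mul_assoc, pb_mul_pb, mul_one]

theorem ph_ng_comm (φ : ℝ) : Commute (ph φ) ng :=
  Commute.mul_right (b := rot _) (c := ph _) (ph_rot_comm φ)
    (by rw [Commute, SemiconjBy, ph_mul, ph_mul, add_comm])

theorem commute_tensor {N N' : ℕ} {f f' : Hom N N} {g g' : Hom N' N'} (h : Commute f f')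
    (h' : Commute g g') : Commute (f ⊗ₗ g) (f' ⊗ₗ g') := by
  rw [Commute, SemiconjBy, ← tensor_mul, ← tensor_mul, h.eq, h'.eq]

theorem id_tensor_mul_ng : (id 1 ⊗ₗ ng) * (ng ⊗ₗ ng) = ng ⊗ₗ id 1 := by
  rw [← tensor_mul, ng_mul_ng, ← one_def, one_mul]

theorem rot_pi_div_two : rot (Real.pi / 2) = ng * ph (Real.pi / 2) := by
  rw [ng_eq, mul_assoc, ph_mul, neg_add_cancel, ph_zero, mul_one]

/-- At π/2 the wave plates of the emulation are negations up to equal phases. The phases commute to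
the front, and conjugating the pair of negations by the polarising beam splitter produces the swap.
This is what makes swaps available among spatial circuits. -/
theorem bsp_pi_div_two :
    bsp (Real.pi / 2) = (ph (Real.pi / 2) ⊗ₗ ph (Real.pi / 2)) * sw := by
  have h1 : Commute (ph (Real.pi / 2) ⊗ₗ ph (Real.pi / 2)) (id 1 ⊗ₗ ng) :=
    commute_tensor (Commute.one_right _) (ph_ng_comm _)
  have h2 := ph_pb_comm (Real.pi / 2)
  set P := ph (Real.pi / 2) ⊗ₗ ph (Real.pi / 2)
  have h3 : rot (Real.pi / 2) ⊗ₗ rot (Real.pi / 2) = P * (ng ⊗ₗ ng) := by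
    rw [rot_pi_div_two, (ph_ng_comm _).symm.eq, tensor_mul]
  calc bsp (Real.pi / 2) = (id 1 ⊗ₗ ng) * pb * P * ((ng ⊗ₗ ng) * pb * (id 1 ⊗ₗ ng)) := by
        rw [bsp_eq, h3]; simp only [mul_assoc]
    _ = P * ((id 1 ⊗ₗ ng) * (pb * (ng ⊗ₗ ng) * pb) * (id 1 ⊗ₗ ng)) := by
        rw [mul_assoc _ pb, ← h2.eq, ← mul_assoc _ P pb, ← h1.eq]; simp only [mul_assoc]
    _ = P * sw := by
        rw [pb_ng_ng_pb, ← mul_assoc (id 1 ⊗ₗ ng), id_tensor_mul_ng, ng_tensor_id_mul_sw,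
          mul_assoc sw, ng_tensor_mul_self, mul_one]

theorem sw_eq :
    sw = (ph (-(Real.pi / 2)) ⊗ₗ ph (-(Real.pi / 2))) * bsp (Real.pi / 2) := by
  rw [bsp_pi_div_two, ← mul_assoc, ← tensor_mul, ph_mul, neg_add_cancel, ph_zero, one_def,
    id_tensor_id, ← one_def, one_mul]

/-! ### Splitting a wire by polarisation -/

/-- The circuit sending the vertical part to the top wire and the negated horizontal part to the
bottom wire. -/
def split : Hom 1 2 := (id 1 ⊗ₗ src : Hom 1 2) ≫ₗ pb ≫ₗ (id 1 ⊗ₗ ng)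

/-- A left inverse of `split`. -/
def merge : Hom 2 1 := (id 1 ⊗ₗ ng) ≫ₗ pb ≫ₗ (id 1 ⊗ₗ det : Hom 2 1)

/-- The vacuum absorbs `g`, so an arbitrary absorbed partner may be created on the new wire. This
supplies the second copy needed by laws about pairs of equal circuits. -/
theorem comp_id_tensor_src' (f g : Hom 1 1) (hg : src ≫ₗ g = src) :
    f ≫ₗ (id 1 ⊗ₗ src : Hom 1 2) = (id 1 ⊗ₗ src : Hom 1 2) ≫ₗ (f ⊗ₗ g) := by
  have h1 := comp_tensor_comp (id 1) f src g
  have h2 := comp_tensor_comp f (id 1) (id 0) src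
  rw [comp_id, id_comp] at h2
  rw [hg, id_comp] at h1
  rw [tensor_id_zero] at h2
  exact h2.symm.trans h1

theorem split_comp_merge : split ≫ₗ merge = id 1 := by
  have e1 : (id 1 ⊗ₗ ng) ≫ₗ (id 1 ⊗ₗ ng) = id 2 := ng_tensor_mul_self
  have e2 : pb ≫ₗ pb = id 2 := pb_mul_pb
  have e3 : (id 1 ⊗ₗ src : Hom 1 2) ≫ₗ (id 1 ⊗ₗ det : Hom 2 1) = id 1 := by
    have h := comp_tensor_comp (id 1) (id 1) src det
    rw [id_comp, show src ≫ₗ det = id 0 from mk_eq_mk.2 .source_detector, tensor_id_zero] at h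
    exact h.symm
  rw [split, merge, comp_assoc, comp_assoc, comp_assoc, ← comp_assoc _ _ (pb ≫ₗ _), e1, id_comp,
    ← comp_assoc pb, e2, id_comp, e3]

/-- The emulation of a beam splitter begins with the inverse of the last two layers of `split`. They
cancel, leaving a wave plate on each wire, and the one on the vacuum wire disappears. -/
theorem rot_comp_split (θ : ℝ) : rot θ ≫ₗ split = split ≫ₗ bsp θ := by
  have e : pb * (id 1 ⊗ₗ ng) * bsp θ = (rot θ ⊗ₗ rot θ) * pb * (id 1 ⊗ₗ ng) := by
    rw [bsp_eq]
    simp only [← mul_assoc]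
    rw [mul_assoc pb, ng_tensor_mul_self, mul_one, pb_mul_pb, one_mul]
  simp only [mul_def, comp_assoc] at e
  rw [split, ← comp_assoc, ← comp_assoc, comp_id_tensor_src' _ _ (src_comp_rot θ)]
  simp only [comp_assoc]
  rw [e]

theorem ph_comp_split (φ : ℝ) : ph φ ≫ₗ split = split ≫ₗ (ph φ ⊗ₗ ph φ) := by
  have h1 : Commute (ph φ ⊗ₗ ph φ) (id 1 ⊗ₗ ng) :=
    commute_tensor (Commute.one_right _) (ph_ng_comm _)
  have e := ((ph_pb_comm φ).mul_right h1).eq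
  simp only [mul_def, comp_assoc] at e
  rw [split, ← comp_assoc, ← comp_assoc, comp_id_tensor_src' _ _ (src_comp_ph φ)]
  simp only [comp_assoc]
  rw [e]

end Hom

/-! ### Existence of Euler angles -/

/-- Allowing a negative modulus halves the range needed for the argument, hence β in [0, π). -/
theorem exists_real_mul_exp (t : ℂ) : ∃ r β : ℝ, β ∈ Set.Ico 0 Real.pi ∧ (r = 0 → β = 0) ∧
    t = r * Complex.exp (Complex.I * β) := by
  by_cases ht : t = 0
  · exact ⟨0, 0, ⟨le_rfl, Real.pi_pos⟩, fun _ => rfl, by simp [ht]⟩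
  have hn : ‖t‖ ≠ 0 := by simpa using ht
  have hp := Complex.norm_mul_exp_arg_mul_I t
  have h1 := Complex.neg_pi_lt_arg t
  have h2 := Complex.arg_le_pi t
  by_cases h0 : 0 ≤ t.arg ∧ t.arg < Real.pi
  · exact ⟨‖t‖, t.arg, h0, fun h => absurd h hn, by rw [mul_comm Complex.I, hp]⟩
  have key : ∃ β : ℝ, β ∈ Set.Ico 0 Real.pi ∧
      Complex.exp (t.arg * Complex.I) = -Complex.exp (Complex.I * β) := by
    by_cases h3 : t.arg < 0
    · refine ⟨t.arg + Real.pi, ⟨by linarith, by linarith⟩, ?_⟩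
      push_cast
      rw [mul_add, Complex.exp_add, mul_comm _ (Real.pi : ℂ), Complex.exp_pi_mul_I, mul_comm]
      ring
    · have : t.arg = Real.pi := by
        rcases not_and_or.1 h0 with h | h <;> linarith
      exact ⟨0, ⟨le_rfl, Real.pi_pos⟩, by rw [this]; simp [Complex.exp_pi_mul_I]⟩
  obtain ⟨β, hβ, he⟩ := key
  refine ⟨-‖t‖, β, hβ, fun h => absurd (neg_eq_zero.1 h) hn, ?_⟩
  conv_lhs => rw [← hp, he]
  push_cast
  ring

/-- For b ≠ 0 the ratio ia/b must be e^{iβ} cot α. Write it as r e^{iβ} with r real and take α = π/2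
- arctan r. The clause on b = 0 is what later yields that α₂ = 0 forces α₁ = 0. -/
theorem exists_angles (a b : ℂ) : ∃ (α β : ℝ) (w : ℂ), α ∈ Set.Ico 0 Real.pi ∧
    β ∈ Set.Ico 0 Real.pi ∧ (α = 0 ∨ α = Real.pi / 2 → β = 0) ∧ (b = 0 → α = 0) ∧
    a = w * (Complex.exp (Complex.I * β) * Complex.cos α) ∧
    b = w * (Complex.I * Complex.sin α) := by
  by_cases hb : b = 0
  · exact ⟨0, 0, a, ⟨le_rfl, Real.pi_pos⟩, ⟨le_rfl, Real.pi_pos⟩, fun _ => rfl, fun _ => rfl,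
      by simp, by simp [hb]⟩
  obtain ⟨r, β, hβ, hr, ht⟩ := exists_real_mul_exp (Complex.I * a / b)
  have h1 := Real.arctan_lt_pi_div_two r
  have h2 := Real.neg_pi_div_two_lt_arctan r
  have hc := Real.cos_arctan_pos r
  have hs : Real.sin (Real.pi / 2 - Real.arctan r) = Real.cos (Real.arctan r) :=
    Real.sin_pi_div_two_sub _
  have hco : Real.cos (Real.pi / 2 - Real.arctan r) = r * Real.cos (Real.arctan r) := by
    rw [Real.cos_pi_div_two_sub]
    conv_rhs => rw [← Real.tan_arctan r, Real.arctan_tan h2 h1]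
    rw [Real.tan_mul_cos hc.ne']
  refine ⟨Real.pi / 2 - Real.arctan r, β, b / (Complex.I * (Real.cos (Real.arctan r) : ℝ)),
    ⟨by linarith, by linarith⟩, hβ, ?_, fun h => absurd h hb, ?_, ?_⟩
  · rintro (h | h)
    · linarith
    · exact hr (Real.arctan_eq_zero_iff.1 (by linarith))
  · rw [← Complex.ofReal_cos, hco]
    have hc' : (Real.cos (Real.arctan r) : ℂ) ≠ 0 := by exact_mod_cast hc.ne'
    rw [Complex.ofReal_mul]
    rw [div_eq_iff hb] at ht
    field_simp
    linear_combination ht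
  · rw [← Complex.ofReal_sin, hs]
    have hc' : (Real.cos (Real.arctan r) : ℂ) ≠ 0 := by exact_mod_cast hc.ne'
    field_simp

theorem exists_exp_of_norm_eq_one {w : ℂ} (hw : w * star w = 1) :
    ∃ β : ℝ, β ∈ Set.Ico 0 (2 * Real.pi) ∧ w = Complex.exp (Complex.I * β) := by
  have hn : ‖w‖ = 1 := by
    have h : Complex.normSq w = 1 := by
      have := Complex.mul_conj w
      rw [starRingEnd_apply, hw] at this
      exact_mod_cast this.symm
    rw [Complex.normSq_eq_norm_sq] at h
    exact (pow_eq_one_iff_of_nonneg (norm_nonneg w) two_ne_zero).1 h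
  have hp := Complex.norm_mul_exp_arg_mul_I w
  rw [hn, Complex.ofReal_one, one_mul, mul_comm] at hp
  have h1 := Complex.neg_pi_lt_arg w
  have h2 := Complex.arg_le_pi w
  have h3 := Real.pi_pos
  by_cases h0 : 0 ≤ w.arg
  · exact ⟨w.arg, ⟨h0, by linarith⟩, hp.symm⟩
  · refine ⟨w.arg + 2 * Real.pi, ⟨by linarith, by linarith⟩, ?_⟩
    push_cast
    rw [mul_add, Complex.exp_add, hp, mul_comm Complex.I, Complex.exp_two_pi_mul_I, mul_one]

/-- The matrix of a beam splitter on the wires `0, 1`. -/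
def topMat (θ : ℝ) : Matrix (Fin 3) (Fin 3) ℂ :=
  !![Complex.cos θ, Complex.I * Complex.sin θ, 0;
     Complex.I * Complex.sin θ, Complex.cos θ, 0;
     0, 0, 1]

/-- The matrix of a beam splitter on the wires `1, 2`. -/
def botMat (θ : ℝ) : Matrix (Fin 3) (Fin 3) ℂ :=
  !![1, 0, 0;
     0, Complex.cos θ, Complex.I * Complex.sin θ;
     0, Complex.I * Complex.sin θ, Complex.cos θ]

/-- The matrix of three phase shifters in parallel. -/
def phaseMat (a b c : ℝ) : Matrix (Fin 3) (Fin 3) ℂ :=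
  Matrix.diagonal ![Complex.exp (Complex.I * a), Complex.exp (Complex.I * b),
    Complex.exp (Complex.I * c)]

abbrev U3 := Matrix.unitaryGroup (Fin 3) ℂ

theorem conj_cos_ofReal (θ : ℝ) : starRingEnd ℂ (Complex.cos θ) = Complex.cos θ := by
  rw [← Complex.cos_conj, Complex.conj_ofReal]

theorem conj_sin_ofReal (θ : ℝ) : starRingEnd ℂ (Complex.sin θ) = Complex.sin θ := by
  rw [← Complex.sin_conj, Complex.conj_ofReal]

theorem forall_fin_three {P : Fin 3 → Prop} (h₀ : P 0) (h₁ : P 1) (h₂ : P 2) : ∀ i, P i :=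
  Fin.forall_fin_succ.2 ⟨h₀, Fin.forall_fin_two.2 ⟨h₁, h₂⟩⟩

theorem topMat_mem (θ : ℝ) : topMat θ ∈ U3 := by
  rw [Matrix.mem_unitaryGroup_iff]
  have h := Complex.sin_sq_add_cos_sq θ
  have hI := Complex.I_mul_I
  ext i j
  fin_cases i <;> fin_cases j <;>
    simp [topMat, Matrix.mul_apply, Fin.sum_univ_three, Matrix.star_apply, conj_cos_ofReal,
      conj_sin_ofReal] <;>
    first | ring1 | linear_combination h - Complex.sin θ ^ 2 * hI

theorem botMat_mem (θ : ℝ) : botMat θ ∈ U3 := by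
  rw [Matrix.mem_unitaryGroup_iff]
  have h := Complex.sin_sq_add_cos_sq θ
  have hI := Complex.I_mul_I
  ext i j
  fin_cases i <;> fin_cases j <;>
    simp [botMat, Matrix.mul_apply, Fin.sum_univ_three, Matrix.star_apply, conj_cos_ofReal,
      conj_sin_ofReal] <;>
    first | ring1 | linear_combination h - Complex.sin θ ^ 2 * hI

theorem exp_mul_star_exp (a : ℝ) :
    Complex.exp (Complex.I * a) * star (Complex.exp (Complex.I * a)) = 1 := by
  rw [← starRingEnd_apply, ← Complex.exp_conj, ← Complex.exp_add]
  simp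

theorem phaseMat_mem (a b c : ℝ) : phaseMat a b c ∈ U3 := by
  rw [Matrix.mem_unitaryGroup_iff, phaseMat, Matrix.star_eq_conjTranspose,
    Matrix.diagonal_conjTranspose, Matrix.diagonal_mul_diagonal, ← Matrix.diagonal_one]
  congr 1
  funext i
  fin_cases i <;> exact exp_mul_star_exp _

theorem row_mul_star {U K : Matrix (Fin 3) (Fin 3) ℂ} (hK : K ∈ U3) {i : Fin 3} {w : ℂ}
    (h : ∀ k, U i k = w * K i k) (j : Fin 3) :
    (U * star K) i j = w * (1 : Matrix (Fin 3) (Fin 3) ℂ) i j := by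
  rw [← Matrix.mem_unitaryGroup_iff.1 hK, Matrix.mul_apply, Matrix.mul_apply, Finset.mul_sum]
  exact Finset.sum_congr rfl fun k _ => by rw [h, mul_assoc]

/-- In VV* = 1, row i paired with itself gives |w| = 1, and paired with another row it kills that
row's entry in column i. -/
theorem mul_star_of_row {V : Matrix (Fin 3) (Fin 3) ℂ} (hV : V ∈ U3) {i : Fin 3} {w : ℂ}
    (h : ∀ j, V i j = w * (1 : Matrix (Fin 3) (Fin 3) ℂ) i j) :
    w * star w = 1 ∧ ∀ k, k ≠ i → V k i = 0 := by
  have hV' := Matrix.mem_unitaryGroup_iff.1 hV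
  have key (k : Fin 3) : V k i * star w = (1 : Matrix (Fin 3) (Fin 3) ℂ) k i := by
    rw [← hV', Matrix.mul_apply, Finset.sum_eq_single i]
    · rw [Matrix.star_apply, h, Matrix.one_apply_eq, mul_one]
    · intro j _ hj
      rw [Matrix.star_apply, h, Matrix.one_apply_ne hj.symm, mul_zero, star_zero, mul_zero]
    · simp
  have h1 : w * star w = 1 := by
    rw [← Matrix.one_apply_eq (α := ℂ) i, ← key i, h, Matrix.one_apply_eq, mul_one]
  refine ⟨h1, fun k hk => ?_⟩
  have h2 := key k
  rw [Matrix.one_apply_ne hk] at h2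
  exact (mul_eq_zero.1 h2).resolve_right fun h0 => by simp [h0] at h1

/-- The matrix of the right-hand side of the Euler equation. -/
def eulerMat (α₁ α₂ α₃ β₁ β₂ β₃ β₄ β₅ β₆ : ℝ) : Matrix (Fin 3) (Fin 3) ℂ :=
  phaseMat β₄ β₅ β₆ * (botMat α₃ * phaseMat 0 β₃ 0) *
    (topMat α₂ * phaseMat β₂ 0 0 * (botMat α₁ * phaseMat 0 β₁ 0))

/-- Elimination by rows: α₁ and α₂ are chosen so that the first row of `U` is a multiple of that of
`K₁`. Then U K₁* fixes the first axis up to a phase, by unitarity in its column as well. A third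
angle treats the second row, and a diagonal unitary remains. -/
theorem exists_eulerAngles {U : Matrix (Fin 3) (Fin 3) ℂ} (hU : U ∈ U3) :
    ∃ α₁ α₂ α₃ β₁ β₂ β₃ β₄ β₅ β₆ : ℝ, EulerAngles α₁ α₂ α₃ β₁ β₂ β₃ β₄ β₅ β₆ ∧
      U = eulerMat α₁ α₂ α₃ β₁ β₂ β₃ β₄ β₅ β₆ := by
  obtain ⟨α₁, β₁, w₁, hα₁, hβ₁, h₁, h₁', hy, hz⟩ := exists_angles (U 0 1) (U 0 2)
  -- The common factor `w₁` of the last two entries now plays the role of the second coordinate.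
  obtain ⟨α₂, β₂, w₂, hα₂, hβ₂, h₂, h₂', hx, hw⟩ := exists_angles (U 0 0) w₁
  set K₁ := topMat α₂ * phaseMat β₂ 0 0 * (botMat α₁ * phaseMat 0 β₁ 0) with hK₁
  have mK₁ : K₁ ∈ U3 := mul_mem (mul_mem (topMat_mem _) (phaseMat_mem _ _ _))
    (mul_mem (botMat_mem _) (phaseMat_mem _ _ _))
  have r₁ : ∀ k, U 0 k = w₂ * K₁ 0 k := by
    refine forall_fin_three ?_ ?_ ?_ <;>
      simp only [hK₁, Matrix.mul_apply, Fin.sum_univ_three, topMat, botMat, phaseMat] <;> simp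
    · rw [hx]
      ring
    · rw [hy, hw]
      ring
    · rw [hz, hw]
      ring
  set V := U * star K₁ with hV
  have mV : V ∈ U3 := mul_mem hU (Unitary.star_mem mK₁)
  have rV : ∀ j, V 0 j = w₂ * (1 : Matrix (Fin 3) (Fin 3) ℂ) 0 j := row_mul_star mK₁ r₁
  obtain ⟨hw₂, cV⟩ := mul_star_of_row mV rV
  obtain ⟨α₃, β₃, w₃, hα₃, hβ₃, h₃, h₃', hy₃, hz₃⟩ := exists_angles (V 1 1) (V 1 2)
  set K₂ := botMat α₃ * phaseMat 0 β₃ 0 with hK₂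
  have mK₂ : K₂ ∈ U3 := mul_mem (botMat_mem _) (phaseMat_mem _ _ _)
  have r₂ : ∀ k, V 0 k = w₂ * K₂ 0 k := by
    simp only [rV]
    refine forall_fin_three ?_ ?_ ?_ <;>
      simp only [hK₂, Matrix.mul_apply, Fin.sum_univ_three, botMat, phaseMat] <;> simp
  have r₃ : ∀ k, V 1 k = w₃ * K₂ 1 k := by
    refine forall_fin_three ?_ ?_ ?_ <;>
      simp only [hK₂, Matrix.mul_apply, Fin.sum_univ_three, botMat, phaseMat] <;> simp
    · exact cV 1 (by decide)
    · rw [hy₃]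
      ring
    · rw [hz₃]
  set W := V * star K₂ with hW
  have mW : W ∈ U3 := mul_mem mV (Unitary.star_mem mK₂)
  have rW₀ : ∀ j, W 0 j = w₂ * (1 : Matrix (Fin 3) (Fin 3) ℂ) 0 j := row_mul_star mK₂ r₂
  have rW₁ : ∀ j, W 1 j = w₃ * (1 : Matrix (Fin 3) (Fin 3) ℂ) 1 j := row_mul_star mK₂ r₃
  obtain ⟨hw₃, cW₁⟩ := mul_star_of_row mW rW₁
  obtain ⟨-, cW₀⟩ := mul_star_of_row mW rW₀
  -- The first two rows are already diagonal, so by unitarity the third row vanishes in their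
  -- columns.
  have rW₂ : ∀ j, W 2 j = W 2 2 * (1 : Matrix (Fin 3) (Fin 3) ℂ) 2 j := by
    refine forall_fin_three ?_ ?_ ?_
    · simp [cW₀ 2 (by decide)]
    · simp [cW₁ 2 (by decide)]
    · simp
  obtain ⟨hw₄, -⟩ := mul_star_of_row mW rW₂
  obtain ⟨β₄, hβ₄, e₄⟩ := exists_exp_of_norm_eq_one hw₂
  obtain ⟨β₅, hβ₅, e₅⟩ := exists_exp_of_norm_eq_one hw₃
  obtain ⟨β₆, hβ₆, e₆⟩ := exists_exp_of_norm_eq_one hw₄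
  have hWd : W = phaseMat β₄ β₅ β₆ := by
    refine Matrix.ext (forall_fin_three ?_ ?_ ?_)
    · simp only [rW₀]
      exact forall_fin_three (by simp [phaseMat, e₄]) (by simp [phaseMat]) (by simp [phaseMat])
    · simp only [rW₁]
      exact forall_fin_three (by simp [phaseMat]) (by simp [phaseMat, e₅]) (by simp [phaseMat])
    · intro j
      rw [rW₂, e₆]
      revert j
      exact forall_fin_three (by simp [phaseMat]) (by simp [phaseMat]) (by simp [phaseMat])
  refine ⟨α₁, α₂, α₃, β₁, β₂, β₃, β₄, β₅, β₆, ⟨hα₁, hα₂, hα₃, hβ₁, hβ₂, hβ₃, hβ₄, hβ₅, hβ₆,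
    h₁, h₂, h₃, fun h => h₁' ?_⟩, ?_⟩
  -- α₂ = 0 makes `w₁` vanish, hence also the last entry of the first row.
  · rw [hz, hw, h]; simp
  · rw [eulerMat, ← hWd, hW, mul_assoc V, Matrix.mem_unitaryGroup_iff'.1 mK₂, mul_one, hV,
      mul_assoc U, Matrix.mem_unitaryGroup_iff'.1 mK₁, mul_one]

/-! ### The matrices of the two sides of the Euler equation -/

/-- The matrix of the spatial semantics. -/
def spat {n m : ℕ} (D : Circuit n m) : Matrix (Fin m) (Fin n) ℂ := LinearMap.toMatrix' (interpH D)

theorem spat_apply {n m : ℕ} (D : Circuit n m) (i : Fin m) (j : Fin n) :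
    spat D i j = interp D (ket (Pol.H, j)) (Pol.H, i) := by
  rw [spat, LinearMap.toMatrix'_apply, ← iotaH_single]
  rfl

theorem spat_comp {a b c : ℕ} {D : Circuit a b} (hD : D.PolPreserving) (D' : Circuit b c) :
    spat (D ⨟ D') = spat D' * spat D := by
  rw [spat, spat, spat, ← LinearMap.toMatrix'_comp]
  congr 1
  rw [interpH, interp, LinearMap.comp_assoc, interpH_spec D hD]
  rfl

theorem castAdd_zero : (Fin.castAdd 1 (0 : Fin 2)) = (0 : Fin 3) := rfl

theorem castAdd_one : (Fin.castAdd 1 (1 : Fin 2)) = (1 : Fin 3) := rfl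

theorem natAdd_zero : (Fin.natAdd 1 (0 : Fin 2)) = (1 : Fin 3) := rfl

theorem natAdd_one : (Fin.natAdd 1 (1 : Fin 2)) = (2 : Fin 3) := rfl

theorem castAdd_zero' : (Fin.castAdd 1 (0 : Fin 1)) = (0 : Fin 2) := rfl

theorem natAdd_two : (Fin.natAdd 2 (0 : Fin 1)) = (2 : Fin 3) := rfl

theorem spat_onTop_bs (θ : ℝ) : spat (onTop (bs θ)) = topMat θ := by
  refine Matrix.ext (forall_fin_three ?_ ?_ ?_) <;> refine forall_fin_three ?_ ?_ ?_ <;>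
    simp [spat_apply, interp_onTop_zero, interp_onTop_one, interp_onTop_two, interp_bs_apply,
      ket_apply, topMat, castAdd_zero, castAdd_one]

theorem spat_onBottom_bs (θ : ℝ) : spat (onBottom (bs θ)) = botMat θ := by
  refine Matrix.ext (forall_fin_three ?_ ?_ ?_) <;> refine forall_fin_three ?_ ?_ ?_ <;>
    simp [spat_apply, interp_onBottom_zero, interp_onBottom_one, interp_onBottom_two,
      interp_bs_apply, ket_apply, botMat, natAdd_zero, natAdd_one]

theorem interp_parallel_zero (D₀ D₁ D₂ : Circuit 1 1) (x : State 3) (c : Pol) :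
    interp (parallel D₀ D₁ D₂) x (c, (0 : Fin 3)) =
      interp D₀ (topL 1 1 (topL 2 1 x)) (c, 0) := by
  have h := congrFun (topL_interp_tensor (D₀ ⊞ₗ D₁) D₂ x) (c, 0)
  exact h.trans (congrFun (topL_interp_tensor D₀ D₁ (topL 2 1 x)) (c, 0))

theorem interp_parallel_one (D₀ D₁ D₂ : Circuit 1 1) (x : State 3) (c : Pol) :
    interp (parallel D₀ D₁ D₂) x (c, (1 : Fin 3)) =
      interp D₁ (botL 1 1 (topL 2 1 x)) (c, 0) := by
  have h := congrFun (topL_interp_tensor (D₀ ⊞ₗ D₁) D₂ x) (c, 1)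
  exact h.trans (congrFun (botL_interp_tensor D₀ D₁ (topL 2 1 x)) (c, 0))

theorem interp_parallel_two (D₀ D₁ D₂ : Circuit 1 1) (x : State 3) (c : Pol) :
    interp (parallel D₀ D₁ D₂) x (c, (2 : Fin 3)) = interp D₂ (botL 2 1 x) (c, 0) :=
  congrFun (botL_interp_tensor (D₀ ⊞ₗ D₁) D₂ x) (c, 0)

theorem spat_parallel {D₀ D₁ D₂ : Circuit 1 1} {a b c : ℝ} (h₀ : interp D₀ = interp (phase a))
    (h₁ : interp D₁ = interp (phase b)) (h₂ : interp D₂ = interp (phase c)) :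
    spat (parallel D₀ D₁ D₂) = phaseMat a b c := by
  refine Matrix.ext (forall_fin_three ?_ ?_ ?_) <;> refine forall_fin_three ?_ ?_ ?_ <;>
    simp [spat_apply, interp_parallel_zero, interp_parallel_one, interp_parallel_two, h₀, h₁, h₂,
      interp_phase_apply, topL, botL, LinearMap.funLeft_apply, ket_apply, phaseMat, castAdd_zero, castAdd_one,
      castAdd_zero', natAdd_two]

theorem interp_wire : interp wire = interp (phase 0) :=
  (interp_eq_of_provable .phase_zero).symm

theorem spat_eulerLeft (θ₁ θ₂ θ₃ φ₁ φ₂ : ℝ) : spat (eulerLeft θ₁ θ₂ θ₃ φ₁ φ₂) =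
    topMat θ₃ * (botMat θ₂ * (phaseMat φ₂ φ₁ 0 * topMat θ₁)) := by
  rw [eulerLeft, spat_comp, spat_comp, spat_comp, spat_onTop_bs, spat_onTop_bs, spat_onBottom_bs,
    spat_parallel rfl rfl interp_wire] <;>
  simp [onTop, onBottom, parallel, PolPreserving]

theorem spat_eulerRight (α₁ α₂ α₃ β₁ β₂ β₃ β₄ β₅ β₆ : ℝ) :
    spat (eulerRight α₁ α₂ α₃ β₁ β₂ β₃ β₄ β₅ β₆) = eulerMat α₁ α₂ α₃ β₁ β₂ β₃ β₄ β₅ β₆ := by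
  rw [eulerRight, spat_comp, spat_comp, spat_comp, spat_comp, spat_comp, spat_comp, spat_onTop_bs,
    spat_onBottom_bs, spat_onBottom_bs, spat_parallel interp_wire rfl interp_wire,
    spat_parallel rfl interp_wire interp_wire, spat_parallel interp_wire rfl interp_wire,
    spat_parallel rfl rfl rfl, eulerMat]
  · simp only [mul_assoc]
  all_goals simp [onTop, onBottom, parallel, PolPreserving]

theorem exists_euler (θ₁ θ₂ θ₃ φ₁ φ₂ : ℝ) : ∃ α₁ α₂ α₃ β₁ β₂ β₃ β₄ β₅ β₆ : ℝ,
    EulerAngles α₁ α₂ α₃ β₁ β₂ β₃ β₄ β₅ β₆ ∧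
      spat (eulerLeft θ₁ θ₂ θ₃ φ₁ φ₂) = eulerMat α₁ α₂ α₃ β₁ β₂ β₃ β₄ β₅ β₆ := by
  rw [spat_eulerLeft]
  exact exists_eulerAngles (mul_mem (topMat_mem _) (mul_mem (botMat_mem _)
    (mul_mem (phaseMat_mem _ _ _) (topMat_mem _))))

namespace Hom

theorem mk_eulerLeft_of_spat {θ₁ θ₂ θ₃ φ₁ φ₂ α₁ α₂ α₃ β₁ β₂ β₃ β₄ β₅ β₆ : ℝ}
    (h : EulerAngles α₁ α₂ α₃ β₁ β₂ β₃ β₄ β₅ β₆)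
    (hU : spat (eulerLeft θ₁ θ₂ θ₃ φ₁ φ₂) = eulerMat α₁ α₂ α₃ β₁ β₂ β₃ β₄ β₅ β₆) :
    mk (eulerLeft θ₁ θ₂ θ₃ φ₁ φ₂) = mk (eulerRight α₁ α₂ α₃ β₁ β₂ β₃ β₄ β₅ β₆) := by
  rw [← spat_eulerRight] at hU
  exact mk_eq_mk.2 (.euler _ _ _ _ _ _ _ _ _ _ _ _ _ _ h (LinearMap.toMatrix'.injective hU.symm))

/-- Left-hand sides of the Euler equation with the same semantics are provably equal. -/
theorem mk_eulerLeft_congr {θ₁ θ₂ θ₃ φ₁ φ₂ θ₁' θ₂' θ₃' φ₁' φ₂' : ℝ}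
    (h : topMat θ₃ * (botMat θ₂ * (phaseMat φ₂ φ₁ 0 * topMat θ₁)) =
      topMat θ₃' * (botMat θ₂' * (phaseMat φ₂' φ₁' 0 * topMat θ₁'))) :
    mk (eulerLeft θ₁ θ₂ θ₃ φ₁ φ₂) = mk (eulerLeft θ₁' θ₂' θ₃' φ₁' φ₂') := by
  -- The same angles serve both circuits, so uniqueness of Euler angles is not needed.
  obtain ⟨α₁, α₂, α₃, β₁, β₂, β₃, β₄, β₅, β₆, hE, hU⟩ := exists_euler θ₁ θ₂ θ₃ φ₁ φ₂
  rw [mk_eulerLeft_of_spat hE hU,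
    mk_eulerLeft_of_spat hE (by rw [← hU, spat_eulerLeft, spat_eulerLeft, h])]

theorem mk_eulerLeft (θ₁ θ₂ θ₃ φ₁ φ₂ : ℝ) : mk (eulerLeft θ₁ θ₂ θ₃ φ₁ φ₂) =
    (bsp θ₁ ⊗ₗ id 1) * ((ph φ₂ ⊗ₗ ph φ₁) ⊗ₗ id 1) * (id 1 ⊗ₗ bsp θ₂) * (bsp θ₃ ⊗ₗ id 1) := rfl

/-! ### Two-wire laws extracted from the Euler equation. -/

theorem botMat_zero : botMat 0 = 1 := by
  refine Matrix.ext (forall_fin_three ?_ ?_ ?_) <;> refine forall_fin_three ?_ ?_ ?_ <;>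
    simp [botMat]

theorem topMat_zero : topMat 0 = 1 := by
  refine Matrix.ext (forall_fin_three ?_ ?_ ?_) <;> refine forall_fin_three ?_ ?_ ?_ <;>
    simp [topMat]

theorem phaseMat_zero : phaseMat 0 0 0 = 1 := by
  refine Matrix.ext (forall_fin_three ?_ ?_ ?_) <;> refine forall_fin_three ?_ ?_ ?_ <;>
    simp [phaseMat]

/-- Two-wire circuits of the form of the left-hand side of the Euler equation with the same
semantics are provably equal. -/
theorem bsp_ph_bsp_congr {θ₁ θ₃ φ₁ φ₂ θ₁' θ₃' φ₁' φ₂' : ℝ}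
    (h : topMat θ₃ * (phaseMat φ₂ φ₁ 0 * topMat θ₁) =
      topMat θ₃' * (phaseMat φ₂' φ₁' 0 * topMat θ₁')) :
    bsp θ₁ * (ph φ₂ ⊗ₗ ph φ₁) * bsp θ₃ = bsp θ₁' * (ph φ₂' ⊗ₗ ph φ₁') * bsp θ₃' := by
  -- A middle beam splitter of angle 0 leaves the third wire untouched, so it can be cancelled.
  have key (θ₁ θ₃ φ₁ φ₂ : ℝ) : mk (eulerLeft θ₁ 0 θ₃ φ₁ φ₂) =
      (bsp θ₁ * (ph φ₂ ⊗ₗ ph φ₁) * bsp θ₃) ⊗ₗ id 1 := by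
    rw [mk_eulerLeft, bsp_zero, show (id 1 ⊗ₗ (1 : Hom 2 2)) = (1 : Hom 3 3) from id_tensor_id 1 2,
      mul_tensor_id, mul_tensor_id]
    exact congrArg (· * (bsp θ₃ ⊗ₗ id 1)) (mul_one (M := Hom 3 3) _)
  refine tensor_id_one_cancel ?_
  rw [← key, ← key]
  exact mk_eulerLeft_congr (by rw [botMat_zero, one_mul, one_mul, h])

theorem ph_zero_tensor : ph 0 ⊗ₗ ph 0 = 1 := by
  rw [ph_zero, one_def, id_tensor_id, ← one_def]

theorem topMat_mul (θ θ' : ℝ) : topMat θ * topMat θ' = topMat (θ + θ') := by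
  have hI := Complex.I_mul_I
  refine Matrix.ext (forall_fin_three ?_ ?_ ?_) <;> refine forall_fin_three ?_ ?_ ?_ <;>
    simp only [Matrix.mul_apply, Fin.sum_univ_three, topMat] <;>
    simp [Complex.cos_add, Complex.sin_add] <;>
    first | ring1 | linear_combination Complex.sin θ * Complex.sin θ' * hI

theorem bsp_mul (θ θ' : ℝ) : bsp θ * bsp θ' = bsp (θ + θ') := by
  have h := bsp_ph_bsp_congr (θ₁ := θ) (θ₃ := θ') (φ₁ := 0) (φ₂ := 0) (θ₁' := θ + θ')
    (θ₃' := 0) (φ₁' := 0) (φ₂' := 0)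
    (by rw [phaseMat_zero, one_mul, one_mul, topMat_mul, topMat_mul, zero_add, add_comm])
  simpa only [ph_zero_tensor, mul_one, bsp_zero] using h

/-- The 2π-periodicity of phases: the Euler equation with trivial beam splitters sees φ only through
its exponential. -/
theorem ph_congr {φ ψ : ℝ} (h : Complex.exp (Complex.I * φ) = Complex.exp (Complex.I * ψ)) :
    ph φ = ph ψ := by
  have h := bsp_ph_bsp_congr (θ₁ := 0) (θ₃ := 0) (φ₁ := 0) (φ₂ := φ) (θ₁' := 0)
    (θ₃' := 0) (φ₁' := 0) (φ₂' := ψ) (by rw [phaseMat, phaseMat, h])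
  simp only [ph_zero, mul_one, one_mul, bsp_zero] at h
  exact tensor_id_one_cancel h

theorem bsp_ph_comm (θ φ : ℝ) : Commute (ph φ ⊗ₗ ph φ) (bsp θ) := by
  have h := bsp_ph_bsp_congr (θ₁ := 0) (θ₃ := θ) (φ₁ := φ) (φ₂ := φ) (θ₁' := θ)
    (θ₃' := 0) (φ₁' := φ) (φ₂' := φ) (by
      rw [topMat_zero, mul_one, one_mul]
      refine Matrix.ext (forall_fin_three ?_ ?_ ?_) <;> refine forall_fin_three ?_ ?_ ?_ <;>
        simp only [Matrix.mul_apply, Fin.sum_univ_three, topMat, phaseMat] <;> simp <;> ring)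
  rw [bsp_zero, one_mul, mul_one] at h
  exact h

theorem bsp_of_sin_eq_zero {θ : ℝ} (h : Real.sin θ = 0) : bsp θ = ph θ ⊗ₗ ph θ := by
  have h' := bsp_ph_bsp_congr (θ₁ := θ) (θ₃ := 0) (φ₁ := 0) (φ₂ := 0) (θ₁' := 0)
    (θ₃' := 0) (φ₁' := θ) (φ₂' := θ) (by
      have hs : Complex.sin θ = 0 := by rw [← Complex.ofReal_sin, h]; simp
      have he : Complex.exp (Complex.I * θ) = Complex.cos θ := by
        rw [mul_comm, Complex.exp_mul_I, hs]; simp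
      rw [topMat_zero, mul_one, one_mul, one_mul, phaseMat_zero, one_mul]
      refine Matrix.ext (forall_fin_three ?_ ?_ ?_) <;> refine forall_fin_three ?_ ?_ ?_ <;>
        simp [topMat, phaseMat, hs, he])
  simpa only [bsp_zero, mul_one, one_mul, ph_zero_tensor] using h'

end Hom

namespace Hom

/-! ### Two-wire circuits -/

/-- A phase shifter on the top one of two wires. -/
def p0 (x : ℝ) : Hom 2 2 := ph x ⊗ₗ id 1

/-- A phase shifter on the bottom one of two wires. -/
def p1 (x : ℝ) : Hom 2 2 := id 1 ⊗ₗ ph x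

theorem p0_mul (x y : ℝ) : p0 x * p0 y = p0 (x + y) := by
  rw [p0, p0, p0, ← ph_mul, mul_tensor_id]

theorem p1_mul (x y : ℝ) : p1 x * p1 y = p1 (x + y) := by
  rw [p1, p1, p1, ← ph_mul, id_tensor_mul]

theorem p0_zero : p0 0 = 1 := by rw [p0, ph_zero, one_def, id_tensor_id, one_def]

theorem p1_zero : p1 0 = 1 := by rw [p1, ph_zero, one_def, id_tensor_id, one_def]

theorem p0_p1_comm (x y : ℝ) : Commute (p0 x) (p1 y) := tensor_commute _ _

theorem ph_tensor_ph (x y : ℝ) : ph x ⊗ₗ ph y = p0 x * p1 y := tensor_eq_mul _ _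

theorem p0_p1_bsp_comm (x θ : ℝ) : Commute (p0 x * p1 x) (bsp θ) := by
  rw [← ph_tensor_ph]
  exact bsp_ph_comm θ x

/-- A circuit on the wires `0, 1` of three wires. -/
def T : Hom 2 2 →* Hom 3 3 where
  toFun u := u ⊗ₗ id 1
  map_one' := id_tensor_id 2 1
  map_mul' f g := mul_tensor_id f g 1

/-- A circuit on the wires `1, 2` of three wires. -/
def Bo : Hom 2 2 →* Hom 3 3 where
  toFun u := id 1 ⊗ₗ u
  map_one' := id_tensor_id 1 2
  map_mul' f g := id_tensor_mul f g 1

/-- The middle wire is shared, which lets its phases pass between the two embeddings. -/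
theorem T_p1 (x : ℝ) : T (p1 x) = Bo (p0 x) := eq_of_heq (tensor_assoc (id 1) (ph x) (id 1))

theorem T_p0 (x : ℝ) : T (p0 x) = (ph x ⊗ₗ id 2 : Hom 3 3) := by
  rw [← id_tensor_id 1 1]
  exact eq_of_heq (tensor_assoc (ph x) (id 1) (id 1))

theorem Bo_p1 (x : ℝ) : Bo (p1 x) = (id 2 ⊗ₗ ph x : Hom 3 3) := by
  rw [← id_tensor_id 1 1]
  exact (eq_of_heq (tensor_assoc (id 1) (id 1) (ph x))).symm

theorem T_p0_comm (x : ℝ) (u : Hom 2 2) : Commute (T (p0 x)) (Bo u) := by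
  rw [T_p0]
  exact tensor_commute (ph x) u

theorem Bo_p1_comm (x : ℝ) (u : Hom 2 2) : Commute (Bo (p1 x)) (T u) := by
  rw [Bo_p1]
  exact (tensor_commute u (ph x)).symm

theorem tensor_ph_eq (u : Hom 2 2) (x : ℝ) : (u ⊗ₗ ph x : Hom 3 3) = T u * Bo (p1 x) := by
  rw [Bo_p1]
  exact tensor_eq_mul u (ph x)

theorem mk_eulerLeft_eq (θ₁ θ₂ θ₃ φ₁ φ₂ : ℝ) : mk (eulerLeft θ₁ θ₂ θ₃ φ₁ φ₂) =
    T (bsp θ₁) * T (p0 φ₂ * p1 φ₁) * Bo (bsp θ₂) * T (bsp θ₃) := by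
  rw [mk_eulerLeft, ph_tensor_ph]
  rfl

theorem mk_eulerRight_eq (α₁ α₂ α₃ β₁ β₂ β₃ β₄ β₅ β₆ : ℝ) :
    mk (eulerRight α₁ α₂ α₃ β₁ β₂ β₃ β₄ β₅ β₆) =
      T (p1 β₁) * Bo (bsp α₁) * T (p0 β₂) * T (bsp α₂) * T (p1 β₃) * Bo (bsp α₃) *
        (T (p0 β₄ * p1 β₅) * Bo (p1 β₆)) := by
  rw [← tensor_ph_eq, ← ph_tensor_ph]
  rfl

/-- Apply the Euler equation with θ₂ = 0. The left-hand matrix fixes the third axis, and this forces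
every layer of the right-hand side touching the last wire to be trivial. -/
theorem exists_bsp_ph_bsp (θ₁ θ₃ φ₁ φ₂ : ℝ) : ∃ a θ c d : ℝ,
    bsp θ₁ * (p0 φ₂ * p1 φ₁) * bsp θ₃ = p0 a * bsp θ * (p0 c * p1 d) := by
  obtain ⟨α₁, α₂, α₃, β₁, β₂, β₃, β₄, β₅, β₆, hE, hU⟩ := exists_euler θ₁ 0 θ₃ φ₁ φ₂
  have hmk := mk_eulerLeft_of_spat hE hU
  rw [spat_eulerLeft, botMat_zero, one_mul] at hU
  have sin_zero {α : ℝ} (h : α ∈ Set.Ico 0 Real.pi) (hs : Complex.sin α = 0) : α = 0 := by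
    have hs' : Real.sin α = 0 := by exact_mod_cast hs
    by_contra h0
    exact (Real.sin_pos_of_pos_of_lt_pi (lt_of_le_of_ne h.1 (Ne.symm h0)) h.2).ne' hs'
  have e02 := congrFun (congrFun hU 0) 2
  have e12 := congrFun (congrFun hU 1) 2
  have e22 := congrFun (congrFun hU 2) 2
  simp only [eulerMat, Matrix.mul_apply, Fin.sum_univ_three, topMat, botMat, phaseMat]
    at e02 e12 e22
  simp at e02 e12 e22
  -- The entry (0, 2) is a multiple of sin α₂ sin α₁; if the first factor vanishes, the convention
  -- on α₂ = 0 still gives α₁ = 0.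
  have hα₁ : α₁ = 0 := by
    rcases e02 with h | h
    · exact hE.hα₂₁ (sin_zero hE.hα₂ h)
    · exact sin_zero hE.hα₁ h
  have hβ₁ := hE.hαβ₁ (Or.inl hα₁)
  subst hα₁ hβ₁
  simp at e12 e22
  have hα₃ : α₃ = 0 := sin_zero hE.hα₃ e12
  have hβ₃ := hE.hαβ₃ (Or.inl hα₃)
  subst hα₃ hβ₃
  simp at e22
  have hβ₆ : p1 β₆ = 1 := by
    rw [p1, ph_congr (ψ := 0) (by simpa using e22.symm), ← p1, p1_zero]
  refine ⟨β₂, α₂, β₄, β₅, tensor_id_one_cancel ?_⟩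
  rw [mk_eulerLeft_eq, mk_eulerRight_eq, bsp_zero, p1_zero, hβ₆] at hmk
  simp only [map_one, mul_one, one_mul, ← map_mul] at hmk
  exact hmk

/-- The normal form of two-wire circuits. -/
def NF2 (u : Hom 2 2) : Prop :=
  ∃ a b θ c d : ℝ, u = p0 a * p1 b * bsp θ * (p0 c * p1 d)

theorem NF2.mul {u v : Hom 2 2} (hu : NF2 u) (hv : NF2 v) : NF2 (u * v) := by
  obtain ⟨a, b, θ, c, d, rfl⟩ := hu
  obtain ⟨a', b', θ', c', d', rfl⟩ := hv
  obtain ⟨x, θ'', y, z, h⟩ := exists_bsp_ph_bsp θ θ' (d + b') (c + a')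
  refine ⟨a + x, b, θ'', y + c', z + d', ?_⟩
  have e : p0 c * p1 d * (p0 a' * p1 b') = p0 (c + a') * p1 (d + b') := by
    rw [← p0_mul, ← p1_mul, mul_assoc, ← mul_assoc (p1 d), ← (p0_p1_comm a' d).eq]
    simp only [mul_assoc]
  have e' : p0 y * p1 z * (p0 c' * p1 d') = p0 (y + c') * p1 (z + d') := by
    rw [← p0_mul, ← p1_mul, mul_assoc, ← mul_assoc (p1 z), ← (p0_p1_comm c' z).eq]
    simp only [mul_assoc]
  calc _ = p0 a * p1 b * (bsp θ * (p0 c * p1 d * (p0 a' * p1 b')) * bsp θ') *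
        (p0 c' * p1 d') := by simp only [mul_assoc]
    _ = p0 a * p1 b * p0 x * bsp θ'' * (p0 y * p1 z * (p0 c' * p1 d')) := by
        rw [e, h]; simp only [mul_assoc]
    _ = _ := by
        rw [e', mul_assoc (p0 a), ← (p0_p1_comm x b).eq, ← mul_assoc (p0 a) (p0 x), p0_mul]

theorem NF2_p0 (x : ℝ) : NF2 (p0 x) :=
  ⟨x, 0, 0, 0, 0, by rw [p0_zero, p1_zero, bsp_zero, mul_one, mul_one, mul_one, mul_one]⟩

theorem NF2_p1 (x : ℝ) : NF2 (p1 x) :=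
  ⟨0, x, 0, 0, 0, by rw [p0_zero, p1_zero, bsp_zero, mul_one, mul_one, one_mul, mul_one]⟩

theorem NF2_bsp (θ : ℝ) : NF2 (bsp θ) :=
  ⟨0, 0, θ, 0, 0, by rw [p0_zero, p1_zero, mul_one, mul_one, one_mul]⟩

theorem NF2_one : NF2 1 := p0_zero ▸ NF2_p0 0

theorem NF2_sw : NF2 sw := by
  rw [sw_eq, ph_tensor_ph]
  exact ((NF2_p0 _).mul (NF2_p1 _)).mul (NF2_bsp _)

/-! ### Three-wire circuits -/

/-- Equal phases on both wires commute with the beam splitter, so `b` on both wires is moved to the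
right. Only a phase on the top wire remains on the left. -/
theorem NF2.exists_left {u : Hom 2 2} (hu : NF2 u) :
    ∃ a θ c d : ℝ, u = p0 a * bsp θ * (p0 c * p1 d) := by
  obtain ⟨a, b, θ, c, d, rfl⟩ := hu
  refine ⟨a - b, θ, b + c, b + d, ?_⟩
  rw [← p0_mul b, ← p1_mul b, ← sub_add_cancel a b, ← p0_mul, add_sub_cancel_right, mul_assoc (p0 _),
    mul_assoc (p0 _), (p0_p1_bsp_comm b θ).eq, mul_assoc (p0 b) (p0 c), ← mul_assoc (p0 c),
    (p0_p1_comm c b).eq]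
  simp only [mul_assoc]

theorem NF2.exists_right {u : Hom 2 2} (hu : NF2 u) :
    ∃ a b θ d : ℝ, u = p0 a * p1 b * bsp θ * p1 d := by
  obtain ⟨a, b, θ, c, d, rfl⟩ := hu
  refine ⟨a + c, b + c, θ, d - c, ?_⟩
  rw [← p0_mul a, ← p1_mul b, ← add_sub_cancel c d, ← p1_mul, add_sub_cancel, ← mul_assoc (p0 c),
    mul_assoc (p0 a * p1 b), ← mul_assoc (bsp θ), ← (p0_p1_bsp_comm c θ).eq, mul_assoc (p0 a) (p0 c),
    ← mul_assoc (p0 c) (p1 b), (p0_p1_comm c b).eq]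
  simp only [mul_assoc]

/-- The right-hand side of the Euler equation already has the wanted shape once middle-wire phases
are assigned to `Bo` and the final top-wire phase β₄ is moved back past the last beam splitter on
wires 12. -/
theorem exists_euler_Bo_T_Bo (θ₁ θ₂ θ₃ φ₁ φ₂ : ℝ) : ∃ u v w, NF2 u ∧ NF2 v ∧ NF2 w ∧
    T (bsp θ₁) * T (p0 φ₂ * p1 φ₁) * Bo (bsp θ₂) * T (bsp θ₃) = Bo u * T v * Bo w := by
  obtain ⟨α₁, α₂, α₃, β₁, β₂, β₃, β₄, β₅, β₆, hE, hU⟩ := exists_euler θ₁ θ₂ θ₃ φ₁ φ₂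
  have hmk := mk_eulerLeft_of_spat hE hU
  rw [mk_eulerLeft_eq, mk_eulerRight_eq] at hmk
  refine ⟨p0 β₁ * bsp α₁, p0 β₂ * bsp α₂ * p0 β₄, p0 β₃ * bsp α₃ * (p0 β₅ * p1 β₆),
    (NF2_p0 _).mul (NF2_bsp _), ((NF2_p0 _).mul (NF2_bsp _)).mul (NF2_p0 _),
    ((NF2_p0 _).mul (NF2_bsp _)).mul ((NF2_p0 _).mul (NF2_p1 _)), ?_⟩
  rw [hmk]
  simp only [map_mul, T_p1, mul_assoc]
  have h := (T_p0_comm β₄ (p0 β₃ * bsp α₃)).eq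
  simp only [map_mul, mul_assoc] at h
  rw [← mul_assoc (Bo (bsp α₃)), ← mul_assoc (Bo (p0 β₃)), ← h]
  simp only [mul_assoc]

/-- The one-sided forms of `v` and `w` reduce the product to an Euler left-hand side. The leading
top-wire phase of `w` slides past `v` into `u`, the middle-wire phase of `v` merges with those of
`u`, and the phases of `v` on the last wire go to the two ends. -/
theorem exists_T_Bo_T {u v w : Hom 2 2} (hu : NF2 u) (hv : NF2 v) (hw : NF2 w) :
    ∃ u' v' w', NF2 u' ∧ NF2 v' ∧ NF2 w' ∧ T u * Bo v * T w = Bo u' * T v' * Bo w' := by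
  obtain ⟨a, b, θ₁, c, d, rfl⟩ := hu
  obtain ⟨x, y, θ₂, z, rfl⟩ := hv.exists_right
  obtain ⟨e, θ₃, g, h, rfl⟩ := hw.exists_left
  obtain ⟨u, v, w, hu, hv, hw, huvw⟩ := exists_euler_Bo_T_Bo θ₁ θ₂ θ₃ (d + x) (c + e)
  refine ⟨p1 y * (p0 b * u), p0 a * v * p0 g, w * (p0 h * p1 z), (NF2_p1 y).mul ((NF2_p0 b).mul hu),
    ((NF2_p0 a).mul hv).mul (NF2_p0 g), hw.mul ((NF2_p0 h).mul (NF2_p1 z)), ?_⟩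
  have e1 := (T_p0_comm e (p0 x * p1 y * bsp θ₂ * p1 z)).eq
  have e2 : p0 c * p1 d * (p0 e * p1 x) = p0 (c + e) * p1 (d + x) := by
    rw [← p0_mul, ← p1_mul, mul_assoc, ← mul_assoc (p1 d), ← (p0_p1_comm e d).eq]
    simp only [mul_assoc]
  have e3 := (Bo_p1_comm y (p0 a * p1 b * bsp θ₁ * (p0 (c + e) * p1 (d + x)))).eq
  have e4 := (Bo_p1_comm z (bsp θ₃ * (p0 g * p1 h))).eq
  calc _ = T (p0 a * p1 b * bsp θ₁ * (p0 c * p1 d)) *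
        (Bo (p0 x * p1 y * bsp θ₂ * p1 z) * T (p0 e)) * T (bsp θ₃ * (p0 g * p1 h)) := by
        simp only [map_mul, mul_assoc]
    _ = T (p0 a * p1 b * bsp θ₁ * (p0 c * p1 d * (p0 e * p1 x))) * Bo (p1 y) * Bo (bsp θ₂) *
        (Bo (p1 z) * T (bsp θ₃ * (p0 g * p1 h))) := by
        rw [← e1]
        simp only [map_mul, mul_assoc, T_p1]
    _ = Bo (p1 y) * T (p0 a * p1 b) * (T (bsp θ₁) * T (p0 (c + e) * p1 (d + x)) * Bo (bsp θ₂) *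
        T (bsp θ₃)) * T (p0 g * p1 h) * Bo (p1 z) := by
        rw [e2, ← e3, e4]
        simp only [map_mul, mul_assoc]
    _ = Bo (p1 y) * (T (p1 b) * (T (p0 a) * Bo u)) * T v * (Bo w * T (p0 g)) *
          (Bo (p0 h) * Bo (p1 z)) := by
        rw [huvw, (p0_p1_comm a b).eq, map_mul, map_mul, T_p1 h]
        simp only [mul_assoc]
    _ = _ := by
        rw [(T_p0_comm a u).eq, ← (T_p0_comm g w).eq, T_p1]
        simp only [map_mul, mul_assoc]

/-- The symmetry on three wires exchanging the first and the last one. -/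
def flip : Hom 3 3 := T sw * Bo sw * T sw

/-- Naturality of the symmetry moving one wire past two, which the hexagon writes as two swaps. -/
theorem Bo_mul (u : Hom 2 2) : Bo u * (T sw * Bo sw) = T sw * Bo sw * T u := by
  have h := sym_natural (id 1) u
  have h' : sym 1 2 = T sw * Bo sw := mk_eq_mk.2 (.hexagon 1 1 1)
  rw [h'] at h
  exact h

theorem T_sw_mul_T_sw : T sw * T sw = 1 := by rw [← map_mul, sw_mul_sw, map_one]

theorem Bo_sw_mul_Bo_sw : Bo sw * Bo sw = 1 := by rw [← map_mul, sw_mul_sw, map_one]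

theorem T_mul (u : Hom 2 2) : T u * (Bo sw * T sw) = Bo sw * T sw * Bo u := by
  have e : T sw * Bo sw * (Bo sw * T sw) = 1 := by
    rw [mul_assoc, ← mul_assoc (Bo sw), Bo_sw_mul_Bo_sw, one_mul, T_sw_mul_T_sw]
  have e' : Bo sw * T sw * (T sw * Bo sw) = 1 := by
    rw [mul_assoc, ← mul_assoc (T sw), T_sw_mul_T_sw, one_mul, Bo_sw_mul_Bo_sw]
  calc T u * (Bo sw * T sw) = Bo sw * T sw * (T sw * Bo sw * T u) * (Bo sw * T sw) := by
        rw [← mul_assoc (Bo sw * T sw), e', one_mul]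
    _ = Bo sw * T sw * Bo u := by
        rw [← Bo_mul, mul_assoc, mul_assoc (Bo u), e, mul_one]

theorem T_mul_flip (u : Hom 2 2) : T u * flip = flip * Bo (sw * u * sw) := by
  have h : T u * T sw = T sw * T (sw * u * sw) := by
    rw [← map_mul, ← map_mul, ← mul_assoc, ← mul_assoc, sw_mul_sw, one_mul]
  calc T u * flip = T u * T sw * (Bo sw * T sw) := by rw [flip]; simp only [mul_assoc]
    _ = flip * Bo (sw * u * sw) := by
      rw [h, mul_assoc, T_mul, flip]; simp only [mul_assoc]

theorem Bo_mul_flip (u : Hom 2 2) : Bo u * flip = flip * T (sw * u * sw) := by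
  have h : T u * T sw = T sw * T (sw * u * sw) := by
    rw [← map_mul, ← map_mul, ← mul_assoc, ← mul_assoc, sw_mul_sw, one_mul]
  rw [flip, ← mul_assoc, Bo_mul, mul_assoc _ (T u), h, ← mul_assoc]

theorem flip_mul_flip : flip * flip = 1 := by
  calc flip * flip = T sw * (Bo sw * (T sw * T sw) * Bo sw) * T sw := by
        simp only [flip, mul_assoc]
    _ = 1 := by rw [T_sw_mul_T_sw, mul_one, Bo_sw_mul_Bo_sw, mul_one, T_sw_mul_T_sw]

theorem sw_mul_mul_sw (u : Hom 2 2) : sw * (sw * u * sw) * sw = u := by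
  rw [mul_assoc sw u, ← mul_assoc, sw_mul_sw, one_mul, mul_assoc, sw_mul_sw, mul_one]

theorem Bo_T_Bo_mul_flip (u v w : Hom 2 2) : Bo u * T v * Bo w * flip =
    flip * (T (sw * u * sw) * Bo (sw * v * sw) * T (sw * w * sw)) := by
  rw [mul_assoc _ (Bo w), Bo_mul_flip, ← mul_assoc _ flip, mul_assoc _ (T v), T_mul_flip,
    ← mul_assoc _ flip, Bo_mul_flip]
  simp only [mul_assoc]

theorem T_Bo_T_mul_flip (u v w : Hom 2 2) : T u * Bo v * T w * flip =
    flip * (Bo (sw * u * sw) * T (sw * v * sw) * Bo (sw * w * sw)) := by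
  rw [mul_assoc _ (T w), T_mul_flip, ← mul_assoc _ flip, mul_assoc _ (Bo v), Bo_mul_flip,
    ← mul_assoc _ flip, T_mul_flip]
  simp only [mul_assoc]

/-- `exists_T_Bo_T` starts only from the pattern 01, 12, 01. Conjugation by the reversal `flip`
exchanges the two patterns and preserves normal forms, since swaps have one. -/
theorem exists_Bo_T_Bo {u v w : Hom 2 2} (hu : NF2 u) (hv : NF2 v) (hw : NF2 w) :
    ∃ u' v' w', NF2 u' ∧ NF2 v' ∧ NF2 w' ∧ Bo u * T v * Bo w = T u' * Bo v' * T w' := by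
  have hs {u : Hom 2 2} (hu : NF2 u) : NF2 (sw * u * sw) := (NF2_sw.mul hu).mul NF2_sw
  obtain ⟨u', v', w', hu', hv', hw', h⟩ := exists_T_Bo_T (hs hu) (hs hv) (hs hw)
  refine ⟨_, _, _, hs hu', hs hv', hs hw', ?_⟩
  have e : Bo u * T v * Bo w * flip =
      T (sw * u' * sw) * Bo (sw * v' * sw) * T (sw * w' * sw) * flip := by
    rw [Bo_T_Bo_mul_flip, h, T_Bo_T_mul_flip, sw_mul_mul_sw, sw_mul_mul_sw, sw_mul_mul_sw]
  rw [← mul_one (Bo u * T v * Bo w), ← flip_mul_flip, ← mul_assoc, e, mul_assoc _ flip,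
    flip_mul_flip, mul_one]

end Hom

namespace Hom

/-! ### Circuits made of phase shifters and beam splitters -/

/-- Adding a wire at the bottom. -/
def wk {N : ℕ} : Hom N N →* Hom (N + 1) (N + 1) where
  toFun f := f ⊗ₗ id 1
  map_one' := id_tensor_id N 1
  map_mul' f g := mul_tensor_id f g 1

/-- A circuit on the last two wires. -/
def at2 (k : ℕ) : Hom 2 2 →* Hom (k + 2) (k + 2) where
  toFun u := id k ⊗ₗ u
  map_one' := id_tensor_id k 2
  map_mul' f g := id_tensor_mul f g k

/-- A circuit on the last three wires. -/
def at3 (k : ℕ) : Hom 3 3 →* Hom (k + 3) (k + 3) where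
  toFun u := id k ⊗ₗ u
  map_one' := id_tensor_id k 3
  map_mul' f g := id_tensor_mul f g k

theorem wk_wk {N : ℕ} (f : Hom N N) : wk (wk f) = (f ⊗ₗ id 2 : Hom (N + 2) (N + 2)) := by
  rw [← id_tensor_id 1 1]
  exact eq_of_heq (tensor_assoc f (id 1) (id 1))

theorem at2_comm {k : ℕ} (u : Hom 2 2) (f : Hom k k) : Commute (at2 k u) (wk (wk f)) := by
  rw [wk_wk]
  exact (tensor_commute f u).symm

theorem at3_Bo (k : ℕ) (u : Hom 2 2) : at3 k (Bo u) = at2 (k + 1) u := by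
  have h : at2 (k + 1) u = (id k ⊗ₗ id 1 : Hom (k + 1) (k + 1)) ⊗ₗ u := by
    rw [id_tensor_id]
    rfl
  rw [h]
  exact (eq_of_heq (tensor_assoc (id k) (id 1) u)).symm

theorem at3_T (k : ℕ) (u : Hom 2 2) : at3 k (T u) = wk (at2 k u) :=
  (eq_of_heq (tensor_assoc (id k) u (id 1))).symm

theorem at2_p0 (k : ℕ) (x : ℝ) : at2 k (p0 x) = wk (id k ⊗ₗ ph x) :=
  (eq_of_heq (tensor_assoc (id k) (ph x) (id 1))).symm

theorem at2_p1 (k : ℕ) (x : ℝ) : at2 k (p1 x) = id (k + 1) ⊗ₗ ph x := by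
  rw [← id_tensor_id k 1]
  exact (eq_of_heq (tensor_assoc (id k) (id 1) (ph x))).symm

/-- The generators of the circuits without polarisation. -/
inductive SGen : (N : ℕ) → Hom N N → Prop
  | phase (φ : ℝ) : SGen 1 (ph φ)
  | last (k : ℕ) {u : Hom 2 2} (hu : NF2 u) : SGen (k + 2) (at2 k u)
  | wk {N : ℕ} {g : Hom N N} (hg : SGen N g) : SGen (N + 1) (wk g)

/-- The circuits made of phase shifters and beam splitters. -/
def Spatial (N : ℕ) : Submonoid (Hom N N) := Submonoid.closure {g | SGen N g}

theorem SGen.exists_of_one {g : Hom 1 1} (hg : SGen 1 g) : ∃ φ, g = ph φ := by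
  cases hg with
  | phase φ => exact ⟨φ, rfl⟩
  | wk hg => cases hg

theorem SGen.of_add_two {k : ℕ} {g : Hom (k + 2) (k + 2)} (hg : SGen (k + 2) g) :
    (∃ u, NF2 u ∧ g = at2 k u) ∨ ∃ g', SGen (k + 1) g' ∧ g = Hom.wk g' := by
  cases hg with
  | last k hu => exact Or.inl ⟨_, hu, rfl⟩
  | wk hg => exact Or.inr ⟨_, hg, rfl⟩

theorem Spatial.of_gen {N : ℕ} {g : Hom N N} (hg : SGen N g) : g ∈ Spatial N :=
  Submonoid.subset_closure hg

theorem Spatial.wk {N : ℕ} {f : Hom N N} (hf : f ∈ Spatial N) : Hom.wk f ∈ Spatial (N + 1) := by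
  have h : Spatial N ≤ (Spatial (N + 1)).comap Hom.wk :=
    Submonoid.closure_le.2 fun g hg => Spatial.of_gen hg.wk
  exact h hf

theorem Spatial.last_phase (k : ℕ) (x : ℝ) : id k ⊗ₗ ph x ∈ Spatial (k + 1) := by
  cases k with
  | zero =>
    rw [show (id 0 ⊗ₗ ph x : Hom (0 + 1) (0 + 1)) = ph x from eq_of_heq (id_zero_tensor (ph x))]
    exact Spatial.of_gen (.phase x)
  | succ k =>
    rw [← at2_p1]
    exact Spatial.of_gen (.last k (NF2_p1 x))

theorem Spatial.eq_one {f : Hom 0 0} (hf : f ∈ Spatial 0) : f = 1 := by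
  have h : Spatial 0 ≤ ⊥ := Submonoid.closure_le.2 fun g hg => by cases hg
  exact Submonoid.mem_bot.1 (h hf)

/-- Staircases: the last wire is brought to the top by a sequence of two-wire circuits. -/
def Stair : (N : ℕ) → Hom N N → Prop
  | 0, f => f = 1
  | 1, f => ∃ φ, f = ph φ
  | k + 2, f => ∃ u S, NF2 u ∧ Stair (k + 1) S ∧ f = at2 k u * wk S

theorem Stair.mem : {N : ℕ} → {S : Hom N N} → Stair N S → S ∈ Spatial N
  | 0, _, h => by rw [h]; exact one_mem _
  | 1, _, ⟨φ, h⟩ => by rw [h]; exact Spatial.of_gen (.phase φ)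
  | k + 2, _, ⟨_, _, hu, hS, h⟩ => by
    rw [h]
    exact mul_mem (Spatial.of_gen (.last k hu)) (Spatial.wk hS.mem)

theorem Stair.one : (N : ℕ) → Stair N 1
  | 0 => rfl
  | 1 => ⟨0, ph_zero.symm⟩
  | k + 2 => ⟨1, 1, NF2_one, Stair.one (k + 1), by rw [map_one, map_one, mul_one]⟩

/-- A generator pushed into a staircase either acts above the last wire, where the induction
hypothesis applies to the tail, or meets the first two steps in a pattern that `exists_Bo_T_Bo`
reverses. What is expelled to the front never touches the last wire. -/
theorem Stair.mul_gen {N : ℕ} {S g : Hom (N + 1) (N + 1)} (hS : Stair (N + 1) S)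
    (hg : SGen (N + 1) g) : ∃ h ∈ Spatial N, ∃ S', Stair (N + 1) S' ∧ S * g = wk h * S' := by
  induction N with
  | zero =>
    obtain ⟨φ, rfl⟩ := hS
    obtain ⟨ψ, rfl⟩ := hg.exists_of_one
    exact ⟨1, one_mem _, _, ⟨φ + ψ, rfl⟩, by rw [ph_mul, map_one, one_mul]⟩
  | succ k ih =>
    obtain ⟨u, S, hu, hS, rfl⟩ := hS
    rcases hg.of_add_two with ⟨v, hv, rfl⟩ | ⟨g, hg', rfl⟩
    · cases k with
      | zero =>
        obtain ⟨φ, rfl⟩ := hS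
        have h0 : wk (ph φ) = at2 0 (p0 φ) := by
          rw [at2_p0, show (id 0 ⊗ₗ ph φ : Hom (0 + 1) (0 + 1)) = ph φ from
            eq_of_heq (id_zero_tensor (ph φ))]
        -- With only two wires nothing is expelled: all factors fuse into a single normal form with
        -- a trivial tail.
        refine ⟨1, one_mem _, _, ⟨u * p0 φ * v, 1, (hu.mul (NF2_p0 φ)).mul hv, Stair.one 1, rfl⟩, ?_⟩
        simp only [map_one, mul_one, one_mul, map_mul, h0]
      | succ k =>
        obtain ⟨u', S, hu', hS, rfl⟩ := hS
        -- `v` commutes with the rest of the staircase and so lands next to the two steps `u` and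
        -- `u'`.
        obtain ⟨a, b, c, ha, hb, hc, h⟩ := exists_Bo_T_Bo hu hu' hv
        have h' := congrArg (at3 k) h
        simp only [map_mul, at3_Bo, at3_T] at h'
        refine ⟨at2 k a, Spatial.of_gen (.last k ha), at2 (k + 1) b * wk (at2 k c * wk S),
          ⟨b, _, hb, ⟨c, S, hc, hS, rfl⟩, rfl⟩, ?_⟩
        calc _ = at2 (k + 1) u * wk (at2 k u') * (wk (wk S) * at2 (k + 1) v) := by
              rw [map_mul]; simp only [mul_assoc]
          _ = wk (at2 k a) * at2 (k + 1) b * wk (at2 k c) * wk (wk S) := by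
              rw [← (at2_comm v S).eq, ← mul_assoc, h']
          _ = _ := by rw [map_mul]; simp only [mul_assoc]
    · obtain ⟨h, hh, S', hS', e⟩ := ih hS hg'
      refine ⟨wk h, Spatial.wk hh, at2 k u * wk S', ⟨u, S', hu, hS', rfl⟩, ?_⟩
      rw [mul_assoc, ← map_mul, e, map_mul, ← mul_assoc, (at2_comm u h).eq, mul_assoc]

theorem Spatial.exists_stair {N : ℕ} {w : Hom (N + 1) (N + 1)} (hw : w ∈ Spatial (N + 1)) :
    ∃ h ∈ Spatial N, ∃ S, Stair (N + 1) S ∧ w = Hom.wk h * S := by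
  induction hw using Submonoid.closure_induction_right with
  | one => exact ⟨1, one_mem _, 1, Stair.one _, by rw [map_one, mul_one]⟩
  | mul_right w _ g hg ih =>
    obtain ⟨h, hh, S, hS, rfl⟩ := ih
    obtain ⟨h', hh', S', hS', e⟩ := hS.mul_gen hg
    exact ⟨h * h', mul_mem hh hh', S', hS', by rw [mul_assoc, e, map_mul, mul_assoc]⟩

/-! ### Reading the first step of a staircase off the semantics. -/

theorem sem_ph (φ : ℝ) (x : State 1) (b : Modes 1) :
    sem (ph φ) x b = Complex.exp (Complex.I * φ) * x b := interp_phase_apply φ x b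

theorem sem_bsp (θ : ℝ) (x : State 2) (c : Pol) (p : Fin 2) : sem (bsp θ) x (c, p) =
    Complex.cos θ * x (c, p) + Complex.I * Complex.sin θ * x (c, 1 - p) :=
  interp_bs_apply θ x c p

theorem sem_p0_zero (a : ℝ) (x : State 2) (c : Pol) :
    sem (p0 a) x (c, 0) = Complex.exp (Complex.I * a) * x (c, 0) :=
  (interp_tensor_zero x c).trans (interp_phase_apply a _ _)

theorem sem_p0_one (a : ℝ) (x : State 2) (c : Pol) : sem (p0 a) x (c, 1) = x (c, 1) :=
  interp_tensor_one (D := phase a) (D' := wire) x c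

theorem sem_p1_zero (a : ℝ) (x : State 2) (c : Pol) : sem (p1 a) x (c, 0) = x (c, 0) :=
  interp_tensor_zero (D := wire) (D' := phase a) x c

theorem sem_p1_one (a : ℝ) (x : State 2) (c : Pol) :
    sem (p1 a) x (c, 1) = Complex.exp (Complex.I * a) * x (c, 1) :=
  (interp_tensor_one x c).trans (interp_phase_apply a _ _)

/-- The amplitude is a phase times cos θ, so being 1 forces sin θ = 0. The beam splitter is then a
pair of phases, and the total phase on the bottom wire is trivial. -/
theorem NF2.eq_p0 {u : Hom 2 2} (hu : NF2 u) (h : sem u (ket (Pol.V, 1)) (Pol.V, 1) = 1) :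
    ∃ x, u = p0 x := by
  obtain ⟨a, b, θ, c, d, rfl⟩ := hu
  simp only [sem_mul, sem_p0_one, sem_p1_one, sem_bsp, sem_p1_zero, sem_p0_zero, ket_apply,
    sub_self] at h
  simp at h
  have hs : Real.sin θ = 0 := by
    have h1 := congrArg (fun z : ℂ => ‖z‖) h
    simp only [norm_mul, mul_comm Complex.I, Complex.norm_exp_ofReal_mul_I, one_mul, mul_one,
      norm_one, ← Complex.ofReal_cos, Complex.norm_real, Real.norm_eq_abs] at h1
    have h2 := Real.sin_sq_add_cos_sq θ
    rw [← sq_abs (Real.cos θ), h1] at h2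
    nlinarith
  have hp : p1 (b + θ + d) = 1 := by
    rw [p1, ph_congr (ψ := 0) (φ := b + θ + d), ← p1, p1_zero]
    have hs' : Complex.sin θ = 0 := by rw [← Complex.ofReal_sin, hs]; simp
    have he : Complex.exp (Complex.I * θ) = Complex.cos θ := by
      rw [mul_comm, Complex.exp_mul_I, hs']; simp
    push_cast
    rw [mul_add, mul_add, Complex.exp_add, Complex.exp_add, he]
    simp only [mul_zero, Complex.exp_zero]
    linear_combination h
  refine ⟨a + θ + c, ?_⟩
  rw [bsp_of_sin_eq_zero hs, ph_tensor_ph]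
  calc p0 a * p1 b * (p0 θ * p1 θ) * (p0 c * p1 d)
      = p0 a * (p1 b * p0 θ) * (p1 θ * p0 c) * p1 d := by simp only [mul_assoc]
    _ = p0 a * p0 θ * (p1 b * p0 c) * p1 θ * p1 d := by
        rw [← (p0_p1_comm θ b).eq, ← (p0_p1_comm c θ).eq]; simp only [mul_assoc]
    _ = p0 (a + θ + c) * p1 (b + θ + d) := by
        rw [← (p0_p1_comm c b).eq, ← p0_mul, ← p0_mul, ← p1_mul, ← p1_mul]
        simp only [mul_assoc]
    _ = p0 (a + θ + c) := by rw [hp, mul_one]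

theorem sem_wk_castAdd {N : ℕ} {f : Hom N N}
    (h : ∀ i, sem (wk f) (ket (Pol.V, i)) = ket (Pol.V, i)) (i : Fin N) :
    sem f (ket (Pol.V, i)) = ket (Pol.V, i) := by
  have e := congrArg (topL N 1) (h (Fin.castAdd 1 i))
  rwa [topL_ket_castAdd, show topL N 1 (sem (wk f) _) = _ from topL_sem_tensor f (id 1) _,
    topL_ket_castAdd] at e

/-- Circuits made of phase shifters and beam splitters are determined by their semantics. -/
theorem Spatial.eq_one_of_sem {N : ℕ} {w : Hom N N} (hw : w ∈ Spatial N)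
    (h : ∀ i, sem w (ket (Pol.V, i)) = ket (Pol.V, i)) : w = 1 := by
  induction N with
  | zero => exact Spatial.eq_one hw
  | succ N ih =>
    obtain ⟨f, hf, S, hS, rfl⟩ := Spatial.exists_stair hw
    cases N with
    | zero =>
      obtain ⟨φ, rfl⟩ := hS
      rw [Spatial.eq_one hf, map_one, one_mul] at h ⊢
      have e := congrFun (h 0) (Pol.V, 0)
      rw [sem_ph, ket_apply, if_pos rfl, mul_one] at e
      rw [ph_congr (ψ := 0) (by simpa using e), ph_zero]
    | succ k =>
      obtain ⟨u, S, hu, hS, rfl⟩ := hS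
      -- A photon entering on the last wire does not see `f`, so its amplitude to stay there is
      -- produced by `u` alone.
      have hfix : sem (Hom.wk f) (ket (Pol.V, Fin.natAdd (k + 1) (0 : Fin 1))) =
          ket (Pol.V, Fin.natAdd (k + 1) (0 : Fin 1)) := by
        refine state_ext ?_ ?_
        · rw [show topL (k + 1) 1 (sem (Hom.wk f) _) = _ from topL_sem_tensor f (id 1) _,
            topL_ket_natAdd, map_zero]
        · rw [show botL (k + 1) 1 (sem (Hom.wk f) _) = _ from botL_sem_tensor f (id 1) _, sem_id]
      have e := h (Fin.natAdd (k + 1) (0 : Fin 1))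
      rw [sem_mul, hfix, sem_mul] at e
      have e' := congrFun (congrArg (botL (k + 1) 1) e) (Pol.V, 0)
      rw [show botL (k + 1) 1 (sem (Hom.wk S) _) = _ from botL_sem_tensor S (id 1) _, sem_id,
        botL_ket_natAdd] at e'
      have hu1 : sem u (ket (Pol.V, 1)) (Pol.V, 1) = 1 := by
        have h1 := botL_sem_tensor (id k) u (ket (Pol.V, Fin.natAdd k (1 : Fin 2)))
        rw [botL_ket_natAdd] at h1
        rw [← h1]
        refine Eq.trans ?_ (e'.trans ?_)
        · rfl
        · simp [ket_apply]
      obtain ⟨x, rfl⟩ := hu.eq_p0 hu1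
      -- The remaining phase sits on the last but one wire, so the whole circuit leaves the last
      -- wire bare.
      have hw' : Hom.wk f * (at2 k (p0 x) * Hom.wk S) =
          Hom.wk (f * ((id k ⊗ₗ ph x) * S)) := by
        rw [map_mul, map_mul, at2_p0]
      rw [hw'] at h ⊢
      rw [ih (mul_mem hf (mul_mem (Spatial.last_phase k x) hS.mem)) (sem_wk_castAdd h), map_one]

theorem NF2.exists_inv {u : Hom 2 2} (hu : NF2 u) : ∃ v, NF2 v ∧ u * v = 1 ∧ v * u = 1 := by
  obtain ⟨a, b, θ, c, d, rfl⟩ := hu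
  have h0 (x y : ℝ) : p0 x * p1 y * (p0 (-x) * p1 (-y)) = 1 := by
    rw [(p0_p1_comm x y).eq, mul_assoc, ← mul_assoc (p0 x), p0_mul, add_neg_cancel, p0_zero, one_mul,
      p1_mul, add_neg_cancel, p1_zero]
  have h0' (x y : ℝ) : p0 (-x) * p1 (-y) * (p0 x * p1 y) = 1 := by
    simpa only [neg_neg] using h0 (-x) (-y)
  have h1 (t : ℝ) : bsp t * bsp (-t) = 1 := by rw [bsp_mul, add_neg_cancel, bsp_zero]
  have h1' (t : ℝ) : bsp (-t) * bsp t = 1 := by rw [bsp_mul, neg_add_cancel, bsp_zero]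
  refine ⟨p0 (-c) * p1 (-d) * bsp (-θ) * (p0 (-a) * p1 (-b)), ⟨_, _, _, _, _, rfl⟩, ?_, ?_⟩
  · calc _ = p0 a * p1 b * (bsp θ * (p0 c * p1 d * (p0 (-c) * p1 (-d))) * bsp (-θ)) *
          (p0 (-a) * p1 (-b)) := by simp only [mul_assoc]
      _ = 1 := by rw [h0, mul_one, h1, mul_one, h0]
  · calc _ = p0 (-c) * p1 (-d) * (bsp (-θ) * (p0 (-a) * p1 (-b) * (p0 a * p1 b)) * bsp θ) *
          (p0 c * p1 d) := by simp only [mul_assoc]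
      _ = 1 := by rw [h0', mul_one, h1', mul_one, h0']

theorem SGen.exists_inv {N : ℕ} {g : Hom N N} (hg : SGen N g) :
    ∃ g', SGen N g' ∧ g * g' = 1 ∧ g' * g = 1 := by
  induction hg with
  | phase φ => exact ⟨_, .phase (-φ), by rw [ph_mul, add_neg_cancel, ph_zero],
      by rw [ph_mul, neg_add_cancel, ph_zero]⟩
  | last k hu =>
    obtain ⟨v, hv, h, h'⟩ := hu.exists_inv
    exact ⟨_, .last k hv, by rw [← map_mul, h, map_one], by rw [← map_mul, h', map_one]⟩
  | wk _ ih =>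
    obtain ⟨g', hg', h, h'⟩ := ih
    exact ⟨_, hg'.wk, by rw [← map_mul, h, map_one], by rw [← map_mul, h', map_one]⟩

theorem Spatial.exists_inv {N : ℕ} {f : Hom N N} (hf : f ∈ Spatial N) :
    ∃ f' ∈ Spatial N, f * f' = 1 ∧ f' * f = 1 := by
  induction hf using Submonoid.closure_induction with
  | mem g hg =>
    obtain ⟨g', hg', h⟩ := SGen.exists_inv hg
    exact ⟨g', Spatial.of_gen hg', h⟩
  | one => exact ⟨1, one_mem _, mul_one _, mul_one _⟩
  | mul f g _ _ ihf ihg =>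
    obtain ⟨f', hf', h1, h2⟩ := ihf
    obtain ⟨g', hg', h3, h4⟩ := ihg
    refine ⟨g' * f', mul_mem hg' hf', ?_, ?_⟩
    · rw [mul_assoc, ← mul_assoc g, h3, one_mul, h1]
    · rw [mul_assoc, ← mul_assoc f', h2, one_mul, h4]

theorem Spatial.ext {N : ℕ} {f g : Hom N N} (hf : f ∈ Spatial N) (hg : g ∈ Spatial N)
    (h : ∀ i, sem f (ket (Pol.V, i)) = sem g (ket (Pol.V, i))) : f = g := by
  obtain ⟨g', hg', h1, h2⟩ := Spatial.exists_inv hg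
  have e : f * g' = 1 := Spatial.eq_one_of_sem (mul_mem hf hg') fun i => by
    rw [sem_mul, h, ← sem_mul, h1, one_def, sem_id]
  calc f = f * (g' * g) := by rw [h2, mul_one]
    _ = g := by rw [← mul_assoc, e, one_mul]

end Hom

namespace Hom

/-! ### Transport and symmetries -/

/-- Transport along equalities of the numbers of wires. -/
def castH {n m n' m' : ℕ} (hn : n = n') (hm : m = m') (f : Hom n m) : Hom n' m' := hn ▸ hm ▸ f

theorem mk_castWires {n m n' m' : ℕ} (hn : n = n') (hm : m = m') (D : Circuit n m) :
    mk (castWires hn hm D) = castH hn hm (mk D) := by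
  subst hn hm
  rfl

theorem castH_comp {a b c a' b' c' : ℕ} (ha : a = a') (hb : b = b') (hc : c = c') (f : Hom a b)
    (g : Hom b c) : castH ha hc (f ≫ₗ g) = castH ha hb f ≫ₗ castH hb hc g := by
  subst ha hb hc
  rfl

theorem castH_id {n n' : ℕ} (h : n = n') : castH h h (id n) = id n' := by
  subst h
  rfl

theorem castH_heq {n m n' m' : ℕ} (hn : n = n') (hm : m = m') (f : Hom n m) :
    HEq (castH hn hm f) f := by
  subst hn hm
  rfl

theorem sym_add_right (a b c : ℕ) : sym a (b + c) =
    castH (Nat.add_assoc a b c) (Nat.add_assoc b a c) (sym a b ⊗ₗ id c) ≫ₗ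
      castH rfl (Nat.add_assoc b c a).symm (id b ⊗ₗ sym a c) := by
  have h : sym a (b + c) = _ := mk_eq_mk.2 (.hexagon a b c)
  rw [h, mk_comp, mk_castWires, mk_castWires]
  rfl

theorem eq_of_comp_eq_id {n m : ℕ} {f : Hom n m} {g g' : Hom m n} (h : f ≫ₗ g = id n)
    (h' : g' ≫ₗ f = id m) : g = g' := by
  rw [← id_comp g, ← h', comp_assoc, h, comp_id]

/-- Both sides are inverse to the symmetry in the other direction, decomposed by the hexagon. -/
theorem sym_add_left (a b c : ℕ) : sym (b + c) a =
    castH (Nat.add_assoc b c a).symm rfl (id b ⊗ₗ sym c a) ≫ₗ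
      castH (Nat.add_assoc b a c) (Nat.add_assoc a b c) (sym b a ⊗ₗ id c) := by
  refine eq_of_comp_eq_id (sym_sym a (b + c)) ?_
  rw [sym_add_right, comp_assoc, ← comp_assoc (castH _ _ (sym b a ⊗ₗ id c)), ← castH_comp,
    ← comp_tensor_comp, sym_sym, id_comp, id_tensor_id, castH_id, id_comp, ← castH_comp,
    ← comp_tensor_comp, sym_sym, id_comp, id_tensor_id, castH_id]

/-- The hexagon with two empty arguments makes this symmetry idempotent; being invertible, it is the
identity. -/
theorem sym_zero_right (a : ℕ) : HEq (sym a 0) (id a) := by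
  set X : Hom a a := castH rfl (Nat.zero_add a) (sym a 0) with hX
  set Y : Hom a a := castH (Nat.zero_add a) rfl (sym 0 a) with hY
  have hYX : Y * X = 1 := by
    rw [mul_def, hX, hY, ← castH_comp, sym_sym, castH_id, one_def]
  have h := sym_add_right a 0 0
  rw [tensor_id_zero] at h
  have hXX : X = X * X := by
    have h2 : HEq (castH rfl (Nat.add_assoc 0 0 a).symm (id 0 ⊗ₗ sym a 0)) (sym a 0) :=
      (castH_heq _ _ _).trans (id_zero_tensor _)
    have h3 : castH (Nat.zero_add a) (Nat.zero_add a)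
        (castH rfl (Nat.add_assoc 0 0 a).symm (id 0 ⊗ₗ sym a 0) : Hom (0 + a) (0 + a)) = X :=
      eq_of_heq ((castH_heq _ _ _).trans (h2.trans (castH_heq _ _ _).symm))
    have h4 := congrArg (castH rfl (Nat.zero_add a)) h
    rw [castH_comp rfl (Nat.zero_add a) (Nat.zero_add a)] at h4
    exact h4.trans (congrArg (X * ·) h3)
  have hX1 : X = 1 := by
    rw [← one_mul X, ← hYX, mul_assoc, ← hXX]
  exact (castH_heq rfl (Nat.zero_add a) (sym a 0)).symm.trans (heq_of_eq hX1)

theorem sym_zero_left (a : ℕ) : HEq (sym 0 a) (id a) := by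
  have h := sym_sym 0 a
  set X : Hom a a := castH rfl (Nat.zero_add a) (sym a 0) with hX
  have hX1 : X = id a := eq_of_heq ((castH_heq _ _ _).trans (sym_zero_right a))
  have h2 := castH_comp (Nat.zero_add a) rfl (Nat.zero_add a) (sym 0 a) (sym a 0)
  rw [h, castH_id, ← hX, hX1] at h2
  exact (castH_heq (Nat.zero_add a) rfl (sym 0 a)).symm.trans
    (heq_of_eq ((comp_id (m := a) _).symm.trans h2.symm))

theorem src_tensor_id : (src ⊗ₗ id 1 : Hom 1 2) = (id 1 ⊗ₗ src : Hom 1 2) ≫ₗ sw := by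
  have h := sym_natural (id 1) src
  rw [show (sym 1 0) = (id 1 : Hom 1 1) from eq_of_heq (sym_zero_right 1)] at h
  exact (h.trans (id_comp (n := 1) (m := 2) _)).symm

theorem src_src_comp_sw : (src ⊗ₗ src) ≫ₗ sw = src ⊗ₗ src := by
  have h := sym_natural src src
  rw [show (sym 0 0) = (id 0 : Hom 0 0) from eq_of_heq (sym_zero_right 0)] at h
  exact h.trans (id_comp (n := 0) (m := 2) _)

theorem sym_two_one : (sym 2 1 : Hom 3 3) = Bo sw * T sw := by
  have h' : sym 1 2 = T sw * Bo sw := mk_eq_mk.2 (.hexagon 1 1 1)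
  have h : sym 1 2 * sym 2 1 = (1 : Hom 3 3) := sym_sym 1 2
  rw [h'] at h
  have e : Bo sw * T sw * (T sw * Bo sw) = 1 := by
    rw [mul_assoc, ← mul_assoc (T sw), T_sw_mul_T_sw, one_mul, Bo_sw_mul_Bo_sw]
  exact (left_inv_eq_right_inv e h).symm

theorem sym_two_two : (sym 2 2 : Hom 4 4) = wk (Bo sw * T sw) * at3 1 (Bo sw * T sw) := by
  rw [← sym_two_one]
  exact sym_add_right 2 1 1

/-! ### The polarising beam splitter on split wires -/

theorem sw_pb_sw : sw * pb * sw = pb := by rw [sw_mul_pb, mul_assoc, sw_mul_sw, mul_one]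

theorem T_pb_Bo_pb_T_pb : T pb * Bo pb * T pb = T sw * Bo pb * T sw := mk_eq_mk.2 .pbs_pbs_pbs

theorem Bo_sw_T_pb_Bo_sw : Bo sw * T pb * Bo sw = T pb * Bo pb * T pb := by
  have h : Bo sw * T pb = T sw * Bo pb * T sw * Bo sw := by
    calc Bo sw * T pb = T sw * (T sw * Bo sw * T pb) := by
          simp only [← mul_assoc, T_sw_mul_T_sw, one_mul]
      _ = T sw * Bo pb * T sw * Bo sw := by rw [← Bo_mul]; simp only [mul_assoc]
  rw [h, mul_assoc, Bo_sw_mul_Bo_sw, mul_one, T_pb_Bo_pb_T_pb]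

/-- The axiom expresses one side of the braid relation through swaps; reversing the wires gives the
other side, and the swap expressions agree. -/
theorem Bo_pb_T_pb_Bo_pb : Bo pb * T pb * Bo pb = T pb * Bo pb * T pb := by
  have h1 := T_Bo_T_mul_flip pb pb pb
  have h2 := T_Bo_T_mul_flip sw pb sw
  rw [T_pb_Bo_pb_T_pb, h2] at h1
  have h3 := congrArg (flip * ·) h1
  simp only [← mul_assoc, flip_mul_flip, one_mul, sw_pb_sw, sw_mul_sw] at h3
  rw [← h3, Bo_sw_T_pb_Bo_sw]

/-- The computation in the symmetric group behind the action of the polarising beam splitter on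
split wires. -/
theorem relations_four {M : Type*} [Monoid M] {a b c q r : M} (ha : a * a = 1) (hb : b * b = 1)
    (hc : c * c = 1) (hq : q * q = 1) (hr : r * r = 1) (hac : a * c = c * a) (har : a * r = r * a)
    (hab : b * a * b = a * b * a) (hbc : c * b * c = b * c * b) (hqa : q * a * q = a * b * a)
    (hqb : q * b * q = b) (hqc : q * c * q = b * c * b) (hrb : r * b * r = b * c * b)
    (hrc : r * c * r = c) :
    q * a * q * a * c = q * c * q * (q * r * q * (a * c * (q * r * q))) := by
  have hqc' : q * (b * c * b) * q = c := by
    rw [← hqc]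
    calc q * (q * c * q) * q = q * q * c * (q * q) := by simp only [mul_assoc]
      _ = c := by rw [hq, one_mul, mul_one]
  -- The word `q * r * q` will be the interleaving `inter`; `h1` and `h2` conjugate `a` and `c` by
  -- it, and `hP` says that it is an involution.
  have h1 : q * r * q * a * (q * r * q) = a * b * c * b * a := by
    calc q * r * q * a * (q * r * q) = q * r * (q * a * q) * r * q := by simp only [mul_assoc]
      _ = q * (r * a) * b * (a * r) * q := by rw [hqa]; simp only [mul_assoc]
      _ = q * a * (r * b * r) * a * q :=
        (congrArg₂ (fun x y => q * x * b * y * q) har.symm har).trans (by simp only [mul_assoc])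
      _ = q * a * (q * q) * (b * c * b) * (q * q) * a * q := by rw [hrb, hq, mul_one, mul_one]
      _ = q * a * q * (q * (b * c * b) * q) * (q * a * q) := by simp only [mul_assoc]
      _ = a * b * (a * c) * a * b * a := by rw [hqc', hqa]; simp only [mul_assoc]
      _ = a * b * c * (a * a) * b * a := by rw [hac]; simp only [mul_assoc]
      _ = a * b * c * b * a := by rw [ha, mul_one]
  have h2 : q * r * q * c * (q * r * q) = b := by
    calc q * r * q * c * (q * r * q) = q * r * (q * c * q) * r * q := by simp only [mul_assoc]
      _ = q * (r * b * r) * (r * c * r) * (r * b * r) * q := by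
        rw [hqc]
        calc _ = q * r * b * 1 * c * 1 * b * r * q := by simp only [mul_one, mul_assoc]
          _ = _ := by rw [← hr]; simp only [mul_assoc]
      _ = q * (b * (c * b * c) * b * c * b) * q := by rw [hrb, hrc]; simp only [mul_assoc]
      _ = q * (b * b * c * (b * b) * c * b) * q := by rw [hbc]; simp only [mul_assoc]
      _ = b := by rw [hb, one_mul, mul_one, hc, one_mul, hqb]
  have hP : q * r * q * (q * r * q) = 1 := by
    calc q * r * q * (q * r * q) = q * (r * (q * q) * r) * q := by simp only [mul_assoc]
      _ = 1 := by rw [hq, mul_one, hr, mul_one, hq]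
  have h3 : q * r * q * (a * c * (q * r * q)) = a * b * c * b * a * b := by
    calc q * r * q * (a * c * (q * r * q)) = q * r * q * a * 1 * c * (q * r * q) := by
          simp only [mul_one, mul_assoc]
      _ = q * r * q * a * (q * r * q) * (q * r * q * c * (q * r * q)) := by
          rw [← hP]; simp only [mul_assoc]
      _ = _ := by rw [h1, h2]
  have e1 : b * a * b * a = a * b := by
    rw [hab, mul_assoc, ha, mul_one]
  calc q * a * q * a * c = a * b * c := by rw [hqa, mul_assoc (a * b), ha, mul_one]
    _ = b * a * b * (a * c) := by rw [← mul_assoc, e1]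
    _ = b * a * (b * c * b) * b * a := by
      rw [hac]
      calc _ = b * a * (b * c) * 1 * a := by simp only [mul_one, mul_assoc]
        _ = _ := by rw [← hb]; simp only [mul_assoc]
    _ = b * (a * c) * b * c * b * a := by rw [← hbc]; simp only [mul_assoc]
    _ = b * c * (a * b) * c * b * a := by rw [hac]; simp only [mul_assoc]
    _ = b * c * b * a * b * (a * c) * b * a := by rw [← e1]; simp only [mul_assoc]
    _ = b * c * b * a * b * c * (a * b * a) := by rw [hac]; simp only [mul_assoc]
    _ = b * c * b * (a * b * c * b * a * b) := by rw [← hab]; simp only [mul_assoc]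
    _ = _ := by rw [h3, hqc]

/-! ### Split pairs of wires -/

/-- Two wires with a vacuum below each of them. -/
def srcPair : Hom 2 4 := (id 1 ⊗ₗ src : Hom 1 2) ⊗ₗ (id 1 ⊗ₗ src : Hom 1 2)

theorem at3_one_T (u : Hom 2 2) : at3 1 (T u) = wk (Bo u) := 
  (eq_of_heq (tensor_assoc (id 1) u (id 1))).symm

theorem tensor_tensor_eq (u v : Hom 2 2) :
    u ⊗ₗ v = wk (T u) * at3 1 (Bo v) := by
  rw [tensor_eq_mul, at3_Bo]
  exact congrArg (· * _) (wk_wk u).symm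

theorem wk_T_comm (u v : Hom 2 2) : wk (T u) * at3 1 (Bo v) = at3 1 (Bo v) * wk (T u) := by
  rw [at3_Bo]
  exact (at2_comm v u).eq.symm

/-- Gathering the two vacua at the bottom lets them absorb a polarising beam splitter or a swap. -/
theorem srcPair_eq : srcPair = (id 2 ⊗ₗ (src ⊗ₗ src) : Hom 2 4) ≫ₗ at3 1 (T sw) := by
  have h : (src ⊗ₗ id 1 ⊗ₗ src : Hom 1 3) = (id 1 ⊗ₗ (src ⊗ₗ src) : Hom 1 3) ≫ₗ T sw := by
    have h1 := comp_tensor_comp (id 1 ⊗ₗ src : Hom 1 2) sw src (id 1)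
    rw [← src_tensor_id, comp_id] at h1
    rw [h1]
    exact congrArg (· ≫ₗ T sw) (eq_of_heq (tensor_assoc (id 1) src src))
  have h2 : srcPair = (id 1 ⊗ₗ (src ⊗ₗ id 1 ⊗ₗ src : Hom 1 3) : Hom 2 4) := by
    rw [show (src ⊗ₗ id 1 ⊗ₗ src : Hom 1 3) = (src ⊗ₗ (id 1 ⊗ₗ src : Hom 1 2) : Hom 1 3) from
      eq_of_heq (tensor_assoc src (id 1) src)]
    exact eq_of_heq (tensor_assoc (id 1) src (id 1 ⊗ₗ src : Hom 1 2))
  have h3 := comp_tensor_comp (id 1) (id 1) (id 1 ⊗ₗ (src ⊗ₗ src) : Hom 1 3) (T sw)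
  rw [← h, id_comp] at h3
  rw [h2, h3]
  refine congrArg (· ≫ₗ at3 1 (T sw)) ?_
  rw [← id_tensor_id 1 1]
  exact (eq_of_heq (tensor_assoc (id 1) (id 1) (src ⊗ₗ src))).symm

theorem srcPair_comp_at3 {u : Hom 2 2} (hu : (src ⊗ₗ src) ≫ₗ u = src ⊗ₗ src) :
    (id 2 ⊗ₗ (src ⊗ₗ src) : Hom 2 4) ≫ₗ at3 1 (Bo u) = id 2 ⊗ₗ (src ⊗ₗ src) := by
  rw [at3_Bo]
  have h := comp_tensor_comp (id 2) (id 2) (src ⊗ₗ src : Hom 0 2) u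
  rw [hu, id_comp] at h
  exact h.symm

theorem comp_srcs (u : Hom 2 2) :
    u ≫ₗ (id 2 ⊗ₗ (src ⊗ₗ src) : Hom 2 4) = (id 2 ⊗ₗ (src ⊗ₗ src) : Hom 2 4) ≫ₗ wk (T u) := by
  have h1 := comp_tensor_comp u (id 2) (id 0) (src ⊗ₗ src : Hom 0 2)
  have h2 := comp_tensor_comp (id 2) u (src ⊗ₗ src : Hom 0 2) (id 2)
  rw [comp_id, id_comp, tensor_id_zero] at h1
  rw [comp_id, id_comp] at h2
  rw [show wk (T u) = (u ⊗ₗ id 2 : Hom 4 4) from wk_wk u]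
  exact h1.symm.trans h2

/-- The interleaving of two pairs of wires. -/
def inter : Hom 4 4 := at3 1 flip

theorem split_tensor_split : (split ⊗ₗ split : Hom 2 4) =
    srcPair ≫ₗ (pb ⊗ₗ pb) ≫ₗ ((id 1 ⊗ₗ ng) ⊗ₗ (id 1 ⊗ₗ ng)) := by
  rw [split, comp_tensor_comp, comp_tensor_comp]
  rfl

theorem negs_eq : ((id 1 ⊗ₗ ng) ⊗ₗ (id 1 ⊗ₗ ng) : Hom 4 4) =
    at3 1 (T (ng ⊗ₗ id 1) * Bo (id 1 ⊗ₗ ng)) := by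
  rw [tensor_tensor_eq, map_mul, at3_one_T]
  refine congrArg (fun x => wk x * _) ?_
  exact eq_of_heq (tensor_assoc (id 1) ng (id 1))

theorem inter_mul_negs : inter * ((id 1 ⊗ₗ ng) ⊗ₗ (id 1 ⊗ₗ ng)) =
    ((id 1 ⊗ₗ ng) ⊗ₗ (id 1 ⊗ₗ ng)) * inter := by
  have e1 : sw * (id 1 ⊗ₗ ng) * sw = ng ⊗ₗ id 1 := by
    rw [mul_assoc, id_tensor_ng_mul_sw, ← mul_assoc, sw_mul_sw, one_mul]
  have e2 : sw * (ng ⊗ₗ id 1) * sw = id 1 ⊗ₗ ng := by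
    rw [mul_assoc, ng_tensor_id_mul_sw, ← mul_assoc, sw_mul_sw, one_mul]
  have e3 : T (ng ⊗ₗ id 1) = (ng ⊗ₗ id 2 : Hom 3 3) := by
    rw [← id_tensor_id 1 1]
    exact eq_of_heq (tensor_assoc ng (id 1) (id 1))
  have e4 : T (ng ⊗ₗ id 1) * Bo (id 1 ⊗ₗ ng) = Bo (id 1 ⊗ₗ ng) * T (ng ⊗ₗ id 1) := by
    rw [e3]
    exact (tensor_commute ng (id 1 ⊗ₗ ng)).eq
  rw [negs_eq, inter, ← map_mul, ← map_mul, mul_assoc _ _ flip, Bo_mul_flip, e1, ← mul_assoc (T _) flip,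
    T_mul_flip, e2, e4, mul_assoc]

/-- Semantically, a polarising beam splitter exchanges the horizontal parts, which after splitting
occupy wires 1 and 3. The bare circuits of the two sides differ; they agree only because the factors
`c` and `r` exposed by `relations_four` act on the two vacua and are absorbed. -/
theorem pb_comp_split_tensor_split :
    pb ≫ₗ (split ⊗ₗ split : Hom 2 4) = (split ⊗ₗ split : Hom 2 4) ≫ₗ inter := by
  set a : Hom 4 4 := wk (T pb) with ha
  set b : Hom 4 4 := at3 1 (T pb) with hb
  set c : Hom 4 4 := at3 1 (Bo pb) with hc
  set q : Hom 4 4 := at3 1 (T sw) with hq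
  set r : Hom 4 4 := at3 1 (Bo sw) with hr
  have hb' : b = wk (Bo pb) := at3_one_T pb
  have hq' : q = wk (Bo sw) := at3_one_T sw
  have hT : T pb * T pb = 1 := by rw [← map_mul, pb_mul_pb, map_one]
  have hB : Bo pb * Bo pb = 1 := by rw [← map_mul, pb_mul_pb, map_one]
  have hqc : q * c * q = b * c * b := by
    rw [hq, hb, hc, ← map_mul, ← map_mul, ← map_mul, ← map_mul, T_pb_Bo_pb_T_pb]
  have hrb : r * b * r = b * c * b := by
    rw [hr, hb, hc, ← map_mul, ← map_mul, ← map_mul, ← map_mul, Bo_sw_T_pb_Bo_sw]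
  have hqq : q * q = 1 := by rw [hq, ← map_mul, T_sw_mul_T_sw, map_one]
  have hrel := relations_four (a := a) (b := b) (c := c) (q := q) (r := r)
    (by rw [ha, ← map_mul, hT, map_one]) (by rw [hb, ← map_mul, hT, map_one])
    (by rw [hc, ← map_mul, hB, map_one]) hqq
    (by rw [hr, ← map_mul, Bo_sw_mul_Bo_sw, map_one]) (wk_T_comm pb pb) (wk_T_comm pb sw)
    (by rw [ha, hb', ← map_mul, ← map_mul, ← map_mul, ← map_mul, Bo_pb_T_pb_Bo_pb])
    (by rw [hc, hb, ← map_mul, ← map_mul, ← map_mul, ← map_mul, Bo_pb_T_pb_Bo_pb])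
    (by rw [ha, hb', hq', ← map_mul, ← map_mul, ← map_mul, ← map_mul, Bo_sw_T_pb_Bo_sw])
    (by rw [hb, hq, ← map_mul, ← map_mul, ← map_mul, ← map_mul, sw_pb_sw]) hqc hrb
    (by rw [hc, hr, ← map_mul, ← map_mul, ← map_mul, ← map_mul, sw_pb_sw])
  have hI : q * r * q = inter := by rw [hq, hr, ← map_mul, ← map_mul]; rfl
  rw [hI] at hrel
  set e : Hom 2 4 := id 2 ⊗ₗ (src ⊗ₗ src) with he
  have hec : e ≫ₗ c = e := srcPair_comp_at3 src_src_comp_pb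
  have her : e ≫ₗ r = e := srcPair_comp_at3 src_src_comp_sw
  have hss : srcPair = e ≫ₗ q := srcPair_eq
  have hp : (pb ⊗ₗ pb : Hom 4 4) = a * c := tensor_tensor_eq pb pb
  set nn : Hom 4 4 := (id 1 ⊗ₗ ng) ⊗ₗ (id 1 ⊗ₗ ng) with hnn
  have hn : inter * nn = nn * inter := inter_mul_negs
  have hpe : pb ≫ₗ e = e ≫ₗ a := comp_srcs pb
  have h1 : a * q * a * c = c * (r * (q * a * c * inter)) := by
    calc a * q * a * c = q * (q * a * q * a * c) := by simp only [← mul_assoc, hqq, one_mul]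
      _ = q * q * c * q * inter * a * c * inter := by rw [hrel]; simp only [mul_assoc]
      _ = q * q * c * (q * q) * r * q * a * c * inter := by
        rw [← hI]; simp only [mul_assoc]
      _ = _ := by rw [hqq, one_mul, mul_one]; simp only [mul_assoc]
  calc pb ≫ₗ (split ⊗ₗ split : Hom 2 4) = pb ≫ₗ e ≫ₗ (q * (a * c) * nn) := by
        rw [split_tensor_split, hp, hss]
        simp only [mul_def, comp_assoc]
        rfl
    _ = e ≫ₗ (a * q * a * c) ≫ₗ nn := by
        rw [hpe]
        simp only [mul_def, comp_assoc]
    _ = e ≫ₗ c ≫ₗ r ≫ₗ (q * a * c) ≫ₗ (inter * nn) := by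
        rw [h1]
        simp only [mul_def, comp_assoc]
    _ = (split ⊗ₗ split : Hom 2 4) ≫ₗ inter := by
        rw [hec, her, hn, split_tensor_split, hp, hss]
        simp only [mul_def, comp_assoc]
        rfl

theorem sw_comp_split_tensor_split :
    sw ≫ₗ (split ⊗ₗ split : Hom 2 4) = (split ⊗ₗ split : Hom 2 4) ≫ₗ sym 2 2 :=
  (sym_natural split split).symm

end Hom

namespace Hom

/-! ### Closure properties of the circuits without polarisation -/

theorem id_tensor_wk (a : ℕ) {N : ℕ} (g : Hom N N) :
    (id a ⊗ₗ wk g : Hom (a + (N + 1)) (a + (N + 1))) = wk (id a ⊗ₗ g) :=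
  (eq_of_heq (tensor_assoc (id a) g (id 1))).symm

theorem id_tensor_at2 (a k : ℕ) (u : Hom 2 2) :
    (id a ⊗ₗ at2 k u : Hom (a + (k + 2)) (a + (k + 2))) = at2 (a + k) u := by
  have h : at2 (a + k) u = (id a ⊗ₗ id k : Hom (a + k) (a + k)) ⊗ₗ u := by
    rw [id_tensor_id]
    rfl
  rw [h]
  exact (eq_of_heq (tensor_assoc (id a) (id k) u)).symm

/-- Adding wires at the top. -/
def pre (a : ℕ) {N : ℕ} : Hom N N →* Hom (a + N) (a + N) where
  toFun f := id a ⊗ₗ f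
  map_one' := id_tensor_id a N
  map_mul' f g := id_tensor_mul f g a

theorem Spatial.pre (a : ℕ) {N : ℕ} {f : Hom N N} (hf : f ∈ Spatial N) :
    id a ⊗ₗ f ∈ Spatial (a + N) := by
  have h : Spatial N ≤ (Spatial (a + N)).comap (Hom.pre a) := by
    clear hf f
    refine Submonoid.closure_le.2 fun g hg => ?_
    change id a ⊗ₗ g ∈ Spatial (a + _)
    induction hg with
    | phase φ => exact Spatial.last_phase a φ
    | last k hu =>
      rw [id_tensor_at2]
      exact Spatial.of_gen (.last (a + k) hu)
    | wk _ ih =>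
      rw [id_tensor_wk]
      exact Spatial.wk ih
  exact h hf

theorem Spatial.T {u : Hom 2 2} (hu : NF2 u) : Hom.T u ∈ Spatial 3 := by
  have h : Hom.T u = Hom.wk (at2 0 u) :=
    congrArg Hom.wk (eq_of_heq (id_zero_tensor u)).symm
  rw [h]
  exact Spatial.of_gen (.wk (.last 0 hu))

theorem Spatial.Bo {u : Hom 2 2} (hu : NF2 u) : Hom.Bo u ∈ Spatial 3 :=
  Spatial.of_gen (.last 1 hu)

theorem Spatial.inter : Hom.inter ∈ Spatial 4 :=
  Spatial.pre 1 (mul_mem (mul_mem (Spatial.T NF2_sw) (Spatial.Bo NF2_sw)) (Spatial.T NF2_sw))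

theorem Spatial.sym_two_two : sym 2 2 ∈ Spatial 4 := by
  have h : Hom.Bo sw * Hom.T sw ∈ Spatial 3 := mul_mem (Spatial.Bo NF2_sw) (Spatial.T NF2_sw)
  rw [Hom.sym_two_two]
  exact mul_mem (Spatial.wk h) (Spatial.pre 1 h)

/-! ### Words of vacuum-free circuits -/

/-- The generators of the vacuum-free circuits. -/
inductive VGen : (N : ℕ) → Hom N N → Prop
  | phase (k : ℕ) (φ : ℝ) : VGen (k + 1) (id k ⊗ₗ ph φ)
  | rot (k : ℕ) (θ : ℝ) : VGen (k + 1) (id k ⊗ₗ rot θ)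
  | pb (k : ℕ) : VGen (k + 2) (at2 k pb)
  | sw (k : ℕ) : VGen (k + 2) (at2 k sw)
  | wk {N : ℕ} {g : Hom N N} (hg : VGen N g) : VGen (N + 1) (wk g)

/-- The vacuum-free circuits. -/
def VWord (N : ℕ) : Submonoid (Hom N N) := Submonoid.closure {g | VGen N g}

theorem VWord.of_gen {N : ℕ} {g : Hom N N} (hg : VGen N g) : g ∈ VWord N :=
  Submonoid.subset_closure hg

theorem VWord.wk {N : ℕ} {f : Hom N N} (hf : f ∈ VWord N) : Hom.wk f ∈ VWord (N + 1) := by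
  have h : VWord N ≤ (VWord (N + 1)).comap Hom.wk :=
    Submonoid.closure_le.2 fun g hg => VWord.of_gen hg.wk
  exact h hf

theorem VWord.tensor_id {N : ℕ} {f : Hom N N} (hf : f ∈ VWord N) (b : ℕ) :
    f ⊗ₗ id b ∈ VWord (N + b) := by
  induction b with
  | zero => rwa [tensor_id_zero]
  | succ b ih =>
    rw [← id_tensor_id b 1, ← eq_of_heq (tensor_assoc f (id b) (id 1))]
    exact VWord.wk ih

theorem id_tensor_id_tensor (a k : ℕ) {n m : ℕ} (f : Hom n m) :
    HEq (id a ⊗ₗ (id k ⊗ₗ f)) (id (a + k) ⊗ₗ f) := by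
  rw [← id_tensor_id a k]
  exact (tensor_assoc (id a) (id k) f).symm

theorem VWord.pre (a : ℕ) {N : ℕ} {f : Hom N N} (hf : f ∈ VWord N) :
    id a ⊗ₗ f ∈ VWord (a + N) := by
  have h : VWord N ≤ (VWord (a + N)).comap (Hom.pre a) := by
    clear hf f
    refine Submonoid.closure_le.2 fun g hg => ?_
    change id a ⊗ₗ g ∈ VWord (a + _)
    induction hg with
    | phase k φ =>
      rw [eq_of_heq (id_tensor_id_tensor a k (ph φ))]
      exact VWord.of_gen (.phase (a + k) φ)
    | rot k θ =>
      rw [eq_of_heq (id_tensor_id_tensor a k (Hom.rot θ))]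
      exact VWord.of_gen (.rot (a + k) θ)
    | pb k =>
      rw [id_tensor_at2]
      exact VWord.of_gen (.pb (a + k))
    | sw k =>
      rw [id_tensor_at2]
      exact VWord.of_gen (.sw (a + k))
    | wk _ ih =>
      rw [id_tensor_wk]
      exact VWord.wk ih
  exact h hf

theorem VWord.tensor {a b : ℕ} {f : Hom a a} {g : Hom b b} (hf : f ∈ VWord a) (hg : g ∈ VWord b) :
    f ⊗ₗ g ∈ VWord (a + b) := by
  rw [tensor_eq_mul]
  exact mul_mem (VWord.tensor_id hf b) (VWord.pre a hg)

/-- A class of circuits that contains a vacuum-free word. -/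
def VHom {n m : ℕ} (f : Hom n m) : Prop := ∃ h : m = n, castH rfl h f ∈ VWord n

theorem VHom.of_mem {n : ℕ} {f : Hom n n} (hf : f ∈ VWord n) : VHom f := ⟨rfl, hf⟩

theorem VHom.mem {n : ℕ} {f : Hom n n} (hf : VHom f) : f ∈ VWord n := hf.2

theorem VHom.castH {n m n' m' : ℕ} {f : Hom n m} (hf : VHom f) (hn : n = n') (hm : m = m') :
    VHom (castH hn hm f) := by
  subst hn hm
  exact hf

theorem VHom.of_heq {n m n' m' : ℕ} {f : Hom n m} {g : Hom n' m'} (hf : VHom f) (hn : n = n')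
    (hm : m = m') (h : HEq g f) : VHom g := by
  subst hn hm
  rwa [eq_of_heq h]

theorem VHom.comp {a b c : ℕ} {f : Hom a b} {g : Hom b c} (hf : VHom f) (hg : VHom g) :
    VHom (f ≫ₗ g) := by
  obtain ⟨rfl, hf⟩ := hf
  obtain ⟨rfl, hg⟩ := hg
  exact ⟨rfl, mul_mem hf hg⟩

theorem VHom.tensor {a b c d : ℕ} {f : Hom a b} {g : Hom c d} (hf : VHom f) (hg : VHom g) :
    VHom (f ⊗ₗ g) := by
  obtain ⟨rfl, hf⟩ := hf
  obtain ⟨rfl, hg⟩ := hg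
  exact ⟨rfl, VWord.tensor hf hg⟩

theorem VHom.id (n : ℕ) : VHom (Hom.id n) := .of_mem (one_mem (VWord n))

theorem VHom.ph (φ : ℝ) : VHom (ph φ) := by
  refine .of_mem ?_
  rw [show Hom.ph φ = Hom.id 0 ⊗ₗ Hom.ph φ from (eq_of_heq (id_zero_tensor _)).symm]
  exact VWord.of_gen (.phase 0 φ)

theorem VHom.rot (θ : ℝ) : VHom (rot θ) := by
  refine .of_mem ?_
  rw [show Hom.rot θ = Hom.id 0 ⊗ₗ Hom.rot θ from (eq_of_heq (id_zero_tensor _)).symm]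
  exact VWord.of_gen (.rot 0 θ)

theorem VHom.pb : VHom pb := by
  refine .of_mem ?_
  rw [show Hom.pb = at2 0 Hom.pb from (eq_of_heq (id_zero_tensor Hom.pb)).symm]
  exact VWord.of_gen (.pb 0)

theorem VHom.sw : VHom sw := by
  refine .of_mem ?_
  rw [show Hom.sw = at2 0 Hom.sw from (eq_of_heq (id_zero_tensor Hom.sw)).symm]
  exact VWord.of_gen (.sw 0)

theorem VHom.bsp (θ : ℝ) : VHom (bsp θ) := by
  have hn : VHom (Hom.id 1 ⊗ₗ ng) := (VHom.id 1).tensor ((VHom.rot _).comp (VHom.ph _))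
  rw [bsp_eq]
  exact (((hn.comp VHom.pb).comp ((VHom.rot θ).tensor (VHom.rot θ))).comp VHom.pb).comp hn

/-- Symmetries are primitive terms, so the hexagons are needed to break them into adjacent swaps,
one argument at a time. -/
theorem VHom.sym_one (a : ℕ) : VHom (sym a 1) := by
  induction a with
  | zero => exact (VHom.id 1).of_heq rfl rfl (sym_zero_left 1)
  | succ a ih =>
    rw [sym_add_left]
    exact ((VHom.tensor (.id a) VHom.sw).castH _ _).comp ((ih.tensor (.id 1)).castH _ _)

theorem VHom.sym (a b : ℕ) : VHom (sym a b) := by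
  induction b with
  | zero => exact (VHom.id a).of_heq rfl (Nat.zero_add a).symm (sym_zero_right a)
  | succ b ih =>
    rw [sym_add_right]
    exact ((ih.tensor (.id 1)).castH _ _).comp ((VHom.tensor (.id b) (.sym_one a)).castH _ _)

theorem VHom.of_vacuumFree {n m : ℕ} (D : Circuit n m) (hD : D.VacuumFree) : VHom (mk D) := by
  induction D with
  | idn n => exact .id n
  | symmetry a b => exact .sym a b
  | comp _ _ ih ih' => exact (ih hD.1).comp (ih' hD.2)
  | tensor _ _ ih ih' => exact (ih hD.1).tensor (ih' hD.2)
  | source => exact hD.elim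
  | detector => exact hD.elim
  | phase φ => exact .ph φ
  | polrot θ => exact .rot θ
  | bs θ => exact .bsp θ
  | pbs => exact .pb

end Hom

namespace Hom

/-! ### Splitting all wires -/

/-- `split` on each of `n` wires. -/
def splits : (n : ℕ) → Hom n (2 * n)
  | 0 => id 0
  | n + 1 => splits n ⊗ₗ split

/-- `merge` on each of `n` pairs of wires. -/
def merges : (n : ℕ) → Hom (2 * n) n
  | 0 => id 0
  | n + 1 => merges n ⊗ₗ merge

theorem splits_comp_merges (n : ℕ) : splits n ≫ₗ merges n = id n := by
  induction n with
  | zero => exact id_comp _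
  | succ n ih =>
    have h := comp_tensor_comp (splits n) (merges n) split merge
    rw [ih, split_comp_merge, id_tensor_id] at h
    exact h.symm

theorem id_tensor_comp_splits {k : ℕ} {g : Hom 1 1} {u : Hom 2 2}
    (h : g ≫ₗ split = split ≫ₗ u) :
    (id k ⊗ₗ g : Hom (k + 1) (k + 1)) ≫ₗ splits (k + 1) = splits (k + 1) ≫ₗ at2 (2 * k) u := by
  have h1 := comp_tensor_comp (id k) (splits k) g split
  have h2 := comp_tensor_comp (splits k) (id (2 * k)) split u
  rw [id_comp, h] at h1
  rw [comp_id] at h2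
  exact h1.symm.trans h2

theorem splits_add_two (k : ℕ) : splits (k + 2) = splits k ⊗ₗ (split ⊗ₗ split : Hom 2 4) :=
  eq_of_heq (tensor_assoc (splits k) split split)

theorem at2_comp_splits {k : ℕ} {u : Hom 2 2} {w : Hom 4 4}
    (h : u ≫ₗ (split ⊗ₗ split : Hom 2 4) = (split ⊗ₗ split : Hom 2 4) ≫ₗ w) :
    at2 k u ≫ₗ splits (k + 2) = splits (k + 2) ≫ₗ pre (2 * k) w := by
  have h1 := comp_tensor_comp (id k) (splits k) u (split ⊗ₗ split : Hom 2 4)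
  have h2 := comp_tensor_comp (splits k) (id (2 * k)) (split ⊗ₗ split : Hom 2 4) w
  rw [id_comp, h] at h1
  rw [comp_id] at h2
  rw [splits_add_two]
  exact h1.symm.trans h2

theorem wk_comp_splits {n : ℕ} {g : Hom n n} {g' : Hom (2 * n) (2 * n)}
    (h : g ≫ₗ splits n = splits n ≫ₗ g') :
    wk g ≫ₗ splits (n + 1) = splits (n + 1) ≫ₗ wk (wk g') := by
  have h1 := comp_tensor_comp g (splits n) (id 1) split
  have h2 := comp_tensor_comp (splits n) g' split (id 2)
  rw [id_comp, h] at h1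
  rw [comp_id] at h2
  rw [wk_wk]
  exact h1.symm.trans h2

theorem VGen.exists_spatial {n : ℕ} {g : Hom n n} (hg : VGen n g) :
    ∃ g' ∈ Spatial (2 * n), g ≫ₗ splits n = splits n ≫ₗ g' := by
  induction hg with
  | phase k φ =>
    refine ⟨_, Spatial.of_gen (.last (2 * k) ?_), id_tensor_comp_splits (ph_comp_split φ)⟩
    rw [ph_tensor_ph]
    exact (NF2_p0 φ).mul (NF2_p1 φ)
  | rot k θ =>
    exact ⟨_, Spatial.of_gen (.last (2 * k) (NF2_bsp θ)), id_tensor_comp_splits (rot_comp_split θ)⟩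
  | pb k =>
    exact ⟨_, Spatial.pre (2 * k) Spatial.inter, at2_comp_splits pb_comp_split_tensor_split⟩
  | sw k =>
    exact ⟨_, Spatial.pre (2 * k) Spatial.sym_two_two, at2_comp_splits sw_comp_split_tensor_split⟩
  | wk _ ih =>
    obtain ⟨g', hg', h⟩ := ih
    exact ⟨_, Spatial.wk (Spatial.wk hg'), wk_comp_splits h⟩

theorem VWord.exists_spatial {n : ℕ} {f : Hom n n} (hf : f ∈ VWord n) :
    ∃ f' ∈ Spatial (2 * n), f ≫ₗ splits n = splits n ≫ₗ f' := by
  induction hf using Submonoid.closure_induction with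
  | mem g hg => exact hg.exists_spatial
  | one => exact ⟨1, one_mem _, (id_comp _).trans (comp_id _).symm⟩
  | mul f g _ _ ih ih' =>
    obtain ⟨f', hf', h⟩ := ih
    obtain ⟨g', hg', h'⟩ := ih'
    refine ⟨f' * g', mul_mem hf' hg', ?_⟩
    rw [mul_def, mul_def, comp_assoc, h', ← comp_assoc, h, comp_assoc]

/-! ### The image of the splitting circuits. -/

theorem sem_id_tensor_src_zero (x : State 1) (c : Pol) :
    sem (id 1 ⊗ₗ src : Hom 1 2) x (c, 0) = x (c, 0) :=
  congrFun (topL_sem_tensor (id 1) src x) (c, 0)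

theorem sem_id_tensor_src_one (x : State 1) (c : Pol) :
    sem (id 1 ⊗ₗ src : Hom 1 2) x (c, 1) = 0 :=
  congrFun (botL_sem_tensor (id 1) src x) (c, 0)

theorem sem_split_zero (x : State 1) (c : Pol) : sem split x (c, 0) =
    interp pbs (sem (id 1 ⊗ₗ src : Hom 1 2) x) (c, 0) := by
  rw [split, sem_comp, sem_comp]
  exact congrFun (topL_sem_tensor (id 1) ng _) (c, 0)

theorem sem_split_one (x : State 1) (c : Pol) : sem split x (c, 1) =
    interp neg (botL 1 1 (interp pbs (sem (id 1 ⊗ₗ src : Hom 1 2) x))) (c, 0) := by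
  rw [split, sem_comp, sem_comp]
  exact congrFun (botL_sem_tensor (id 1) ng _) (c, 0)

theorem sem_split_V_zero (x : State 1) : sem split x (Pol.V, 0) = x (Pol.V, 0) := by
  rw [sem_split_zero, interp_pbs_V, sem_id_tensor_src_zero]

theorem sem_split_V_one (x : State 1) : sem split x (Pol.V, 1) = x (Pol.H, 0) := by
  rw [sem_split_one, interp_neg_V]
  exact (interp_pbs_H _ 1).trans (sem_id_tensor_src_zero x Pol.H)

theorem sem_split_H (x : State 1) (i : Fin 2) : sem split x (Pol.H, i) = 0 := by
  fin_cases i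
  · exact (sem_split_zero x Pol.H).trans ((interp_pbs_H _ 0).trans (sem_id_tensor_src_one x Pol.H))
  · refine (sem_split_one x Pol.H).trans ?_
    rw [interp_neg_H]
    exact (interp_pbs_V _ 1).trans (sem_id_tensor_src_one x Pol.V)

theorem exists_sem_split_eq (i : Fin 2) : ∃ x, sem split x = ket (Pol.V, i) := by
  fin_cases i
  · refine ⟨ket (Pol.V, 0), ?_⟩
    funext ⟨c, p⟩
    cases c
    · fin_cases p
      · exact (sem_split_V_zero _).trans (by simp [ket_apply])
      · exact (sem_split_V_one _).trans (by simp [ket_apply])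
    · exact (sem_split_H _ p).trans (by simp [ket_apply])
  · refine ⟨ket (Pol.H, 0), ?_⟩
    funext ⟨c, p⟩
    cases c
    · fin_cases p
      · exact (sem_split_V_zero _).trans (by simp [ket_apply])
      · exact (sem_split_V_one _).trans (by simp [ket_apply])
    · exact (sem_split_H _ p).trans (by simp [ket_apply])

/-- Surjectivity onto vertical states is what transfers the hypothesis on the n-wire circuits to
their spatial translations; horizontal inputs are never tested. -/
theorem exists_sem_splits_eq (n : ℕ) (i : Fin (2 * n)) :
    ∃ x, sem (splits n) x = ket (Pol.V, i) := by
  induction n with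
  | zero => exact i.elim0
  | succ n ih =>
    change Fin (2 * n + 2) at i
    change ∃ x : State (n + 1), sem (splits n ⊗ₗ split) x = ket (Pol.V, i)
    refine Fin.addCases (fun j => ?_) (fun j => ?_) i
    · obtain ⟨x, hx⟩ := ih j
      refine ⟨inclTop n 1 x, state_ext ?_ ?_⟩
      · rw [topL_sem_tensor, topL_inclTop, hx, topL_ket_castAdd]
      · rw [botL_sem_tensor, botL_inclTop, map_zero, botL_ket_castAdd]
    · obtain ⟨x, hx⟩ := exists_sem_split_eq j
      refine ⟨shift n 1 x, state_ext ?_ ?_⟩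
      · rw [topL_sem_tensor, topL_shift, map_zero, topL_ket_natAdd]
      · rw [botL_sem_tensor, botL_shift, hx, botL_ket_natAdd]

theorem VWord.ext {n : ℕ} {f g : Hom n n} (hf : f ∈ VWord n) (hg : g ∈ VWord n)
    (h : sem f = sem g) : f = g := by
  obtain ⟨f', hf', ef⟩ := VWord.exists_spatial hf
  obtain ⟨g', hg', eg⟩ := VWord.exists_spatial hg
  have h' : f' = g' := by
    refine Spatial.ext hf' hg' fun i => ?_
    obtain ⟨x, hx⟩ := exists_sem_splits_eq n i
    rw [← hx, ← sem_comp, ← sem_comp, ← ef, ← eg, sem_comp, sem_comp, h]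
  rw [← comp_id f, ← comp_id g, ← splits_comp_merges, ← comp_assoc, ef, h', ← eg, comp_assoc]

end Hom

end LOv

theorem mainTheorem8 {n m : ℕ} (D₁ D₂ : LOv.Circuit n m)
    (h₁ : D₁.VacuumFree) (h₂ : D₂.VacuumFree) (h : LOv.interp D₁ = LOv.interp D₂) :
    LOv.Provable D₁ D₂ := by
  -- Vacuum-free circuits have as many outputs as inputs, so both circuits become elements of one
  -- monoid.
  obtain ⟨rfl, -⟩ := LOv.Hom.VHom.of_vacuumFree D₁ h₁
  exact LOv.Hom.mk_eq_mk.1 (LOv.Hom.VWord.ext (LOv.Hom.VHom.of_vacuumFree D₁ h₁).mem (LOv.Hom.VHom.of_vacuumFree D₂ h₂).mem h)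

end
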